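/- **Setting.** Let $\mathcal X\subset\mathbb R^d$, let $p,q$ be probability laws on $\mathcal X$ (train and test covariates), and let $w(\cdot\mid x)$ be a conditional law on $\mathbb R$, common to both populations, so that $(X,Y)$ has law $p(dx)\,w(dy\mid x)$ and $(\widetilde X,\widetilde Y)$ has law $q(dx)\,w(dy\mid x)$; $\mathbb E_p,\mathbb E_q$ are the corresponding expectations. Put $f_0(x)=\mathbb E[Y\mid X=x]=\int y\,w(dy\mid x)$ and $\sigma^2(x)=\mathrm{Var}(Y\mid X=x)$. Let $\mathcal G=\{g_\beta:\beta\in\Theta\}$ be a parametric model with $\Theta\subset\mathbb R^k$ compact, each $g_\beta:\mathcal X\to\mathbb R$ measurable, and $\beta\mapsto g_\beta(x)$ continuous on $\Theta$ and twice differentiable in the interior of $\Theta$ for every $x$; write $\dot g_\beta,\ddot g_\beta$ for the gradient and Hessian in $\beta$. **Data and estimator.** Fix $\rho>0$ and let $n\to\infty$ along even integers for which $m=\rho n$ is an even integer. At each stage one observes $n$ i.i.d. copies of $(Y,X)$ and, independently, $m$ i.i.d. copies of $\widetilde X$, split into two folds $\{(Y_{(i,\ell)},X_{(i,\ell)})\}_{i\le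 n/2}$, $\{\widetilde X_{(j,\ell)}\}_{j\le m/2}$, $\ell\in\{1,2\}$. For each $\ell$, $\widehat f_{(-\ell)}$ and $\widehat r_{(-\ell)}$ are real functions on $\mathcal X$ computed (measurably) from the data of the fold other than $\ell$. Let $$\widehat{\mathcal R}_{(\ell)}(\beta)=\frac{2}{n}\sum_{i=1}^{n/2}\Big\{\big(Y_{(i,\ell)}-g_\beta(X_{(i,\ell)})\big)^2-\big(\widehat f_{(-\ell)}(X_{(i,\ell)})-g_\beta(X_{(i,\ell)})\big)^2\Big\}\widehat r_{(-\ell)}(X_{(i,\ell)})+\frac{2}{m}\sum_{j=1}^{m/2}\big(\widehat f_{(-\ell)}(\widetilde X_{(j,\ell)})-g_\beta(\widetilde X_{(j,\ell)})\big)^2,$$ and let $\widehat\beta^{\mathrm{DR}}$ be a (measurable) minimizer over $\Theta$ of $\widehat{\mathcal R}=\widehat{\mathcal R}_{(1)}+\widehat{\mathcal R}_{(2)}$. **Assumptions.** 1. (Bounded data) There is $C>0$ such that $|Y|,|\widetilde Y|$ and all coordinates of $X,\widetilde X$ are almost surely smaller than $C$ in absolute value. 2. (Bounded density ratio) $q$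 has a density $r=r_0=dq/dp$ with respect to $p$, with $0\le r_0(x)<C_r<\infty$ for all $x\in\mathcal X$. 3. (Unique minimizer) The test risk $\beta\mapsto\mathbb E_q[(\widetilde Y-g_\beta(\widetilde X))^2]$ has a unique minimizer $\widetilde\beta_0$ over $\Theta$, and $\widetilde\beta_0$ is an interior point of $\Theta$. 4. (Bounded model) $g_\beta(x)$ is bounded uniformly in $(\beta,x)\in\Theta\times\mathcal X$, and $\dot g_{\widetilde\beta_0}(x)$, $\ddot g_{\widetilde\beta_0}(x)$ are bounded uniformly in $x\in\mathcal X$. 5. (Hessian limit) There is an invertible $k\times k$ matrix $D$ such that, for every sequence of random vectors $\beta_n^*$ in the interior of $\Theta$ with $\beta_n^*\to\widetilde\beta_0$ in probability, each entry of the Hessian matrix of $\widehat{\mathcal R}$ at $\beta_n^*$ converges in probability to the corresponding entry of $D^\top$. 6. (Nuisance convergence) With $\|\cdot\|_2$ the norm of $L^2(p)$, for $\ell\in\{1,2\}$: $\|\widehat r_{(-\ell)}-r_0\|_2=o_p(1)$, $\|\widehat f_{(-\ell)}-f_0\|_2=o_p(1)$ and $\|\widehat r_{(-\ell)}-r_0\|_2\,\|\widehat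 f_{(-\ell)}-f_0\|_2=o_p(\min\{n,m\}^{-1/2})$. 7. (Correct specification) $f_0\in\mathcal G$, that is, $f_0=g_\beta$ $p$-almost everywhere for some $\beta\in\Theta$. **Theorem.** Let $\beta_0$ be a minimizer over $\Theta$ of the train risk $\beta\mapsto\mathbb E_p[(Y-g_\beta(X))^2]$. Then $\mathbb E_q[\dot g_{\beta_0}(\widetilde X)\dot g_{\beta_0}(\widetilde X)^\top]$ is invertible and $$\sqrt n\,\big(\beta_0-\widehat\beta^{\mathrm{DR}}\big)\xrightarrow{d}\mathcal N(0,\Omega),$$ $$\Omega=\mathbb E_q\big[\dot g_{\beta_0}(\widetilde X)\dot g_{\beta_0}(\widetilde X)^\top\big]^{-1}\,\mathbb E_q\big[\sigma^2(\widetilde X)\,r(\widetilde X)\,\dot g_{\beta_0}(\widetilde X)\dot g_{\beta_0}(\widetilde X)^\top\big]\,\mathbb E_q\big[\dot g_{\beta_0}(\widetilde X)\dot g_{\beta_0}(\widetilde X)^\top\big]^{-1}.$$ -/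

import Mathlib

open MeasureTheory ProbabilityTheory Filter Topology
open scoped ENNReal

/-! Covariate shift: the covariate has law `p` (train) or `q` (test) on a space `𝒳`, and the outcome
given the covariate has the same conditional law `w` in both populations, so that the joint laws of
(covariate, outcome) are `p ⊗ₘ w` and `q ⊗ₘ w`. -/

noncomputable section

namespace CovariateShift

/-- `i`-th partial derivative of a real function on `ℝᵏ`. -/
def pderiv {k : ℕ} (i : Fin k) (F : EuclideanSpace ℝ (Fin k) → ℝ)
    (β : EuclideanSpace ℝ (Fin k)) : ℝ :=
  fderiv ℝ F β (EuclideanSpace.single i 1)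

/-- Hessian matrix (Jacobian matrix of the gradient) of a real function on `ℝᵏ`. -/
def hess {k : ℕ} (F : EuclideanSpace ℝ (Fin k) → ℝ) (β : EuclideanSpace ℝ (Fin k)) :
    Matrix (Fin k) (Fin k) ℝ :=
  Matrix.of fun i j => pderiv j (pderiv i F) β

/-- `F` is twice differentiable at `β`. -/
def TwiceDifferentiableAt {k : ℕ} (F : EuclideanSpace ℝ (Fin k) → ℝ)
    (β : EuclideanSpace ℝ (Fin k)) : Prop :=
  DifferentiableAt ℝ F β ∧ DifferentiableAt ℝ (fderiv ℝ F) β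

/-- `β` is a minimizer of `F` over `Θ`. -/
def IsArgmin {k : ℕ} (F : EuclideanSpace ℝ (Fin k) → ℝ) (Θ : Set (EuclideanSpace ℝ (Fin k)))
    (β : EuclideanSpace ℝ (Fin k)) : Prop :=
  β ∈ Θ ∧ ∀ β' ∈ Θ, F β ≤ F β'

/-- `Z N = o_p(1)` as `N → ∞`, for `[0, ∞]`-valued `Z N`. -/
def IsLittleOpOne {Ω : Type*} [MeasurableSpace Ω] (P : Measure Ω) (Z : ℕ → Ω → ℝ≥0∞) : Prop :=
  ∀ ε : ℝ≥0∞, 0 < ε → Tendsto (fun N => P {ω | ε ≤ Z N ω}) atTop (𝓝 0)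

section Population

variable {𝒳 : Type*} [MeasurableSpace 𝒳] {k : ℕ}

/-- The regression function `f₀ x = E[Y | X = x]`. -/
def regressionFn (w : Kernel 𝒳 ℝ) (x : 𝒳) : ℝ := ∫ y, y ∂(w x)

/-- The conditional variance `σ² x = Var[Y | X = x]`. -/
def condVar (w : Kernel 𝒳 ℝ) (x : 𝒳) : ℝ := ∫ y, (y - regressionFn w x) ^ 2 ∂(w x)

/-- Population risk `E[(Y - g_β(X))²]` when `X` has law `μ` and `Y` given `X` has law `w`. -/
def popRisk (μ : Measure 𝒳) (w : Kernel 𝒳 ℝ) (g : EuclideanSpace ℝ (Fin k) → 𝒳 → ℝ)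
    (β : EuclideanSpace ℝ (Fin k)) : ℝ :=
  ∫ z, (z.2 - g β z.1) ^ 2 ∂(μ ⊗ₘ w)

/-- The matrix `E_q[s(X̃) ġ_β(X̃) ġ_β(X̃)ᵀ]`, where `X̃` has law `q` and `ġ_β` is the gradient of `g`
in the parameter. -/
def gramMatrix (q : Measure 𝒳) (g : EuclideanSpace ℝ (Fin k) → 𝒳 → ℝ)
    (β : EuclideanSpace ℝ (Fin k)) (s : 𝒳 → ℝ) : Matrix (Fin k) (Fin k) ℝ :=
  Matrix.of fun i j =>
    ∫ x, s x * (pderiv i (fun b => g b x) β * pderiv j (fun b => g b x) β) ∂q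

/-- `Ω = E_q[ġ ġᵀ]⁻¹ E_q[σ² r₀ ġ ġᵀ] E_q[ġ ġᵀ]⁻¹`. -/
def asymptoticCov (q : Measure 𝒳) (w : Kernel 𝒳 ℝ) (r₀ : 𝒳 → ℝ)
    (g : EuclideanSpace ℝ (Fin k) → 𝒳 → ℝ) (β : EuclideanSpace ℝ (Fin k)) :
    Matrix (Fin k) (Fin k) ℝ :=
  (gramMatrix q g β fun _ => 1)⁻¹ * gramMatrix q g β (fun x => condVar w x * r₀ x) *
    (gramMatrix q g β fun _ => 1)⁻¹

end Population

section Sample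

variable {𝒳 : Type*} {k a b : ℕ}

/-- The doubly robust empirical risk on one fold with labelled data `z i = (X_i, Y_i)` and
unlabelled data `t j`, for given nuisance functions `f` and `r`. -/
def foldRisk (g : EuclideanSpace ℝ (Fin k) → 𝒳 → ℝ) (f r : 𝒳 → ℝ)
    (z : Fin a → 𝒳 × ℝ) (t : Fin b → 𝒳) (β : EuclideanSpace ℝ (Fin k)) : ℝ :=
  (1 / (a : ℝ)) * ∑ i, (((z i).2 - g β (z i).1) ^ 2 - (f (z i).1 - g β (z i).1) ^ 2) * r (z i).1 +
    (1 / (b : ℝ)) * ∑ j, (f (t j) - g β (t j)) ^ 2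

/-- The two-fold cross-fitted risk: the folds are `0, 1 : Fin 2`, fold `ℓ` carries the labelled data
`z ℓ` and the unlabelled data `t ℓ`, and the nuisance estimators `f ℓ`, `r ℓ` that are used on fold
`ℓ` are computed from the data of the other fold `1 - ℓ`. -/
def crossFitRisk (g : EuclideanSpace ℝ (Fin k) → 𝒳 → ℝ)
    (f r : Fin 2 → (Fin a → 𝒳 × ℝ) → (Fin b → 𝒳) → 𝒳 → ℝ)
    (z : Fin 2 → Fin a → 𝒳 × ℝ) (t : Fin 2 → Fin b → 𝒳)
    (β : EuclideanSpace ℝ (Fin k)) : ℝ :=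
  ∑ ℓ, foldRisk g (f ℓ (z (1 - ℓ)) (t (1 - ℓ))) (r ℓ (z (1 - ℓ)) (t (1 - ℓ))) (z ℓ) (t ℓ) β

end Sample

end CovariateShift

end

/-! Correct specification makes the population minimizers agree: `f₀ = g β₀` holds `p`-a.e., hence
`q`-a.e. because `q ≪ p`, so `β₀` minimizes the test risk and equals `βt`. Put `m = g β₀`. The
squares of `g β` cancel in the labelled part of the empirical risk, so its increment from `β₀` is
`-2 * score` in the direction `g β - m` plus a test average of `(g β - m)²`. Its gradient at `β₀` is
`-2 * score` in the directions `∂ᵢg`, summed over the folds.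

The heart of the proof is that `√n * score` is asymptotically unaffected by nuisance estimation
(`isLittleOpOne_sqrt_mul_score_sub`). Subtracting the oracle average of `u (Y - m) r₀` leaves three
errors. The first, an average of `u (Y - m) (r̂ - r₀)`, is centred given the other fold. The second,
an average of `u (f̂ - m) (r̂ - r₀)`, is controlled by the product rate. The third is the difference
between a test average of `u (f̂ - m)` and a train average of `u r₀ (f̂ - m)`, whose means agree
because `dq = r₀ dp`. Cross-fitting makes the nuisances independent of the averaged sample, so
conditional Markov and Chebyshev bounds suffice and no empirical process theory enters. In the limit
the unlabelled sample adds no variance.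

Consistency (`isLittleOpOne_argmin_sub`) comes from a lower bound on the excess risk that is uniform
on small neighbourhoods, followed by a finite subcover of `Θ` away from `β₀`. A mean value expansion
of each partial derivative then expresses the gradient at `β₀` through Hessian entries at
intermediate points. These points must be measurable for the Hessian hypothesis to apply, which is
the purpose of the selection lemmas. A perturbation bound (`abs_sub_inv_mulVec_le`) gives `β₀ - β̂ ≈
(Dᵀ)⁻¹ ∇risk`.

Feeding the constant sequence `β₀` to the Hessian hypothesis identifies `Dᵀ = 4 G`, where `G = E_q[ġ
ġᵀ]`; this proves that `G` is invertible. Thus `√n (β₀ - β̂)` is asymptotically `-G⁻¹` times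
`n^{-1/2}` times the sum of the oracle vectors over all labelled data. The multivariate CLT gives
the covariance `G⁻¹ W G⁻¹`, with `W = E_q[σ² r₀ ġ ġᵀ]`. -/

noncomputable section
namespace CovariateShift

/-! ### Calculus of `o_p(1)` for `[0, ∞]`-valued variables -/

section LittleOp

variable {Ω : Type*} [MeasurableSpace Ω] {P : Measure Ω} {A B : ℕ → Ω → ℝ≥0∞}

/-- Larger thresholds give smaller events, so the threshold `∞` is dominated by the threshold `1`.
Later proofs may therefore divide by `ε`. -/
lemma IsLittleOpOne.of_ne_top
    (h : ∀ ε : ℝ≥0∞, 0 < ε → ε ≠ ∞ → Tendsto (fun N => P {ω | ε ≤ A N ω}) atTop (𝓝 0)) :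
    IsLittleOpOne P A := by
  intro ε hε
  refine tendsto_of_tendsto_of_tendsto_of_le_of_le tendsto_const_nhds
    (h (min ε 1) (lt_min hε one_pos) (by simp)) (fun _ => zero_le) fun N => ?_
  exact measure_mono fun ω (hω : ε ≤ A N ω) => (min_le_left _ _).trans hω

/-- Only monotonicity and subadditivity of `P` on arbitrary sets enter this calculus, so the basic
rules need no measurability of the variables. -/
lemma IsLittleOpOne.mono_ae (hB : IsLittleOpOne P B)
    (h : ∀ᶠ N in atTop, ∀ᵐ ω ∂P, A N ω ≤ B N ω) : IsLittleOpOne P A := by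
  intro ε hε
  refine tendsto_of_tendsto_of_tendsto_of_le_of_le' tendsto_const_nhds (hB ε hε)
    (Eventually.of_forall fun _ => zero_le) ?_
  filter_upwards [h] with N hN
  refine measure_mono_ae ?_
  filter_upwards [hN] with ω hω h'
  exact le_trans h' hω

lemma IsLittleOpOne.mono (hB : IsLittleOpOne P B) (h : ∀ N ω, A N ω ≤ B N ω) :
    IsLittleOpOne P A :=
  hB.mono_ae (Eventually.of_forall fun N => ae_of_all _ (h N))

lemma IsLittleOpOne.add (hA : IsLittleOpOne P A) (hB : IsLittleOpOne P B) :
    IsLittleOpOne P fun N ω => A N ω + B N ω := by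
  intro ε hε
  have h := (hA (ε / 2) (ENNReal.half_pos hε.ne')).add (hB (ε / 2) (ENNReal.half_pos hε.ne'))
  rw [add_zero] at h
  refine tendsto_of_tendsto_of_tendsto_of_le_of_le tendsto_const_nhds h (fun _ => zero_le)
    fun N => (measure_mono fun ω hω => ?_).trans (measure_union_le _ _)
  by_contra hcon
  simp only [Set.mem_union, Set.mem_ofPred_eq, not_or, not_le] at hcon
  have := ENNReal.add_lt_add hcon.1 hcon.2
  rw [ENNReal.add_halves] at this
  exact absurd hω (not_le.2 this)

lemma IsLittleOpOne.zero : IsLittleOpOne P fun _ _ => 0 := by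
  intro ε hε
  simp [hε.not_ge]

lemma IsLittleOpOne.sum {ι : Type*} (s : Finset ι) {A : ι → ℕ → Ω → ℝ≥0∞}
    (h : ∀ i ∈ s, IsLittleOpOne P (A i)) : IsLittleOpOne P fun N ω => ∑ i ∈ s, A i N ω := by
  classical
  induction s using Finset.induction_on with
  | empty => simpa using IsLittleOpOne.zero
  | insert i s hi ih =>
    simp_rw [Finset.sum_insert hi]
    exact (h i (by simp)).add (ih fun j hj => h j (by simp [hj]))

lemma IsLittleOpOne.const_mul (hA : IsLittleOpOne P A) {c : ℝ≥0∞} (hc : c ≠ ∞) :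
    IsLittleOpOne P fun N ω => c * A N ω := by
  refine IsLittleOpOne.of_ne_top fun ε hε hε' => ?_
  rcases eq_or_ne c 0 with rfl | h0
  · simp [hε.not_ge]
  refine tendsto_of_tendsto_of_tendsto_of_le_of_le tendsto_const_nhds
    (hA (ε / c) (ENNReal.div_pos hε.ne' hc)) (fun _ => zero_le) fun N =>
      measure_mono fun ω hω => ?_
  simp only [Set.mem_ofPred_eq] at hω ⊢
  rw [ENNReal.div_le_iff h0 hc, mul_comm]
  exact hω

/-- It suffices to bound on events whose complements have vanishing probability. -/
lemma IsLittleOpOne.of_event (hB : IsLittleOpOne P B) {s : ℕ → Set Ω}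
    (hs : Tendsto (fun N => P (s N)ᶜ) atTop (𝓝 0))
    (h : ∀ N, ∀ ω ∈ s N, A N ω ≤ B N ω) : IsLittleOpOne P A := by
  intro ε hε
  have h2 := (hB ε hε).add hs
  rw [add_zero] at h2
  refine tendsto_of_tendsto_of_tendsto_of_le_of_le tendsto_const_nhds h2 (fun _ => zero_le)
    fun N => (measure_mono fun ω hω => ?_).trans (measure_union_le _ _)
  by_cases hωs : ω ∈ s N
  · exact Or.inl (le_trans hω (h N ω hωs))
  · exact Or.inr hωs

lemma IsLittleOpOne.of_sq {X : ℕ → Ω → ℝ≥0∞} (h : IsLittleOpOne P fun N ω => X N ω ^ 2) :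
    IsLittleOpOne P X := by
  intro ε hε
  refine tendsto_of_tendsto_of_tendsto_of_le_of_le tendsto_const_nhds
    (h (ε ^ 2) (pos_iff_ne_zero.2 (pow_ne_zero 2 hε.ne'))) (fun _ => zero_le) fun N => measure_mono fun ω (hω : ε ≤ X N ω) => ?_
  exact pow_le_pow_left' hω 2

lemma IsLittleOpOne.sq {X : ℕ → Ω → ℝ≥0∞} (h : IsLittleOpOne P X) :
    IsLittleOpOne P fun N ω => X N ω ^ 2 := by
  refine IsLittleOpOne.of_ne_top fun ε hε hε' => ?_
  refine tendsto_of_tendsto_of_tendsto_of_le_of_le tendsto_const_nhds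
    (h (min ε 1) (lt_min hε one_pos)) (fun _ => zero_le) fun N => measure_mono fun ω hω => ?_
  simp only [Set.mem_ofPred_eq] at hω ⊢
  by_contra hcon
  push Not at hcon
  have h1 : X N ω ^ 2 < ε := by
    calc X N ω ^ 2 = X N ω * X N ω := pow_two _
      _ ≤ X N ω * 1 := by gcongr; exact (hcon.trans_le (min_le_right _ _)).le
      _ < ε := by rw [mul_one]; exact hcon.trans_le (min_le_left _ _)
  exact absurd hω (not_le.2 h1)

/-- A sequence bounded in `L²` times an `o_p(1)` sequence is `o_p(1)`. -/
lemma IsLittleOpOne.mul_of_lintegral_sq_le {X : ℕ → Ω → ℝ≥0∞} (hA : IsLittleOpOne P A)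
    (hX : ∀ N, AEMeasurable (X N) P) {c : ℝ≥0∞} (hc : c ≠ ∞)
    (h : ∀ᶠ N in atTop, ∫⁻ ω, X N ω ^ 2 ∂P ≤ c) :
    IsLittleOpOne P fun N ω => A N ω * X N ω := by
  refine IsLittleOpOne.of_ne_top fun ε hε hε' => ?_
  rw [ENNReal.tendsto_nhds_zero]
  intro η hη
  -- `M` is a truncation level for `X N`: by Chebyshev, the tail beyond `M` has probability at most
  -- `c / M ^ 2 ≤ η / 2`, uniformly in large `N`.
  obtain ⟨M, hM0, hM⟩ : ∃ M : ℝ≥0∞, 0 < M ∧ M ≠ ∞ ∧ c / M ^ 2 ≤ η / 2 := by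
    have ht : Tendsto (fun n : ℕ => c / ((n : ℝ≥0∞) + 1) ^ 2) atTop (𝓝 0) := by
      have h1 : Tendsto (fun n : ℕ => c / ((n + 1 : ℕ) : ℝ≥0∞)) atTop (𝓝 0) := by
        have := (ENNReal.tendsto_inv_nat_nhds_zero.comp (tendsto_add_atTop_nat 1))
        simpa [div_eq_mul_inv] using ENNReal.Tendsto.const_mul this (Or.inr hc)
      refine tendsto_of_tendsto_of_tendsto_of_le_of_le tendsto_const_nhds h1
        (fun _ => zero_le) fun n => ?_
      gcongr
      push_cast
      exact le_self_pow (by simp) (by norm_num)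
    obtain ⟨n, hn⟩ := ((ENNReal.tendsto_nhds_zero.1 ht) (η / 2) (ENNReal.half_pos hη.ne')).exists
    exact ⟨n + 1, by positivity, by simp, hn⟩
  have h2 := (ENNReal.tendsto_nhds_zero.1 (hA (ε / M) (ENNReal.div_pos hε.ne' hM.1)))
    (η / 2) (ENNReal.half_pos hη.ne')
  filter_upwards [h, h2] with N hN hN2
  calc P {ω | ε ≤ A N ω * X N ω}
      ≤ P ({ω | ε / M ≤ A N ω} ∪ {ω | M ^ 2 ≤ X N ω ^ 2}) := by
        refine measure_mono fun ω hω => ?_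
        by_contra hcon
        simp only [Set.mem_union, Set.mem_ofPred_eq, not_or, not_le] at hcon
        have h3 : X N ω ≤ M := by
          by_contra h4
          exact absurd (pow_le_pow_left' (not_le.1 h4).le 2) (not_le.2 hcon.2)
        have h4 : A N ω * X N ω < ε := by
          calc A N ω * X N ω ≤ A N ω * M := by gcongr
            _ < ε := by
              rw [← ENNReal.lt_div_iff_mul_lt (Or.inl hM0.ne') (Or.inl hM.1)]
              exact hcon.1
        exact absurd hω (not_le.2 h4)
    _ ≤ η / 2 + c / M ^ 2 := by
        refine (measure_union_le _ _).trans (add_le_add hN2 ?_)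
        refine (meas_ge_le_lintegral_div ((hX N).pow_const 2) (pow_ne_zero 2 hM0.ne')
          (ENNReal.pow_ne_top hM.1)).trans ?_
        gcongr
    _ ≤ η / 2 + η / 2 := add_le_add le_rfl hM.2
    _ = η := ENNReal.add_halves η

/-- The product is at most the square of the larger factor, hence at most the sum of the squares. -/
lemma IsLittleOpOne.mul (hA : IsLittleOpOne P A) (hB : IsLittleOpOne P B) :
    IsLittleOpOne P fun N ω => A N ω * B N ω := by
  refine (hA.sq.add hB.sq).mono fun N ω => ?_
  rcases le_total (A N ω) (B N ω) with h | h
  · calc A N ω * B N ω ≤ B N ω * B N ω := by gcongr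
      _ ≤ _ := by rw [← pow_two]; exact le_add_self
  · calc A N ω * B N ω ≤ A N ω * A N ω := by gcongr
      _ ≤ _ := by rw [← pow_two]; exact le_self_add

lemma isLittleOpOne_of_tendsto {c : ℕ → ℝ≥0∞} (hc : Tendsto c atTop (𝓝 0)) :
    IsLittleOpOne P fun N _ => c N := by
  intro ε hε
  refine tendsto_const_nhds.congr' ?_
  filter_upwards [hc.eventually (gt_mem_nhds hε)] with N hN
  simp [not_le.2 hN]

lemma tendstoInMeasure_iff_isLittleOpOne {E : Type*} [SeminormedAddCommGroup E]
    {X : ℕ → Ω → E} {Y : Ω → E} :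
    TendstoInMeasure P X atTop Y ↔ IsLittleOpOne P fun N ω => ‖X N ω - Y ω‖ₑ := by
  simp only [TendstoInMeasure, IsLittleOpOne, edist_eq_enorm_sub]

end LittleOp

/-! ### Markov bounds conditional on an independent variable -/

section Conditioning

variable {Ω : Type*} [MeasurableSpace Ω] {P : Measure Ω} [IsProbabilityMeasure P]

/-- Markov's inequality conditionally on an independent variable. -/
lemma measure_le_of_indepFun {E V : Type*} [MeasurableSpace E] [MeasurableSpace V]
    {Z : Ω → E} {T : Ω → V} (hZ : Measurable Z) (hT : Measurable T) (hind : IndepFun Z T P)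
    {φ : E → V → ℝ≥0∞} (hφ : Measurable (Function.uncurry φ)) {ε : ℝ≥0∞} (hε : ε ≠ 0)
    (hε' : ε ≠ ∞) (δ : ℝ≥0∞) {κ : Ω → ℝ≥0∞}
    (hκ : ∀ ω, ∫⁻ v, φ (Z ω) v ∂(P.map T) ≤ κ ω) :
    P {ω | ε ≤ φ (Z ω) (T ω)} ≤ P {ω | δ ≤ κ ω} + δ / ε := by
  have hpT : IsProbabilityMeasure (P.map T) := Measure.isProbabilityMeasure_map hT.aemeasurable
  have hpZ : IsProbabilityMeasure (P.map Z) := Measure.isProbabilityMeasure_map hZ.aemeasurable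
  have hs : MeasurableSet {v : E × V | ε ≤ φ v.1 v.2} := measurableSet_le measurable_const hφ
  have hmap := (indepFun_iff_map_prod_eq_prod_map_map hZ.aemeasurable hT.aemeasurable).1 hind
  have h1 : P {ω | ε ≤ φ (Z ω) (T ω)} = ∫⁻ ω, P.map T {v | ε ≤ φ (Z ω) v} ∂P := by
    calc P {ω | ε ≤ φ (Z ω) (T ω)}
        = P.map (fun ω => (Z ω, T ω)) {v : E × V | ε ≤ φ v.1 v.2} := by
          rw [Measure.map_apply (hZ.prodMk hT) hs]; rfl
      _ = ∫⁻ z, P.map T {v | ε ≤ φ z v} ∂(P.map Z) := by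
          rw [hmap, Measure.prod_apply hs]; rfl
      _ = _ := lintegral_map (measurable_measure_prodMk_left hs) hZ
  rw [h1]
  have hmeas : Measurable fun ω => P.map T {v | ε ≤ φ (Z ω) v} :=
    (measurable_measure_prodMk_left hs).comp hZ
  calc ∫⁻ ω, P.map T {v | ε ≤ φ (Z ω) v} ∂P
      -- The bound `κ` is not assumed measurable, so its exceptional event is replaced by a
      -- measurable hull of equal measure. Off the hull, Markov's inequality holds with conditional
      -- mean at most `δ`.
      ≤ ∫⁻ ω, ((toMeasurable P {ω | δ ≤ κ ω}).indicator 1 ω + δ / ε) ∂P := by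
        refine lintegral_mono fun ω => ?_
        by_cases hω : ω ∈ toMeasurable P {ω | δ ≤ κ ω}
        · simp only [Set.indicator_of_mem hω, Pi.one_apply]
          exact prob_le_one.trans le_self_add
        · have hlt : ¬ δ ≤ κ ω := fun h => hω (subset_toMeasurable P _ h)
          rw [Set.indicator_of_notMem hω, zero_add]
          refine (meas_ge_le_lintegral_div
            (hφ.comp measurable_prodMk_left).aemeasurable hε hε').trans ?_
          gcongr
          exact (hκ ω).trans (not_le.1 hlt).le
    _ = P {ω | δ ≤ κ ω} + δ / ε := by
        rw [lintegral_add_right _ measurable_const,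
          lintegral_indicator_one (measurableSet_toMeasurable _ _), measure_toMeasurable]
        simp

/-- This is the device behind cross-fitting. With `Z N` frozen, the law of `T N` is unchanged by
independence, so it is enough that the conditional mean be small in probability. Integrability of
that mean over `Z N` is not needed. -/
lemma IsLittleOpOne.of_lintegral_indep {E V : ℕ → Type*} [∀ N, MeasurableSpace (E N)]
    [∀ N, MeasurableSpace (V N)] {Z : ∀ N, Ω → E N} {T : ∀ N, Ω → V N}
    (hZ : ∀ N, Measurable (Z N)) (hT : ∀ N, Measurable (T N))
    (hind : ∀ N, IndepFun (Z N) (T N) P) {φ : ∀ N, E N → V N → ℝ≥0∞}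
    (hφ : ∀ N, Measurable (Function.uncurry (φ N))) {κ : ℕ → Ω → ℝ≥0∞}
    (hκ : IsLittleOpOne P κ)
    (h : ∀ᶠ N in atTop, ∀ ω, ∫⁻ v, φ N (Z N ω) v ∂(P.map (T N)) ≤ κ N ω) :
    IsLittleOpOne P fun N ω => φ N (Z N ω) (T N ω) := by
  refine IsLittleOpOne.of_ne_top fun ε hε hε' => ?_
  rw [ENNReal.tendsto_nhds_zero]
  intro η hη
  have hη' : 0 < min (η / 2) 1 := lt_min (ENNReal.half_pos hη.ne') one_pos
  have hδ : 0 < ε * min (η / 2) 1 := by positivity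
  filter_upwards [h, (ENNReal.tendsto_nhds_zero.1 (hκ _ hδ)) (η / 2) (ENNReal.half_pos hη.ne')]
    with N hN hN2
  refine (measure_le_of_indepFun (hZ N) (hT N) (hind N) (hφ N) hε.ne' hε'
    (ε * min (η / 2) 1) hN).trans ?_
  calc _ ≤ η / 2 + min (η / 2) 1 := by
        gcongr
        rw [mul_comm, ENNReal.mul_div_cancel_right hε.ne' hε']
    _ ≤ η / 2 + η / 2 := by gcongr; exact min_le_left _ _
    _ = η := ENNReal.add_halves η

end Conditioning

/-! ### Moment bounds and laws of large numbers for sample means -/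

section Average

/-- Sample mean of `h` over a finite sample. -/
def sampleMean {𝒲 : Type*} {n : ℕ} (x : Fin n → 𝒲) (h : 𝒲 → ℝ) : ℝ :=
  (1 / (n : ℝ)) * ∑ i, h (x i)

variable {Ω : Type*} [MeasurableSpace Ω] {P : Measure Ω} [IsProbabilityMeasure P]
  {𝒲 : Type*} [MeasurableSpace 𝒲] {μ : Measure 𝒲} [IsProbabilityMeasure μ]

omit [MeasurableSpace 𝒲] in
lemma sampleMean_add {n : ℕ} (x : Fin n → 𝒲) (h h' : 𝒲 → ℝ) :
    sampleMean x (fun v => h v + h' v) = sampleMean x h + sampleMean x h' := by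
  simp [sampleMean, Finset.sum_add_distrib, mul_add]

omit [MeasurableSpace 𝒲] in
lemma sampleMean_sub {n : ℕ} (x : Fin n → 𝒲) (h h' : 𝒲 → ℝ) :
    sampleMean x (fun v => h v - h' v) = sampleMean x h - sampleMean x h' := by
  simp [sampleMean, Finset.sum_sub_distrib, mul_sub]

omit [MeasurableSpace 𝒲] in
lemma sampleMean_const_mul {n : ℕ} (x : Fin n → 𝒲) (c : ℝ) (h : 𝒲 → ℝ) :
    sampleMean x (fun v => c * h v) = c * sampleMean x h := by
  simp only [sampleMean, ← Finset.mul_sum]; ring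

omit [MeasurableSpace 𝒲] in
lemma sampleMean_mono {n : ℕ} (x : Fin n → 𝒲) {h h' : 𝒲 → ℝ} (hh : ∀ v, h v ≤ h' v) :
    sampleMean x h ≤ sampleMean x h' := by
  unfold sampleMean
  gcongr
  exact hh _

omit [MeasurableSpace 𝒲] in
lemma abs_sampleMean_le {n : ℕ} (x : Fin n → 𝒲) (h : 𝒲 → ℝ) :
    |sampleMean x h| ≤ sampleMean x fun v => |h v| := by
  unfold sampleMean
  rw [abs_mul, abs_of_nonneg (by positivity : (0 : ℝ) ≤ 1 / (n : ℝ))]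
  gcongr
  exact Finset.abs_sum_le_sum_abs _ _

lemma measurable_sampleMean_uncurry {E : Type*} [MeasurableSpace E] {n : ℕ} {h : E → 𝒲 → ℝ}
    (hh : Measurable (Function.uncurry h)) :
    Measurable fun v : E × (Fin n → 𝒲) => sampleMean v.2 (h v.1) := by
  unfold sampleMean
  refine measurable_const.mul (Finset.measurable_sum _ fun i _ => ?_)
  exact hh.comp (measurable_fst.prodMk ((measurable_pi_apply i).comp measurable_snd))

lemma lintegral_enorm_sampleMean_le {n : ℕ} {h : 𝒲 → ℝ} (hh : Measurable h) :
    ∫⁻ v, ‖sampleMean v h‖ₑ ∂(Measure.pi fun _ : Fin n => μ) ≤ ∫⁻ y, ‖h y‖ₑ ∂μ := by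
  rcases Nat.eq_zero_or_pos n with rfl | hn
  · simp [sampleMean]
  have hn0 : (n : ℝ≥0∞) ≠ 0 := by exact_mod_cast hn.ne'
  have h1 : ‖(1 / (n : ℝ))‖ₑ = (n : ℝ≥0∞)⁻¹ := by
    rw [Real.enorm_eq_ofReal (by positivity), one_div, ENNReal.ofReal_inv_of_pos (by positivity)]
    simp
  calc ∫⁻ v, ‖sampleMean v h‖ₑ ∂(Measure.pi fun _ : Fin n => μ)
      ≤ ∫⁻ v, (n : ℝ≥0∞)⁻¹ * ∑ i, ‖h (v i)‖ₑ ∂(Measure.pi fun _ : Fin n => μ) := by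
        refine lintegral_mono fun v => ?_
        unfold sampleMean
        rw [enorm_mul, h1]
        gcongr
        exact enorm_sum_le _ _
    _ = (n : ℝ≥0∞)⁻¹ * ∑ _i : Fin n, ∫⁻ y, ‖h y‖ₑ ∂μ := by
        rw [lintegral_const_mul' _ _ (by simpa using hn0), lintegral_finsetSum]
        · congr 1
          refine Finset.sum_congr rfl fun i _ => ?_
          exact (measurePreserving_eval (fun _ : Fin n => μ) i).lintegral_comp hh.enorm
        · intro i _
          exact (hh.comp (measurable_pi_apply i)).enorm
    _ = ∫⁻ y, ‖h y‖ₑ ∂μ := by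
        rw [Finset.sum_const, Finset.card_univ, Fintype.card_fin, nsmul_eq_mul, ← mul_assoc,
          ENNReal.inv_mul_cancel hn0 (by simp), one_mul]

/-- The left side is the variance of an i.i.d. mean, that is `Var[h] / n`, and the variance is at
most the second moment. When the second moment is infinite the bound is trivial. -/
lemma lintegral_enorm_sampleMean_sub_sq_le {n : ℕ} (hn : 0 < n) {h : 𝒲 → ℝ}
    (hh : Measurable h) :
    ∫⁻ v, ‖sampleMean v h - ∫ y, h y ∂μ‖ₑ ^ 2 ∂(Measure.pi fun _ : Fin n => μ) ≤
      (n : ℝ≥0∞)⁻¹ * ∫⁻ y, ‖h y‖ₑ ^ 2 ∂μ := by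
  have hn0 : (n : ℝ≥0∞) ≠ 0 := by exact_mod_cast hn.ne'
  by_cases htop : ∫⁻ y, ‖h y‖ₑ ^ 2 ∂μ = ∞
  · rw [htop, ENNReal.mul_top (by simp)]
    exact le_top
  have hL : MemLp h 2 μ := by
    refine ⟨hh.aestronglyMeasurable, ?_⟩
    rw [eLpNorm_eq_lintegral_rpow_enorm_toReal (by simp) (by simp)]
    simp only [ENNReal.toReal_ofNat, ENNReal.rpow_ofNat]
    exact ENNReal.rpow_lt_top_of_nonneg (by norm_num) htop
  have hi : ∀ i : Fin n, MemLp (fun v : Fin n → 𝒲 => h (v i)) 2 (Measure.pi fun _ : Fin n => μ) :=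
    fun i => hL.comp_measurePreserving (measurePreserving_eval (fun _ : Fin n => μ) i)
  have hmean : ∫ v, sampleMean v h ∂(Measure.pi fun _ : Fin n => μ) = ∫ y, h y ∂μ := by
    unfold sampleMean
    rw [integral_const_mul, integral_finsetSum _ fun i _ => (hi i).integrable (by norm_num)]
    have : ∀ i : Fin n, ∫ v, h (v i) ∂(Measure.pi fun _ : Fin n => μ) = ∫ y, h y ∂μ := fun i => by
      conv_rhs => rw [← (measurePreserving_eval (fun _ : Fin n => μ) i).map_eq]
      exact (integral_map (measurable_pi_apply i).aemeasurable hh.aestronglyMeasurable).symm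
    simp_rw [this]
    have : (n : ℝ) ≠ 0 := by exact_mod_cast hn.ne'
    simp; field_simp
  have hmem : MemLp (fun v : Fin n → 𝒲 => sampleMean v h) 2 (Measure.pi fun _ : Fin n => μ) := by
    unfold sampleMean
    exact (memLp_finsetSum _ fun i _ => hi i).const_mul _
  have hvar : Var[fun v : Fin n → 𝒲 => sampleMean v h; Measure.pi fun _ : Fin n => μ] =
      (n : ℝ)⁻¹ * Var[h; μ] := by
    unfold sampleMean
    rw [variance_const_mul]
    have := variance_sum_pi (μ := fun _ : Fin n => μ) (X := fun _ => h) (fun _ => hL)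
    have h2 : (∑ i : Fin n, fun ω : Fin n → 𝒲 => h (ω i)) = fun ω => ∑ i, h (ω i) := by
      ext; simp
    rw [h2] at this
    rw [this]
    have : (n : ℝ) ≠ 0 := by exact_mod_cast hn.ne'
    simp; field_simp
  calc _ = evariance (fun v : Fin n → 𝒲 => sampleMean v h) (Measure.pi fun _ : Fin n => μ) := by
        rw [evariance, hmean]
    _ = ENNReal.ofReal ((n : ℝ)⁻¹ * Var[h; μ]) := by rw [← hmem.ofReal_variance_eq, hvar]
    _ = (n : ℝ≥0∞)⁻¹ * ENNReal.ofReal (Var[h; μ]) := by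
        rw [ENNReal.ofReal_mul (by positivity), ENNReal.ofReal_inv_of_pos (by positivity)]
        simp
    _ ≤ _ := by
        gcongr
        have h3 : Var[h; μ] ≤ ∫ y, h y ^ 2 ∂μ := by
          simpa using variance_le_expectation_sq hh.aestronglyMeasurable
        refine (ENNReal.ofReal_le_ofReal h3).trans ?_
        rw [ofReal_integral_eq_lintegral_ofReal hL.integrable_sq (ae_of_all _ fun _ => sq_nonneg _)]
        refine lintegral_mono fun y => ?_
        rw [← enorm_pow, Real.enorm_eq_ofReal (sq_nonneg _)]

/-- At each stage `N`, the `X N i` are an i.i.d. sample from `μ`, independent of `Z N`. -/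
structure IsIndepSample (P : Measure Ω) (μ : Measure 𝒲) (n : ℕ → ℕ)
    (X : ∀ N, Fin (n N) → Ω → 𝒲) {E : ℕ → Type*} [∀ N, MeasurableSpace (E N)]
    (Z : ∀ N, Ω → E N) : Prop where
  measurable : ∀ N i, Measurable (X N i)
  map_eq : ∀ N i, P.map (X N i) = μ
  iIndepFun : ∀ N, iIndepFun (X N) P
  measurable_aux : ∀ N, Measurable (Z N)
  indepFun_aux : ∀ N, IndepFun (Z N) (fun ω i => X N i ω) P
  tendsto_size : Tendsto n atTop atTop

variable {n : ℕ → ℕ} {X : ∀ N, Fin (n N) → Ω → 𝒲} {E : ℕ → Type*} [∀ N, MeasurableSpace (E N)]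
  {Z : ∀ N, Ω → E N}

omit [IsProbabilityMeasure μ] in
lemma IsIndepSample.map_pi (hX : IsIndepSample P μ n X Z) (N : ℕ) :
    P.map (fun ω i => X N i ω) = Measure.pi fun _ => μ := by
  rw [(iIndepFun_iff_map_fun_eq_pi_map fun i => (hX.measurable N i).aemeasurable).1
    (hX.iIndepFun N)]
  simp [hX.map_eq]

/-- An uncentred first-moment bound: it serves for integrands that are already small in `L¹`, such
as a product of two nuisance errors. -/
lemma IsIndepSample.isLittleOpOne_sampleMean (hX : IsIndepSample P μ n X Z)
    {h : ∀ N, E N → 𝒲 → ℝ} (hh : ∀ N, Measurable (Function.uncurry (h N)))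
    {c : ℕ → ℝ} (hc : IsLittleOpOne P fun N ω => ‖c N‖ₑ * ∫⁻ y, ‖h N (Z N ω) y‖ₑ ∂μ) :
    IsLittleOpOne P fun N ω => ‖c N * sampleMean (fun i => X N i ω) (h N (Z N ω))‖ₑ := by
  refine IsLittleOpOne.of_lintegral_indep (Z := Z) (T := fun N ω i => X N i ω)
    (φ := fun N z v => ‖c N * sampleMean v (h N z)‖ₑ) hX.measurable_aux
    (fun N => measurable_pi_lambda _ (hX.measurable N)) hX.indepFun_aux
    (fun N => ((measurable_sampleMean_uncurry (hh N)).const_mul _).enorm) hc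
    (Eventually.of_forall fun N ω => ?_)
  rw [hX.map_pi]
  simp_rw [enorm_mul]
  rw [lintegral_const_mul' _ _ (by simp)]
  gcongr
  exact lintegral_enorm_sampleMean_le ((hh N).comp measurable_prodMk_left)

/-- A conditional Chebyshev bound. Centring gains the factor `1 / n`, so a prefactor `√n` is
harmless as soon as the `L²` norm of the integrand vanishes, at whatever speed. -/
lemma IsIndepSample.isLittleOpOne_sampleMean_sub (hX : IsIndepSample P μ n X Z)
    {h : ∀ N, E N → 𝒲 → ℝ} (hh : ∀ N, Measurable (Function.uncurry (h N)))
    {c : ℕ → ℝ} (hc : IsLittleOpOne P fun N ω =>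
      ‖c N‖ₑ ^ 2 * (n N : ℝ≥0∞)⁻¹ * ∫⁻ y, ‖h N (Z N ω) y‖ₑ ^ 2 ∂μ) :
    IsLittleOpOne P fun N ω =>
      ‖c N * (sampleMean (fun i => X N i ω) (h N (Z N ω)) - ∫ y, h N (Z N ω) y ∂μ)‖ₑ := by
  refine IsLittleOpOne.of_sq ?_
  refine IsLittleOpOne.of_lintegral_indep (Z := Z) (T := fun N ω i => X N i ω)
    (φ := fun N z v => ‖c N * (sampleMean v (h N z) - ∫ y, h N z y ∂μ)‖ₑ ^ 2) hX.measurable_aux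
    (fun N => measurable_pi_lambda _ (hX.measurable N)) hX.indepFun_aux
    (fun N => ?_) hc ?_
  · have h1 : Measurable fun z => ∫ y, h N z y ∂μ :=
      (hh N).stronglyMeasurable.integral_prod_right.measurable
    exact (((measurable_sampleMean_uncurry (hh N)).sub (h1.comp measurable_fst)).const_mul
      _).enorm.pow_const 2
  · filter_upwards [hX.tendsto_size.eventually_gt_atTop 0] with N hN ω
    rw [hX.map_pi]
    simp_rw [enorm_mul, mul_pow]
    rw [lintegral_const_mul' _ _ (by simp), mul_assoc]
    gcongr
    exact lintegral_enorm_sampleMean_sub_sq_le hN ((hh N).comp measurable_prodMk_left)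

/-- Weak law of large numbers for bounded functions. -/
lemma IsIndepSample.isLittleOpOne_sampleMean_sub_of_bounded (hX : IsIndepSample P μ n X Z)
    {h : 𝒲 → ℝ} (hh : Measurable h) {B : ℝ} (hB : ∀ᵐ y ∂μ, |h y| ≤ B) :
    IsLittleOpOne P fun N ω => ‖sampleMean (fun i => X N i ω) h - ∫ y, h y ∂μ‖ₑ := by
  have := hX.isLittleOpOne_sampleMean_sub (h := fun N _ => h) (fun N => hh.comp measurable_snd)
    (c := fun _ => 1) (by
      refine (isLittleOpOne_of_tendsto (c := fun N => (n N : ℝ≥0∞)⁻¹ * ENNReal.ofReal B ^ 2)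
        ?_).mono fun N ω => ?_
      · have := ENNReal.tendsto_inv_nat_nhds_zero.comp hX.tendsto_size
        simpa using ENNReal.Tendsto.mul_const this (b := ENNReal.ofReal B ^ 2) (Or.inr (by simp))
      · simp only [enorm_one, one_pow, one_mul]
        gcongr
        calc ∫⁻ y, ‖h y‖ₑ ^ 2 ∂μ ≤ ∫⁻ _, ENNReal.ofReal B ^ 2 ∂μ := by
              refine lintegral_mono_ae ?_
              filter_upwards [hB] with y hy
              rw [Real.enorm_eq_ofReal_abs]
              gcongr
          _ = _ := by simp)
  simpa using this

end Average

/-! ### The multivariate central limit theorem for row-wise i.i.d. arrays -/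

section CLT

open scoped RealInnerProductSpace

variable {Ω : Type*} [MeasurableSpace Ω] {P : Measure Ω} [IsProbabilityMeasure P]
  {𝒲 : Type*} [MeasurableSpace 𝒲] {μ : Measure 𝒲} [IsProbabilityMeasure μ]

/-- Convergence of the characteristic functions in the central limit theorem, with any variance. -/
lemma tendsto_charFun_pow_of_variance {X : 𝒲 → ℝ} (hX : MemLp X 2 μ) (h0 : ∫ y, X y ∂μ = 0) :
    Tendsto (fun n : ℕ => charFun (μ.map X) ((Real.sqrt n)⁻¹) ^ n) atTop
      (𝓝 (Complex.exp (-((∫ y, X y ^ 2 ∂μ : ℝ) : ℂ) / 2))) := by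
  have hXm : AEMeasurable X μ := hX.aestronglyMeasurable.aemeasurable
  set v := ∫ y, X y ^ 2 ∂μ with hv
  have hv0 : 0 ≤ v := integral_nonneg fun _ => sq_nonneg _
  rcases hv0.eq_or_lt with h | h
  · have hX0 : X =ᵐ[μ] fun _ => 0 := by
      have := (integral_eq_zero_iff_of_nonneg (fun _ => sq_nonneg _) hX.integrable_sq).1 h.symm
      filter_upwards [this] with y hy
      simpa using hy
    have h1 : μ.map X = Measure.dirac 0 := by
      rw [Measure.map_congr hX0, Measure.map_const]; simp
    simp [h1, ← h, charFun_dirac]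
  · have hs : 0 < Real.sqrt v := Real.sqrt_pos.2 h
    -- The unit-variance statement is applied to `X / √v` at the argument `√v`, so the two
    -- rescalings cancel. Division by `√v` is why zero variance was treated apart.
    have key := tendsto_charFun_inv_sqrt_mul_pow (P := μ) (X := fun y => (Real.sqrt v)⁻¹ * X y)
      (hXm.const_mul _) (by rw [integral_const_mul, h0, mul_zero])
      (by
        have : ((fun y => (Real.sqrt v)⁻¹ * X y) ^ 2) = fun y => v⁻¹ * X y ^ 2 := by
          ext y
          simp [mul_pow, Real.sq_sqrt hv0]
        rw [this, integral_const_mul, ← hv, inv_mul_cancel₀ h.ne']) (Real.sqrt v)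
    have e1 : (-((v : ℝ) : ℂ) / 2) = (-(((Real.sqrt v : ℝ) : ℂ)) ^ 2 / 2) := by
      rw [← Complex.ofReal_pow, Real.sq_sqrt hv0]
    rw [e1]
    refine key.congr fun n => ?_
    rw [charFun_map_mul_comp hXm]
    congr 2
    field_simp

omit [IsProbabilityMeasure μ] in
-- The Cramér–Wold reduction: along the line through `t`, a vector characteristic function is that
-- of the scalar projection onto `t`.
lemma charFun_map_smul_eq_inner {F : Type*} [NormedAddCommGroup F] [InnerProductSpace ℝ F]
    [MeasurableSpace F] [BorelSpace F] [SecondCountableTopology F] {ξ : 𝒲 → F}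
    (hξ : Measurable ξ) (c : ℝ) (t : F) :
    charFun (μ.map ξ) (c • t) = charFun (μ.map fun y => ⟪ξ y, t⟫) c := by
  rw [charFun_apply, charFun_apply_real, integral_map hξ.aemeasurable (by fun_prop),
    integral_map (by fun_prop) (by fun_prop)]
  simp [inner_smul_right]

/-- Second-moment matrix of a random vector. -/
def momentMatrix {k : ℕ} (μ : Measure 𝒲) (ξ : 𝒲 → EuclideanSpace ℝ (Fin k)) :
    Matrix (Fin k) (Fin k) ℝ :=
  Matrix.of fun i j => ∫ y, ξ y i * ξ y j ∂μ

variable {k : ℕ} {ξ : 𝒲 → EuclideanSpace ℝ (Fin k)}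

omit [IsProbabilityMeasure μ] in
lemma dotProduct_momentMatrix_mulVec (hint : ∀ i j, Integrable (fun y => ξ y i * ξ y j) μ)
    (t : EuclideanSpace ℝ (Fin k)) :
    t.ofLp ⬝ᵥ (momentMatrix μ ξ).mulVec t.ofLp = ∫ y, ⟪ξ y, t⟫ ^ 2 ∂μ := by
  have h1 : ∀ y, ⟪ξ y, t⟫ ^ 2 = ∑ i, ∑ j, t i * t j * (ξ y i * ξ y j) := by
    intro y
    rw [PiLp.inner_apply, pow_two, Finset.sum_mul_sum]
    refine Finset.sum_congr rfl fun i _ => Finset.sum_congr rfl fun j _ => ?_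
    simp
    ring
  simp_rw [h1]
  rw [integral_finsetSum _ fun i _ => integrable_finsetSum _ fun j _ => (hint i j).const_mul _]
  simp_rw [integral_finsetSum _ fun j _ => (hint _ j).const_mul _, integral_const_mul]
  simp only [dotProduct, Matrix.mulVec, momentMatrix, Matrix.of_apply, Finset.mul_sum]
  refine Finset.sum_congr rfl fun i _ => Finset.sum_congr rfl fun j _ => by ring

omit [IsProbabilityMeasure μ] in
lemma posSemidef_momentMatrix (hint : ∀ i j, Integrable (fun y => ξ y i * ξ y j) μ) :
    (momentMatrix μ ξ).PosSemidef := by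
  refine Matrix.PosSemidef.of_dotProduct_mulVec_nonneg ?_ fun x => ?_
  · ext i j
    simp [momentMatrix, mul_comm]
  · have := dotProduct_momentMatrix_mulVec hint (WithLp.toLp 2 x)
    simp only [star_trivial] at this ⊢
    rw [this]
    exact integral_nonneg fun _ => sq_nonneg _

/-- Multivariate central limit theorem for triangular arrays with i.i.d. rows from a fixed law. -/
theorem tendstoInDistribution_inv_sqrt_smul_sum {ι : ℕ → Type*} [∀ N, Fintype (ι N)]
    {X : ∀ N, ι N → Ω → 𝒲} (hXm : ∀ N i, Measurable (X N i)) (hlaw : ∀ N i, P.map (X N i) = μ)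
    (hind : ∀ N, iIndepFun (X N) P)
    (hcard : Tendsto (fun N => Fintype.card (ι N)) atTop atTop)
    (hξ : Measurable ξ) (hξ2 : ∀ i, MemLp (fun y => ξ y i) 2 μ) (hξ0 : ∀ i, ∫ y, ξ y i ∂μ = 0) :
    TendstoInDistribution
      (fun N ω => (Real.sqrt (Fintype.card (ι N)))⁻¹ • ∑ i, ξ (X N i ω)) atTop
      (id : EuclideanSpace ℝ (Fin k) → EuclideanSpace ℝ (Fin k)) (fun _ => P)
      (multivariateGaussian 0 (momentMatrix μ ξ)) := by
  have hint : ∀ i j, Integrable (fun y => ξ y i * ξ y j) μ := fun i j =>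
    (hξ2 i).integrable_mul (hξ2 j)
  have hsum : ∀ N, Measurable fun ω => ∑ i, ξ (X N i ω) := fun N =>
    Finset.measurable_sum _ fun i _ => hξ.comp (hXm N i)
  have hm : ∀ N, AEMeasurable (fun ω => (Real.sqrt (Fintype.card (ι N)))⁻¹ • ∑ i, ξ (X N i ω)) P :=
    fun N => by
      have := hsum N
      fun_prop
  refine ⟨hm, aemeasurable_id, ?_⟩
  -- By Lévy's continuity theorem it is enough to fix `t`. Independence turns the characteristic
  -- function of the normalized sum into a power of that of `⟪ξ, t⟫`, and the limiting variance is
  -- the quadratic form of `momentMatrix`.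
  refine ProbabilityMeasure.tendsto_iff_tendsto_charFun.2 fun t => ?_
  have hinner : ∀ y, ⟪ξ y, t⟫ = ∑ i, t i * ξ y i := by
    intro y
    simp [PiLp.inner_apply]
  have hL2 : MemLp (fun y => ⟪ξ y, t⟫) 2 μ := by
    simp_rw [hinner]
    exact memLp_finsetSum _ fun i _ => (hξ2 i).const_mul _
  have hmean : ∫ y, ⟪ξ y, t⟫ ∂μ = 0 := by
    simp_rw [hinner]
    rw [integral_finsetSum _ fun i _ => ((hξ2 i).const_mul _).integrable (by norm_num)]
    simp [integral_const_mul, hξ0]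
  have hlim := (tendsto_charFun_pow_of_variance hL2 hmean).comp hcard
  have hgauss : charFun (multivariateGaussian 0 (momentMatrix μ ξ)) t =
      Complex.exp (-((∫ y, ⟪ξ y, t⟫ ^ 2 ∂μ : ℝ) : ℂ) / 2) := by
    rw [charFun_multivariateGaussian (posSemidef_momentMatrix hint),
      dotProduct_momentMatrix_mulVec hint]
    congr 1
    simp [neg_div]
  simp only [ProbabilityMeasure.coe_mk, Measure.map_id]
  rw [hgauss]
  refine hlim.congr fun N => ?_
  have h1 : charFun (P.map fun ω => (Real.sqrt (Fintype.card (ι N)))⁻¹ • ∑ i, ξ (X N i ω)) t =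
      charFun (P.map fun ω => ∑ i, ξ (X N i ω)) ((Real.sqrt (Fintype.card (ι N)))⁻¹ • t) := by
    rw [charFun_map_smul_eq_inner (hsum N), charFun_apply, charFun_apply_real,
      integral_map (hm N) (by fun_prop), integral_map ((hsum N).inner_const.aemeasurable)
        (by fun_prop)]
    simp [real_inner_smul_left]
  have h2 : iIndepFun (fun i ω => ξ (X N i ω)) P := (hind N).comp (fun _ => ξ) fun _ => hξ
  rw [h1, h2.charFun_map_fun_sum_eq_prod (X := fun i ω => ξ (X N i ω))
    fun i => (hξ.comp (hXm N i)).aemeasurable]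
  have h3 : ∀ i, P.map (fun ω => ξ (X N i ω)) = μ.map ξ := fun i => by
    rw [← hlaw N i, Measure.map_map hξ (hXm N i)]; rfl
  simp only [Finset.prod_apply, h3, Finset.prod_const, Finset.card_univ, Function.comp_apply]
  rw [charFun_map_smul_eq_inner hξ]

end CLT

/-! ### Measurable maximizers and mean value points -/

section Selection

variable {Ω : Type*} [MeasurableSpace Ω]

/-- The least maximizer of a random continuous function on `[0, 1]` is measurable. -/
lemma exists_measurable_argmax {ψ : Ω → unitInterval → ℝ} (hm : ∀ s, Measurable fun ω => ψ ω s)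
    (hc : ∀ ω, Continuous (ψ ω)) :
    ∃ s : Ω → unitInterval, Measurable s ∧ ∀ ω u, ψ ω u ≤ ψ ω (s ω) := by
  have hex : ∀ ω, ∃ s, IsLeast {s | ∀ u, ψ ω u ≤ ψ ω s} s := by
    intro ω
    have hne : {s | ∀ u, ψ ω u ≤ ψ ω s}.Nonempty := by
      obtain ⟨s, -, hs⟩ := isCompact_univ.exists_isMaxOn Set.univ_nonempty (hc ω).continuousOn
      exact ⟨s, fun u => hs (Set.mem_univ u)⟩
    have hcl : IsClosed {s | ∀ u, ψ ω u ≤ ψ ω s} := by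
      have : {s | ∀ u, ψ ω u ≤ ψ ω s} = ⋂ u, {s | ψ ω u ≤ ψ ω s} := by ext; simp
      rw [this]
      exact isClosed_iInter fun u => isClosed_le continuous_const (hc ω)
    exact hcl.isCompact.exists_isLeast hne
  choose s hs using hex
  refine ⟨s, measurable_of_Iic fun t => ?_, fun ω => (hs ω).1⟩
  let d := TopologicalSpace.denseSeq unitInterval
  have hd : DenseRange d := TopologicalSpace.denseRange_denseSeq _
  -- The least maximizer lies in `[0, t]` exactly when the supremum over `[0, t]` equals the global
  -- one. Both are tested on a dense sequence, with `min t (d j)` running through a dense subset of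
  -- `[0, t]` and a slack `1 / (n + 1)` replacing attainment.
  have heq : s ⁻¹' Set.Iic t =
      ⋂ i : ℕ, ⋂ n : ℕ, ⋃ j : ℕ, {ω | ψ ω (d i) - 1 / ((n : ℝ) + 1) < ψ ω (min t (d j))} := by
    ext ω
    simp only [Set.mem_preimage, Set.mem_Iic, Set.mem_iInter, Set.mem_iUnion, Set.mem_ofPred_eq]
    constructor
    · intro hst i n
      have hcont : Continuous fun v => ψ ω (min t v) := (hc ω).comp (by fun_prop)
      have hopen : IsOpen {v | ψ ω (d i) - 1 / ((n : ℝ) + 1) < ψ ω (min t v)} :=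
        isOpen_lt continuous_const hcont
      refine hd.exists_mem_open hopen ⟨s ω, ?_⟩
      have h1 : ψ ω (d i) ≤ ψ ω (s ω) := (hs ω).1 (d i)
      have h2 : (0 : ℝ) < 1 / ((n : ℝ) + 1) := by positivity
      rw [Set.mem_ofPred_eq, min_eq_right hst]
      linarith
    · intro h
      obtain ⟨s', hs't, hs'⟩ := (isClosed_Iic (a := t)).isCompact.exists_isMaxOn
        Set.nonempty_Iic (hc ω).continuousOn
      have h1 : ∀ i, ψ ω (d i) ≤ ψ ω s' := by
        intro i
        refine le_of_forall_pos_lt_add fun ε hε => ?_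
        obtain ⟨n, hn⟩ := exists_nat_one_div_lt hε
        obtain ⟨j, hj⟩ := h i n
        have h2 : ψ ω (min t (d j)) ≤ ψ ω s' := hs' (Set.mem_Iic.2 (min_le_left _ _))
        linarith
      have h2 : ∀ u, ψ ω u ≤ ψ ω s' := fun u => by
        have hcl : IsClosed {u | ψ ω u ≤ ψ ω s'} := isClosed_le (hc ω) continuous_const
        exact hd.induction_on u hcl h1
      exact ((hs ω).2 h2).trans hs't
  rw [heq]
  exact MeasurableSet.iInter fun i => MeasurableSet.iInter fun n => MeasurableSet.iUnion fun j =>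
    measurableSet_lt ((hm _).sub_const _) (hm _)

/-- Mean value theorem with a measurable intermediate point. -/
lemma exists_measurable_deriv_eq_sub {φ φ' : Ω → ℝ → ℝ}
    (hm : ∀ s ∈ Set.Icc (0 : ℝ) 1, Measurable fun ω => φ ω s)
    (hd : ∀ ω, ∀ s ∈ Set.Icc (0 : ℝ) 1, HasDerivAt (φ ω) (φ' ω s) s) :
    ∃ s : Ω → ℝ, Measurable s ∧ ∀ ω, s ω ∈ Set.Icc (0 : ℝ) 1 ∧
      φ' ω (s ω) = φ ω 1 - φ ω 0 := by
  -- Rolle's auxiliary function, vanishing at `0` and `1`. Maximizing `ψ ^ 2` treats interior maxima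
  -- and minima of `ψ` at once.
  set ψ : Ω → ℝ → ℝ := fun ω s => φ ω s - φ ω 0 - s * (φ ω 1 - φ ω 0) with hψ
  have hψd : ∀ ω, ∀ s ∈ Set.Icc (0 : ℝ) 1,
      HasDerivAt (ψ ω) (φ' ω s - (φ ω 1 - φ ω 0)) s := by
    intro ω s hs
    have := ((hd ω s hs).sub_const (φ ω 0)).sub ((hasDerivAt_id s).mul_const (φ ω 1 - φ ω 0))
    exact this.congr_deriv (by simp)
  have h0m : (0 : ℝ) ∈ Set.Icc (0 : ℝ) 1 := by simp
  have h1m : (1 : ℝ) ∈ Set.Icc (0 : ℝ) 1 := by simp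
  obtain ⟨s, hsm, hs⟩ := exists_measurable_argmax (ψ := fun ω (s : unitInterval) => ψ ω s ^ 2)
    (fun s => (((hm s s.2).sub (hm 0 h0m)).sub
      (((hm 1 h1m).sub (hm 0 h0m)).const_mul _)).pow_const 2)
    (fun ω => by
      have : ContinuousOn (ψ ω) (Set.Icc 0 1) := fun u hu =>
        (hψd ω u hu).continuousAt.continuousWithinAt
      exact (continuousOn_iff_continuous_domRestrict.1 this).pow 2)
  classical
  -- If the maximizer is an endpoint, the maximum of `ψ ^ 2` is `0`, so `ψ` vanishes on `[0, 1]` and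
  -- every interior point works; `1 / 2` is an arbitrary one.
  refine ⟨fun ω => if (s ω : ℝ) ∈ Set.Ioo (0 : ℝ) 1 then (s ω : ℝ) else 1 / 2, ?_, fun ω => ?_⟩
  · have h1 : Measurable fun ω => (s ω : ℝ) := measurable_subtype_coe.comp hsm
    exact Measurable.ite (h1 measurableSet_Ioo) h1 measurable_const
  have hmax : ∀ u ∈ Set.Icc (0 : ℝ) 1, ψ ω u ^ 2 ≤ ψ ω (s ω) ^ 2 := fun u hu => hs ω ⟨u, hu⟩
  have hzero : ψ ω (s ω) = 0 → ∀ u ∈ Set.Ioo (0 : ℝ) 1, φ' ω u = φ ω 1 - φ ω 0 := by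
    intro h u hu
    have hev : ψ ω =ᶠ[𝓝 u] fun _ => 0 := by
      filter_upwards [Ioo_mem_nhds hu.1 hu.2] with v hv
      have := hmax v ⟨hv.1.le, hv.2.le⟩
      rw [h] at this
      nlinarith [sq_nonneg (ψ ω v)]
    have h2 := (hψd ω u ⟨hu.1.le, hu.2.le⟩).unique
      ((hasDerivAt_const u (0 : ℝ)).congr_of_eventuallyEq hev)
    linarith
  dsimp only
  split_ifs with hin
  · refine ⟨⟨hin.1.le, hin.2.le⟩, ?_⟩
    by_cases h : ψ ω (s ω) = 0
    · exact hzero h _ hin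
    -- At an interior maximizer `2 ψ ψ' = 0`, and `ψ ≠ 0` here forces `ψ' = 0`.
    · have hloc : IsLocalMax (fun u => ψ ω u ^ 2) (s ω : ℝ) := by
        filter_upwards [Ioo_mem_nhds hin.1 hin.2] with v hv
        exact hmax v ⟨hv.1.le, hv.2.le⟩
      have h2 := hloc.hasDerivAt_eq_zero ((hψd ω _ ⟨hin.1.le, hin.2.le⟩).pow 2)
      have h3 : φ' ω (s ω) - (φ ω 1 - φ ω 0) = 0 := by
        simpa [h] using h2
      linarith
  · have hend : (s ω : ℝ) = 0 ∨ (s ω : ℝ) = 1 := by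
      have h1 := (s ω).2
      by_contra hcon
      push Not at hcon
      exact hin ⟨lt_of_le_of_ne h1.1 (Ne.symm hcon.1), lt_of_le_of_ne h1.2 hcon.2⟩
    have h0 : ψ ω (s ω) = 0 := by
      rcases hend with h | h <;> rw [h] <;> simp [hψ]
    exact ⟨by norm_num, hzero h0 _ (by norm_num)⟩

end Selection

/-! ### Measurability and mean values of partial derivatives -/

section PartialDerivatives

variable {X : Type*} [MeasurableSpace X] {k : ℕ}

/-- The partial derivative is the limit of difference quotients with step `1 / n`. The shift by `n₀`
keeps the evaluation points in `Θ`, the only place where measurability is assumed. -/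
lemma measurable_pderiv {F : EuclideanSpace ℝ (Fin k) → X → ℝ}
    {Θ : Set (EuclideanSpace ℝ (Fin k))} (hF : ∀ β ∈ Θ, Measurable (F β))
    {β : EuclideanSpace ℝ (Fin k)} (hβ : β ∈ interior Θ)
    (hd : ∀ x, DifferentiableAt ℝ (fun b => F b x) β) (i : Fin k) :
    Measurable fun x => pderiv i (fun b => F b x) β := by
  set e : EuclideanSpace ℝ (Fin k) := EuclideanSpace.single i 1
  have hlim : Tendsto (fun n : ℕ => β + ((n : ℝ))⁻¹ • e) atTop (𝓝 β) := by
    have := (tendsto_inv_atTop_nhds_zero_nat (𝕜 := ℝ)).smul_const e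
    simpa using this.const_add β
  obtain ⟨n₀, hn₀⟩ := eventually_atTop.1
    (hlim.eventually (mem_interior_iff_mem_nhds.1 hβ))
  refine measurable_of_tendsto_metrizable (f := fun (n : ℕ) x =>
    ((n + n₀ : ℕ) : ℝ) * (F (β + (((n + n₀ : ℕ) : ℝ))⁻¹ • e) x - F β x)) (fun n => ?_) ?_
  · exact ((hF _ (hn₀ _ (Nat.le_add_left _ _))).sub (hF _ (interior_subset hβ))).const_mul _
  · rw [tendsto_pi_nhds]
    intro x
    have h1 := (hd x).hasFDerivAt.lim (c := fun n : ℕ => (n : ℝ)) (l := atTop) e (by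
      simpa using tendsto_natCast_atTop_atTop)
    exact h1.comp (tendsto_add_atTop_nat n₀)

lemma TwiceDifferentiableAt.differentiableAt_pderiv {F : EuclideanSpace ℝ (Fin k) → ℝ}
    {β : EuclideanSpace ℝ (Fin k)} (h : TwiceDifferentiableAt F β) (i : Fin k) :
    DifferentiableAt ℝ (pderiv i F) β :=
  h.2.clm_apply (differentiableAt_const _)

lemma fderiv_apply_eq_sum_pderiv (G : EuclideanSpace ℝ (Fin k) → ℝ)
    (β v : EuclideanSpace ℝ (Fin k)) : fderiv ℝ G β v = ∑ j, v j * pderiv j G β := by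
  conv_lhs => rw [← (EuclideanSpace.basisFun (Fin k) ℝ).sum_repr v]
  simp [pderiv]

/-- A random point on the segment at which the mean value theorem holds for a partial derivative. -/
lemma exists_measurable_meanValue_pderiv {Θ : Set (EuclideanSpace ℝ (Fin k))}
    {F : X → EuclideanSpace ℝ (Fin k) → ℝ} (hF : ∀ β ∈ Θ, Measurable fun x => F x β)
    (hd : ∀ x, ∀ β ∈ interior Θ, TwiceDifferentiableAt (F x) β)
    {βt : EuclideanSpace ℝ (Fin k)} {r : ℝ}
    (hball : Metric.ball βt r ⊆ interior Θ) {γ : X → EuclideanSpace ℝ (Fin k)}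
    (hγ : Measurable γ) (hγr : ∀ x, γ x ∈ Metric.ball βt r) (i : Fin k) :
    ∃ βs : X → EuclideanSpace ℝ (Fin k), Measurable βs ∧ (∀ x, βs x ∈ interior Θ) ∧
      (∀ x, ‖βs x - βt‖ ≤ ‖γ x - βt‖) ∧
      ∀ x, pderiv i (F x) (γ x) - pderiv i (F x) βt =
        ∑ j, hess (F x) (βs x) i j * (γ x - βt) j := by
  have hseg : ∀ x, ∀ s ∈ Set.Icc (0 : ℝ) 1, βt + s • (γ x - βt) ∈ Metric.ball βt r ∧
      ‖βt + s • (γ x - βt) - βt‖ ≤ ‖γ x - βt‖ := by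
    intro x s hs
    have h2 : ‖βt + s • (γ x - βt) - βt‖ ≤ ‖γ x - βt‖ := by
      rw [add_sub_cancel_left, norm_smul, Real.norm_of_nonneg hs.1]
      exact mul_le_of_le_one_left (norm_nonneg _) hs.2
    refine ⟨?_, h2⟩
    have := hγr x
    rw [mem_ball_iff_norm] at this ⊢
    exact h2.trans_lt this
  -- A Carathéodory argument: the partial derivative is continuous in the parameter, being
  -- differentiable there, and measurable in `x`. Joint measurability lets a random parameter be
  -- substituted.
  have hjoint : Measurable fun v : X × interior Θ => pderiv i (F v.1) v.2 := by
    have h := measurable_uncurry_of_continuous_of_measurable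
      (u := fun (b : interior Θ) (x : X) => pderiv i (F x) b)
      (fun x => continuous_iff_continuousAt.2 fun b =>
        ((hd x b b.2).differentiableAt_pderiv i).continuousAt.comp continuous_subtype_val.continuousAt)
      (fun b => measurable_pderiv (F := fun b x => F x b) hF b.2 (fun x => (hd x b b.2).1) i)
    exact h.comp measurable_swap
  obtain ⟨s, hsm, hs⟩ := exists_measurable_deriv_eq_sub
    (φ := fun x s => pderiv i (F x) (βt + s • (γ x - βt)))
    (φ' := fun x s => fderiv ℝ (pderiv i (F x)) (βt + s • (γ x - βt)) (γ x - βt))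
    (fun s hs => by
      have h1 : Measurable fun x => (x, (⟨βt + s • (γ x - βt), hball (hseg x s hs).1⟩ :
          interior Θ)) :=
        measurable_id.prodMk (Measurable.subtype_mk (by fun_prop))
      exact hjoint.comp h1)
    (fun x s hs => by
      have h1 := ((hd x _ (hball (hseg x s hs).1)).differentiableAt_pderiv i).hasFDerivAt
      have h2 : HasDerivAt (fun s : ℝ => βt + s • (γ x - βt)) (γ x - βt) s := by
        simpa using ((hasDerivAt_id s).smul_const (γ x - βt)).const_add βt
      exact h1.comp_hasDerivAt s h2)
  refine ⟨fun x => βt + s x • (γ x - βt), by fun_prop, fun x => hball (hseg x _ (hs x).1).1,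
    fun x => (hseg x _ (hs x).1).2, fun x => ?_⟩
  have := (hs x).2
  simp only [one_smul, zero_smul, add_zero, add_sub_cancel] at this
  rw [← this, fderiv_apply_eq_sum_pderiv]
  refine Finset.sum_congr rfl fun j _ => ?_
  rw [mul_comm]
  rfl

end PartialDerivatives

/-! ### Linearization of a consistent minimizer -/

section ZEstimation

variable {k : ℕ}

/-- Since `δ = M⁻¹ M δ` and `v = A δ`, the error is `e = -M⁻¹ (A - M) δ`, so `∑|e| ≤ Y ∑|δ|`. Also
`∑|δ| ≤ G + ∑|e|`, and `Y ≤ 1 / 2` absorbs the last term to give `∑|δ| ≤ 2 G`. Invertibility of `A`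
is never used. -/
lemma abs_sub_inv_mulVec_le {M A : Matrix (Fin k) (Fin k) ℝ} (hM : IsUnit M.det)
    {δ v : Fin k → ℝ} (h : ∀ i, v i = ∑ j, A i j * δ j)
    (hY : ∑ i, ∑ j, ∑ l, |M⁻¹ i j| * |A j l - M j l| ≤ 1 / 2) (i : Fin k) :
    |δ i - ∑ j, M⁻¹ i j * v j| ≤
      2 * (∑ i, ∑ j, ∑ l, |M⁻¹ i j| * |A j l - M j l|) * ∑ i, ∑ j, |M⁻¹ i j| * |v j| := by
  set Y := ∑ i, ∑ j, ∑ l, |M⁻¹ i j| * |A j l - M j l| with hYdef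
  set G := ∑ i, ∑ j, |M⁻¹ i j| * |v j| with hG
  set S := ∑ l, |δ l| with hS
  set e : Fin k → ℝ := fun i => δ i - ∑ j, M⁻¹ i j * v j with he
  have hδ : ∀ i, δ i = ∑ j, M⁻¹ i j * ∑ l, M j l * δ l := by
    intro i
    have h1 : M⁻¹.mulVec (M.mulVec δ) = δ := by
      rw [Matrix.mulVec_mulVec, Matrix.nonsing_inv_mul _ hM, Matrix.one_mulVec]
    have := congrFun h1 i
    simpa [Matrix.mulVec, dotProduct] using this.symm
  have hei : ∀ i, e i = ∑ j, ∑ l, -(M⁻¹ i j * (A j l - M j l) * δ l) := by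
    intro i
    simp only [he]
    conv_lhs => rw [hδ i]
    rw [← Finset.sum_sub_distrib]
    refine Finset.sum_congr rfl fun j _ => ?_
    rw [h j, ← mul_sub, ← Finset.sum_sub_distrib, Finset.mul_sum]
    exact Finset.sum_congr rfl fun l _ => by ring
  have hδe : ∀ i, δ i = (∑ j, M⁻¹ i j * v j) + e i := fun i => by simp [he]
  change |e i| ≤ _
  clear_value e
  have hSl : ∀ l, |δ l| ≤ S := fun l =>
    Finset.single_le_sum (f := fun l => |δ l|) (fun _ _ => abs_nonneg _) (Finset.mem_univ l)
  have hS0 : 0 ≤ S := Finset.sum_nonneg fun _ _ => abs_nonneg _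
  have hY0 : 0 ≤ Y := Finset.sum_nonneg fun _ _ => Finset.sum_nonneg fun _ _ =>
    Finset.sum_nonneg fun _ _ => by positivity
  have hsum : ∑ i, |e i| ≤ Y * S := by
    rw [hYdef, Finset.sum_mul]
    refine Finset.sum_le_sum fun i _ => ?_
    rw [hei, Finset.sum_mul]
    refine (Finset.abs_sum_le_sum_abs _ _).trans (Finset.sum_le_sum fun j _ => ?_)
    rw [Finset.sum_mul]
    refine (Finset.abs_sum_le_sum_abs _ _).trans (Finset.sum_le_sum fun l _ => ?_)
    rw [abs_neg, abs_mul, abs_mul]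
    gcongr
    exact hSl l
  have hSG : S ≤ G + ∑ i, |e i| := by
    rw [hG, ← Finset.sum_add_distrib]
    refine Finset.sum_le_sum fun i _ => ?_
    calc |δ i| = |(∑ j, M⁻¹ i j * v j) + e i| := by rw [← hδe i]
      _ ≤ |∑ j, M⁻¹ i j * v j| + |e i| := abs_add_le _ _
      _ ≤ _ := by
        gcongr
        refine (Finset.abs_sum_le_sum_abs _ _).trans (Finset.sum_le_sum fun j _ => ?_)
        rw [abs_mul]
  have h1 : |e i| ≤ ∑ i, |e i| :=
    Finset.single_le_sum (f := fun l => |e l|) (fun _ _ => abs_nonneg _) (Finset.mem_univ i)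
  have h2 : S ≤ 2 * G := by nlinarith
  calc |e i| ≤ Y * S := h1.trans hsum
    _ ≤ Y * (2 * G) := mul_le_mul_of_nonneg_left h2 hY0
    _ = 2 * Y * G := by ring

variable {Ω : Type*} [MeasurableSpace Ω] {P : Measure Ω}

/-- Asymptotic linearity of a consistent minimizer whose Hessian converges in probability along
consistent random sequences. -/
theorem isLittleOpOne_argmin_sub_inv_mulVec_grad {Θ : Set (EuclideanSpace ℝ (Fin k))}
    {βt : EuclideanSpace ℝ (Fin k)} (hβt : βt ∈ interior Θ)
    {risk : ℕ → Ω → EuclideanSpace ℝ (Fin k) → ℝ}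
    (hmeas : ∀ N, ∀ β ∈ Θ, Measurable fun ω => risk N ω β)
    (hdiff : ∀ N ω, ∀ β ∈ interior Θ, TwiceDifferentiableAt (risk N ω) β)
    {M : Matrix (Fin k) (Fin k) ℝ} (hM : IsUnit M.det)
    (hhess : ∀ βs : ℕ → Ω → EuclideanSpace ℝ (Fin k), (∀ N, Measurable (βs N)) →
      (∀ N ω, βs N ω ∈ interior Θ) → TendstoInMeasure P βs atTop (fun _ => βt) →
      ∀ i j, TendstoInMeasure P (fun N ω => hess (risk N ω) (βs N ω) i j) atTop
        (fun _ => M i j))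
    {βhat : ℕ → Ω → EuclideanSpace ℝ (Fin k)} (hβhat_meas : ∀ N, Measurable (βhat N))
    (hβhat : ∀ N, ∀ᵐ ω ∂P, IsArgmin (risk N ω) Θ (βhat N ω))
    (hcons : IsLittleOpOne P fun N ω => ‖βhat N ω - βt‖ₑ) {c : ℕ → ℝ}
    (hgrad : ∀ i, ∀ Y : ℕ → Ω → ℝ≥0∞, IsLittleOpOne P Y →
      IsLittleOpOne P fun N ω => Y N ω * ‖c N * pderiv i (risk N ω) βt‖ₑ) (i : Fin k) :
    IsLittleOpOne P fun N ω =>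
      ‖c N * ((βt - βhat N ω) i - ∑ j, M⁻¹ i j * pderiv j (risk N ω) βt)‖ₑ := by
  classical
  obtain ⟨r, hr, hball⟩ := Metric.isOpen_iff.1 isOpen_interior βt hβt
  -- Outside the ball the estimator is replaced by `βt`, so that the segment to `βt` always stays in
  -- the interior of `Θ`.
  set γ : ℕ → Ω → EuclideanSpace ℝ (Fin k) := fun N ω =>
    if βhat N ω ∈ Metric.ball βt r then βhat N ω else βt with hγ
  have hγm : ∀ N, Measurable (γ N) := fun N =>
    Measurable.ite (hβhat_meas N measurableSet_ball) (hβhat_meas N) measurable_const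
  have hγr : ∀ N ω, γ N ω ∈ Metric.ball βt r := fun N ω => by
    simp only [hγ]
    split_ifs with h
    · exact h
    · exact Metric.mem_ball_self hr
  have hγle : ∀ N ω, ‖γ N ω - βt‖ ≤ ‖βhat N ω - βt‖ := fun N ω => by
    simp only [hγ]
    split_ifs with h
    · exact le_rfl
    · simp
  -- There is one intermediate point per partial derivative. The rows of `A` below are thus Hessian
  -- rows at different points, each sequence of points being consistent on its own.
  choose βs hβsm hβsi hβsn hβs using fun (i : Fin k) (N : ℕ) =>
    exists_measurable_meanValue_pderiv (hmeas N) (hdiff N) hball (hγm N) (hγr N) i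
  have hA : ∀ j l, IsLittleOpOne P fun N ω =>
      ‖hess (risk N ω) (βs j N ω) j l - M j l‖ₑ := by
    intro j l
    refine tendstoInMeasure_iff_isLittleOpOne.1 (hhess (βs j) (hβsm j) (hβsi j) ?_ j l)
    refine tendstoInMeasure_iff_isLittleOpOne.2 (hcons.mono fun N ω => ?_)
    exact enorm_le_iff_norm_le.2 ((hβsn j N ω).trans (hγle N ω))
  set A : ℕ → Ω → Matrix (Fin k) (Fin k) ℝ := fun N ω =>
    Matrix.of fun j l => hess (risk N ω) (βs j N ω) j l with hAdef
  set Y : ℕ → Ω → ℝ := fun N ω => ∑ i, ∑ j, ∑ l, |M⁻¹ i j| * |A N ω j l - M j l| with hY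
  have hYop : IsLittleOpOne P fun N ω => ‖Y N ω‖ₑ := by
    refine (IsLittleOpOne.sum Finset.univ fun i _ => IsLittleOpOne.sum Finset.univ fun j _ =>
      IsLittleOpOne.sum Finset.univ fun l _ => (hA j l).const_mul (c := ‖M⁻¹ i j‖ₑ)
        (by simp)).mono fun N ω => ?_
    refine (enorm_sum_le _ _).trans (Finset.sum_le_sum fun i _ => (enorm_sum_le _ _).trans
      (Finset.sum_le_sum fun j _ => (enorm_sum_le _ _).trans (Finset.sum_le_sum fun l _ => ?_)))
    rw [enorm_mul, Real.enorm_abs, Real.enorm_abs]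
    rfl
  -- Here `hgrad` acts as tightness of the rescaled gradient: its product with the `o_p(1)` Hessian
  -- error is again `o_p(1)`.
  have hbound : IsLittleOpOne P fun N ω => ∑ i, ∑ j, (2 * ‖M⁻¹ i j‖ₑ) *
      (‖Y N ω‖ₑ * ‖c N * pderiv j (risk N ω) βt‖ₑ) :=
    IsLittleOpOne.sum _ fun i _ => IsLittleOpOne.sum _ fun j _ =>
      (hgrad j _ hYop).const_mul (ENNReal.mul_ne_top (by simp) (by simp))
  -- On this event, whose complement has vanishing probability, the estimator is an interior
  -- minimizer, so its gradient is zero, and the perturbation bound applies.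
  refine hbound.of_event (s := fun N => {ω | IsArgmin (risk N ω) Θ (βhat N ω) ∧
    βhat N ω ∈ Metric.ball βt r ∧ Y N ω ≤ 1 / 2}) ?_ ?_
  · have h1 := (hcons (ENNReal.ofReal r) (by simpa using hr)).add
      (hYop (ENNReal.ofReal (1 / 2)) (by simp))
    rw [add_zero] at h1
    refine tendsto_of_tendsto_of_tendsto_of_le_of_le tendsto_const_nhds h1 (fun _ => zero_le)
      fun N => ?_
    calc _ ≤ P ({ω | ¬ IsArgmin (risk N ω) Θ (βhat N ω)} ∪
            ({ω | ENNReal.ofReal r ≤ ‖βhat N ω - βt‖ₑ} ∪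
              {ω | ENNReal.ofReal (1 / 2) ≤ ‖Y N ω‖ₑ})) := by
          refine measure_mono fun ω hω => ?_
          simp only [Set.mem_compl_iff, Set.mem_ofPred_eq, not_and_or] at hω
          rcases hω with h | h | h
          · exact Or.inl h
          · refine Or.inr (Or.inl ?_)
            rw [mem_ball_iff_norm, not_lt] at h
            rw [Set.mem_ofPred_eq, ← ofReal_norm]
            exact ENNReal.ofReal_le_ofReal h
          · refine Or.inr (Or.inr ?_)
            rw [not_le] at h
            rw [Set.mem_ofPred_eq, Real.enorm_eq_ofReal_abs]
            exact ENNReal.ofReal_le_ofReal (h.le.trans (le_abs_self _))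
      _ ≤ 0 + _ := by
          refine (measure_union_le _ _).trans (add_le_add ?_ (measure_union_le _ _))
          exact (ae_iff.1 (hβhat N)).le
      _ = _ := zero_add _
  · rintro N ω ⟨hmin, hin, hYle⟩
    have hγeq : γ N ω = βhat N ω := by simp only [hγ]; rw [if_pos hin]
    have hzero : ∀ j, pderiv j (risk N ω) (βhat N ω) = 0 := by
      intro j
      have hloc : IsLocalMin (risk N ω) (βhat N ω) := by
        filter_upwards [mem_interior_iff_mem_nhds.1 (hball hin)] with b hb
        exact hmin.2 b hb
      simp [pderiv, hloc.fderiv_eq_zero]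
    have heq : ∀ j, pderiv j (risk N ω) βt = ∑ l, A N ω j l * (βt - βhat N ω) l := by
      intro j
      have h1 := hβs j N ω
      rw [hγeq, hzero j, zero_sub] at h1
      rw [← neg_neg (pderiv j (risk N ω) βt), h1, ← Finset.sum_neg_distrib]
      refine Finset.sum_congr rfl fun l _ => ?_
      simp only [hAdef, Matrix.of_apply, PiLp.sub_apply]
      ring
    have h2 := abs_sub_inv_mulVec_le (δ := fun l => (βt - βhat N ω) l)
      (v := fun j => pderiv j (risk N ω) βt) hM heq hYle i
    have h3 : |c N * ((βt - βhat N ω) i - ∑ j, M⁻¹ i j * pderiv j (risk N ω) βt)| ≤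
        ∑ i, ∑ j, (2 * |M⁻¹ i j|) * (|Y N ω| * |c N * pderiv j (risk N ω) βt|) := by
      rw [abs_mul]
      calc _ ≤ |c N| * (2 * Y N ω * ∑ i, ∑ j, |M⁻¹ i j| * |pderiv j (risk N ω) βt|) := by gcongr
        _ ≤ |c N| * (2 * |Y N ω| * ∑ i, ∑ j, |M⁻¹ i j| * |pderiv j (risk N ω) βt|) := by
          gcongr
          exact le_abs_self _
        _ = _ := by
          simp_rw [abs_mul, Finset.mul_sum]
          refine Finset.sum_congr rfl fun _ _ => Finset.sum_congr rfl fun _ _ => by ring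
    rw [Real.enorm_eq_ofReal_abs]
    refine (ENNReal.ofReal_le_ofReal h3).trans (le_of_eq ?_)
    rw [ENNReal.ofReal_sum_of_nonneg fun _ _ => Finset.sum_nonneg fun _ _ => by positivity]
    refine Finset.sum_congr rfl fun i _ => ?_
    rw [ENNReal.ofReal_sum_of_nonneg fun _ _ => by positivity]
    refine Finset.sum_congr rfl fun j _ => ?_
    rw [ENNReal.ofReal_mul (by positivity), ENNReal.ofReal_mul (by positivity),
      ENNReal.ofReal_mul (by positivity)]
    simp only [Real.enorm_eq_ofReal_abs]
    simp

end ZEstimation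

/-! ### Increments, gradient and Hessian of the one-fold risk -/

section Score

variable {𝒳 : Type*} {k a b : ℕ}

/-- The doubly robust score in the direction `u`, at the working regression function `m`. -/
def score (m f r : 𝒳 → ℝ) (z : Fin a → 𝒳 × ℝ) (t : Fin b → 𝒳) (u : 𝒳 → ℝ) : ℝ :=
  sampleMean z (fun v => u v.1 * ((v.2 - f v.1) * r v.1)) +
    sampleMean t fun x => u x * (f x - m x)

lemma score_add (m f r : 𝒳 → ℝ) (z : Fin a → 𝒳 × ℝ) (t : Fin b → 𝒳) (u u' : 𝒳 → ℝ) :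
    score m f r z t (fun x => u x + u' x) = score m f r z t u + score m f r z t u' := by
  simp only [score, add_mul, sampleMean_add]
  ring

/-- The terms `g β ^ 2` cancel between the two squares of the labelled part, which is therefore
affine in `g β`. Only the unlabelled average is quadratic, which makes the excess risk positive
without any sign condition on `r`. -/
lemma foldRisk_sub (g : EuclideanSpace ℝ (Fin k) → 𝒳 → ℝ) (f r : 𝒳 → ℝ)
    (z : Fin a → 𝒳 × ℝ) (t : Fin b → 𝒳) (β β' : EuclideanSpace ℝ (Fin k)) :
    foldRisk g f r z t β - foldRisk g f r z t β' =
      -2 * score (g β') f r z t (fun x => g β x - g β' x) +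
        sampleMean t fun x => (g β x - g β' x) ^ 2 := by
  simp only [foldRisk, score, sampleMean]
  have e1 : ∑ i, (((z i).2 - g β (z i).1) ^ 2 - (f (z i).1 - g β (z i).1) ^ 2) * r (z i).1 -
      ∑ i, (((z i).2 - g β' (z i).1) ^ 2 - (f (z i).1 - g β' (z i).1) ^ 2) * r (z i).1 =
      -2 * ∑ i, (g β (z i).1 - g β' (z i).1) * (((z i).2 - f (z i).1) * r (z i).1) := by
    rw [← Finset.sum_sub_distrib, Finset.mul_sum]
    exact Finset.sum_congr rfl fun i _ => by ring
  have e2 : ∑ j, (f (t j) - g β (t j)) ^ 2 - ∑ j, (f (t j) - g β' (t j)) ^ 2 =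
      -2 * ∑ j, (g β (t j) - g β' (t j)) * (f (t j) - g β' (t j)) +
        ∑ j, (g β (t j) - g β' (t j)) ^ 2 := by
    rw [← Finset.sum_sub_distrib, Finset.mul_sum, ← Finset.sum_add_distrib]
    exact Finset.sum_congr rfl fun i _ => by ring
  linear_combination (1 / (a : ℝ)) * e1 + (1 / (b : ℝ)) * e2

lemma hasFDerivAt_foldRisk {g : EuclideanSpace ℝ (Fin k) → 𝒳 → ℝ} (f r : 𝒳 → ℝ)
    (z : Fin a → 𝒳 × ℝ) (t : Fin b → 𝒳) {β : EuclideanSpace ℝ (Fin k)}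
    (hd : ∀ x, DifferentiableAt ℝ (fun b => g b x) β) :
    HasFDerivAt (foldRisk g f r z t)
      ((1 / (a : ℝ)) • ∑ i, (-2 * (((z i).2 - f (z i).1) * r (z i).1)) •
          fderiv ℝ (fun b => g b (z i).1) β +
        (1 / (b : ℝ)) • ∑ j, (-2 * (f (t j) - g β (t j))) • fderiv ℝ (fun b => g b (t j)) β) β := by
  refine HasFDerivAt.add ((HasFDerivAt.fun_sum fun i _ => ?_).const_mul _)
    ((HasFDerivAt.fun_sum fun j _ => ?_).const_mul _)
  · have h1 := (((hd (z i).1).hasFDerivAt).const_mul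
      (-2 * (((z i).2 - f (z i).1) * r (z i).1))).const_add
        (((z i).2 ^ 2 - f (z i).1 ^ 2) * r (z i).1)
    refine h1.congr_of_eventuallyEq (Eventually.of_forall fun b => ?_)
    ring
  · have h1 := (((hd (t j)).hasFDerivAt).const_sub (f (t j))).pow 2
    refine h1.congr_fderiv ?_
    ext v
    simp

lemma twiceDifferentiableAt_foldRisk {g : EuclideanSpace ℝ (Fin k) → 𝒳 → ℝ} (f r : 𝒳 → ℝ)
    (z : Fin a → 𝒳 × ℝ) (t : Fin b → 𝒳) {s : Set (EuclideanSpace ℝ (Fin k))} (hs : IsOpen s)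
    (hd : ∀ x, ∀ β ∈ s, TwiceDifferentiableAt (fun b => g b x) β)
    {β : EuclideanSpace ℝ (Fin k)} (hβ : β ∈ s) :
    TwiceDifferentiableAt (foldRisk g f r z t) β := by
  refine ⟨(hasFDerivAt_foldRisk f r z t fun x => (hd x β hβ).1).differentiableAt, ?_⟩
  have heq : fderiv ℝ (foldRisk g f r z t) =ᶠ[𝓝 β] fun b' =>
      (1 / (a : ℝ)) • ∑ i, (-2 * (((z i).2 - f (z i).1) * r (z i).1)) •
          fderiv ℝ (fun b => g b (z i).1) b' +
        (1 / (b : ℝ)) • ∑ j, (-2 * (f (t j) - g b' (t j))) • fderiv ℝ (fun b => g b (t j)) b' := by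
    filter_upwards [hs.mem_nhds hβ] with b' hb'
    exact (hasFDerivAt_foldRisk f r z t fun x => (hd x b' hb').1).fderiv
  refine DifferentiableAt.congr_of_eventuallyEq ?_ heq
  refine DifferentiableAt.fun_add (DifferentiableAt.fun_const_smul
    (DifferentiableAt.fun_sum fun i _ => DifferentiableAt.fun_const_smul (hd _ β hβ).2 _) _)
    (DifferentiableAt.fun_const_smul (DifferentiableAt.fun_sum fun j _ => ?_) _)
  exact DifferentiableAt.fun_smul (((hd _ β hβ).1.const_sub _).const_mul _) (hd _ β hβ).2

lemma pderiv_foldRisk {g : EuclideanSpace ℝ (Fin k) → 𝒳 → ℝ} (f r : 𝒳 → ℝ)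
    (z : Fin a → 𝒳 × ℝ) (t : Fin b → 𝒳) {β : EuclideanSpace ℝ (Fin k)}
    (hd : ∀ x, DifferentiableAt ℝ (fun b => g b x) β) (i : Fin k) :
    pderiv i (foldRisk g f r z t) β =
      -2 * score (g β) f r z t fun x => pderiv i (fun b => g b x) β := by
  rw [pderiv, (hasFDerivAt_foldRisk f r z t hd).fderiv]
  simp only [add_apply, smul_apply,
    sum_apply, smul_eq_mul, score, sampleMean, mul_add]
  congr 1 <;> rw [mul_left_comm] <;> congr 1 <;> rw [Finset.mul_sum] <;>
    refine Finset.sum_congr rfl fun i _ => ?_ <;> simp only [pderiv] <;> ring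

lemma hess_foldRisk {g : EuclideanSpace ℝ (Fin k) → 𝒳 → ℝ} (f r : 𝒳 → ℝ)
    (z : Fin a → 𝒳 × ℝ) (t : Fin b → 𝒳) {s : Set (EuclideanSpace ℝ (Fin k))} (hs : IsOpen s)
    (hd : ∀ x, ∀ β ∈ s, TwiceDifferentiableAt (fun b => g b x) β)
    {β : EuclideanSpace ℝ (Fin k)} (hβ : β ∈ s) (i j : Fin k) :
    hess (foldRisk g f r z t) β i j =
      -2 * score (g β) f r z t (fun x => hess (fun b => g b x) β i j) +
        2 * sampleMean t fun x => pderiv i (fun b => g b x) β * pderiv j (fun b => g b x) β := by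
  -- The gradient formula is needed on a neighbourhood of `β`, not merely at `β`, before it can be
  -- differentiated again.
  have heq : pderiv i (foldRisk g f r z t) =ᶠ[𝓝 β] fun b' =>
      (1 / (a : ℝ)) * ∑ l, (-2 * (((z l).2 - f (z l).1) * r (z l).1)) *
          pderiv i (fun b => g b (z l).1) b' +
        (1 / (b : ℝ)) * ∑ l, (-2 * (f (t l) - g b' (t l))) * pderiv i (fun b => g b (t l)) b' := by
    filter_upwards [hs.mem_nhds hβ] with b' hb'
    rw [pderiv, (hasFDerivAt_foldRisk f r z t fun x => (hd x b' hb').1).fderiv]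
    simp [pderiv]
  have hF : HasFDerivAt (fun b' =>
      (1 / (a : ℝ)) * ∑ l, (-2 * (((z l).2 - f (z l).1) * r (z l).1)) *
          pderiv i (fun b => g b (z l).1) b' +
        (1 / (b : ℝ)) * ∑ l, (-2 * (f (t l) - g b' (t l))) * pderiv i (fun b => g b (t l)) b') _ β :=
    HasFDerivAt.add
      ((HasFDerivAt.fun_sum (u := Finset.univ) fun l _ =>
        ((hd (z l).1 β hβ).differentiableAt_pderiv i).hasFDerivAt.const_mul
          (-2 * (((z l).2 - f (z l).1) * r (z l).1))).const_mul (1 / (a : ℝ)))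
      ((HasFDerivAt.fun_sum (u := Finset.univ) fun l _ =>
        ((((hd (t l) β hβ).1.hasFDerivAt).const_sub (f (t l))).const_mul (-2)).mul
          ((hd (t l) β hβ).differentiableAt_pderiv i).hasFDerivAt).const_mul (1 / (b : ℝ)))
  have h1 : hess (foldRisk g f r z t) β i j =
      fderiv ℝ (pderiv i (foldRisk g f r z t)) β (EuclideanSpace.single j 1) := rfl
  rw [h1, heq.fderiv_eq, hF.fderiv]
  have h2 : ∀ x, fderiv ℝ (pderiv i fun b => g b x) β (EuclideanSpace.single j 1) =
    hess (fun b => g b x) β i j := fun x => rfl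
  have h3 : ∀ x, fderiv ℝ (fun b => g b x) β (EuclideanSpace.single j 1) =
    pderiv j (fun b => g b x) β := fun x => rfl
  simp only [add_apply, smul_apply,
    sum_apply, neg_apply, smul_eq_mul, h2, h3, score,
    sampleMean]
  have e1 : ∑ l, -2 * (((z l).2 - f (z l).1) * r (z l).1) * hess (fun b => g b (z l).1) β i j =
      -2 * ∑ l, hess (fun b => g b (z l).1) β i j * (((z l).2 - f (z l).1) * r (z l).1) := by
    rw [Finset.mul_sum]
    exact Finset.sum_congr rfl fun l _ => by ring
  have e2 : ∑ l, (-2 * (f (t l) - g β (t l)) * hess (fun b => g b (t l)) β i j +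
        pderiv i (fun b => g b (t l)) β * (-2 * -pderiv j (fun b => g b (t l)) β)) =
      -2 * ∑ l, hess (fun b => g b (t l)) β i j * (f (t l) - g β (t l)) +
        2 * ∑ l, pderiv i (fun b => g b (t l)) β * pderiv j (fun b => g b (t l)) β := by
    rw [Finset.mul_sum, Finset.mul_sum, ← Finset.sum_add_distrib]
    exact Finset.sum_congr rfl fun i _ => by ring
  linear_combination (1 / (a : ℝ)) * e1 + (1 / (b : ℝ)) * e2

end Score

/-! ### Second-order calculus of a sum of two functions -/

section Sum

variable {k : ℕ}

lemma TwiceDifferentiableAt.add {F G : EuclideanSpace ℝ (Fin k) → ℝ}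
    {s : Set (EuclideanSpace ℝ (Fin k))} (hs : IsOpen s) (hF : ∀ β ∈ s, TwiceDifferentiableAt F β)
    (hG : ∀ β ∈ s, TwiceDifferentiableAt G β) {β : EuclideanSpace ℝ (Fin k)} (hβ : β ∈ s) :
    TwiceDifferentiableAt (fun b => F b + G b) β ∧
    (∀ i, pderiv i (fun b => F b + G b) β = pderiv i F β + pderiv i G β) ∧
    ∀ i j, hess (fun b => F b + G b) β i j = hess F β i j + hess G β i j := by
  have heq : fderiv ℝ (fun b => F b + G b) =ᶠ[𝓝 β] fun b => fderiv ℝ F b + fderiv ℝ G b := by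
    filter_upwards [hs.mem_nhds hβ] with b hb
    exact fderiv_fun_add (hF b hb).1 (hG b hb).1
  have hp : ∀ i, ∀ b ∈ s, pderiv i (fun b => F b + G b) b = pderiv i F b + pderiv i G b := by
    intro i b hb
    simp [pderiv, fderiv_fun_add (hF b hb).1 (hG b hb).1]
  refine ⟨⟨(hF β hβ).1.add (hG β hβ).1, ?_⟩, fun i => hp i β hβ, fun i j => ?_⟩
  · exact ((hF β hβ).2.add (hG β hβ).2).congr_of_eventuallyEq heq
  · have h2 : pderiv i (fun b => F b + G b) =ᶠ[𝓝 β] fun b => pderiv i F b + pderiv i G b := by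
      filter_upwards [hs.mem_nhds hβ] with b hb
      exact hp i b hb
    have h1 : ∀ H : EuclideanSpace ℝ (Fin k) → ℝ, hess H β i j =
      fderiv ℝ (pderiv i H) β (EuclideanSpace.single j 1) := fun H => rfl
    rw [h1, h1, h1, h2.fderiv_eq, fderiv_fun_add ((hF β hβ).differentiableAt_pderiv i)
      ((hG β hβ).differentiableAt_pderiv i)]
    rfl

end Sum

/-! ### Conditional moments and the population risk -/

section Population

variable {𝒳 : Type*} [MeasurableSpace 𝒳] {μ : Measure 𝒳} [IsProbabilityMeasure μ]
  {w : Kernel 𝒳 ℝ} [IsMarkovKernel w] {C : ℝ}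

omit [IsProbabilityMeasure μ] in
lemma lintegral_compProd_fst [SFinite μ] {F : 𝒳 → ℝ≥0∞} (hF : Measurable F) :
    ∫⁻ v, F v.1 ∂(μ ⊗ₘ w) = ∫⁻ x, F x ∂μ := by
  conv_rhs => rw [← Measure.fst_compProd μ w]
  rw [Measure.fst, lintegral_map hF measurable_fst]

lemma integral_compProd_fst {F : 𝒳 → ℝ} (hF : Measurable F) :
    ∫ v, F v.1 ∂(μ ⊗ₘ w) = ∫ x, F x ∂μ := by
  conv_rhs => rw [← Measure.fst_compProd μ w]
  rw [Measure.fst, integral_map measurable_fst.aemeasurable hF.aestronglyMeasurable]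

omit [IsMarkovKernel w] in
lemma measurable_regressionFn [IsSFiniteKernel w] : Measurable (regressionFn w) := by
  have : StronglyMeasurable fun x => ∫ y, (fun (_ : 𝒳) (y : ℝ) => y) x y ∂(w x) :=
    StronglyMeasurable.integral_kernel_prod_right' (κ := w) (f := fun v : 𝒳 × ℝ => v.2)
      measurable_snd.stronglyMeasurable
  exact this.measurable

lemma measurable_condVar : Measurable (condVar w) := by
  have : StronglyMeasurable fun x => ∫ y, (y - regressionFn w x) ^ 2 ∂(w x) :=
    StronglyMeasurable.integral_kernel_prod_right' (κ := w)
      (f := fun v : 𝒳 × ℝ => (v.2 - regressionFn w v.1) ^ 2)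
      ((measurable_snd.sub (measurable_regressionFn.comp measurable_fst)).pow_const
        2).stronglyMeasurable
  exact this.measurable

lemma ae_ae_abs_le (hy : ∀ᵐ z ∂(μ ⊗ₘ w), |z.2| ≤ C) : ∀ᵐ x ∂μ, ∀ᵐ y ∂(w x), |y| ≤ C :=
  Measure.ae_ae_of_ae_compProd hy

lemma integrable_of_ae_abs_le {ν : Measure ℝ} [IsFiniteMeasure ν] (h : ∀ᵐ y ∂ν, |y| ≤ C) :
    Integrable (fun y : ℝ => y) ν :=
  Integrable.of_bound aestronglyMeasurable_id C h

lemma abs_regressionFn_le {x : 𝒳} (h : ∀ᵐ y ∂(w x), |y| ≤ C) : |regressionFn w x| ≤ C := by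
  simpa [regressionFn] using norm_integral_le_of_norm_le_const (f := fun y : ℝ => y) h

/-- A centred residual is orthogonal to every function of the covariate. -/
lemma integral_mul_residual (hy : ∀ᵐ z ∂(μ ⊗ₘ w), |z.2| ≤ C) {m : 𝒳 → ℝ}
    (hm : regressionFn w =ᵐ[μ] m) (v : 𝒳 → ℝ) :
    ∫ z, v z.1 * (z.2 - m z.1) ∂(μ ⊗ₘ w) = 0 := by
  -- Without integrability the Bochner integral is `0` by convention, so `v` may involve an
  -- arbitrary estimated density ratio.
  by_cases hint : Integrable (fun z : 𝒳 × ℝ => v z.1 * (z.2 - m z.1)) (μ ⊗ₘ w)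
  · rw [Measure.integral_compProd hint]
    refine integral_eq_zero_of_ae ?_
    filter_upwards [ae_ae_abs_le hy, hm] with x hx hmx
    rw [integral_const_mul, integral_sub (integrable_of_ae_abs_le hx) (integrable_const _)]
    simp [← hmx, regressionFn]
  · exact integral_undef hint

lemma integral_sq_sub {x : 𝒳} (h : ∀ᵐ y ∂(w x), |y| ≤ C) (c : ℝ) :
    ∫ y, (y - c) ^ 2 ∂(w x) = condVar w x + (regressionFn w x - c) ^ 2 := by
  have h1 := integrable_of_ae_abs_le h
  have h2 : Integrable (fun y => (y - regressionFn w x) ^ 2) (w x) := by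
    refine Integrable.of_bound (by fun_prop) ((2 * C) ^ 2) ?_
    filter_upwards [h] with y hy
    rw [Real.norm_of_nonneg (sq_nonneg _), ← sq_abs]
    gcongr
    have := abs_regressionFn_le h
    exact (abs_sub _ _).trans (by linarith)
  have h3 : ∀ y, (y - c) ^ 2 = (y - regressionFn w x) ^ 2 +
      ((2 * (regressionFn w x - c)) * (y - regressionFn w x) + (regressionFn w x - c) ^ 2) := by
    intro y; ring
  rw [integral_congr_ae (ae_of_all _ h3)]
  have h4 : Integrable (fun y => y - regressionFn w x) (w x) := h1.sub (integrable_const _)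
  have h5 : Integrable (fun y => 2 * (regressionFn w x - c) * (y - regressionFn w x) +
      (regressionFn w x - c) ^ 2) (w x) := (h4.const_mul _).add (integrable_const _)
  rw [integral_add h2 h5,
    integral_add (h4.const_mul _) (integrable_const _), integral_const_mul,
    integral_sub h1 (integrable_const _)]
  simp [condVar, regressionFn]

/-- The weight `v` serves two purposes: `v = 1` gives the bias-variance decomposition of the risk,
and `v = u u' r₀²` gives the covariance of the oracle scores. -/
lemma integral_mul_sq_residual (hy : ∀ᵐ z ∂(μ ⊗ₘ w), |z.2| ≤ C) {m : 𝒳 → ℝ} (hmm : Measurable m)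
    {v : 𝒳 → ℝ} (hv : Measurable v) {B : ℝ} (hvB : ∀ x, |v x| ≤ B) (hmB : ∀ x, |m x| ≤ B) :
    ∫ z, v z.1 * (z.2 - m z.1) ^ 2 ∂(μ ⊗ₘ w) =
      ∫ x, v x * (condVar w x + (regressionFn w x - m x) ^ 2) ∂μ := by
  have hint : Integrable (fun z : 𝒳 × ℝ => v z.1 * (z.2 - m z.1) ^ 2) (μ ⊗ₘ w) := by
    refine Integrable.of_bound (Measurable.aestronglyMeasurable ?_) (B * (C + B) ^ 2) ?_
    · exact (hv.comp measurable_fst).mul ((measurable_snd.sub (hmm.comp measurable_fst)).pow_const 2)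
    · filter_upwards [hy] with z hz
      have hB0 : 0 ≤ B := (abs_nonneg _).trans (hvB z.1)
      rw [norm_mul, norm_pow]
      simp only [Real.norm_eq_abs]
      gcongr
      · exact hvB _
      · exact (abs_sub _ _).trans (add_le_add hz (hmB _))
  rw [Measure.integral_compProd hint]
  refine integral_congr_ae ?_
  filter_upwards [ae_ae_abs_le hy] with x hx
  simp only [integral_const_mul, integral_sq_sub hx]

omit [IsMarkovKernel w] in
lemma condVar_nonneg (x : 𝒳) : 0 ≤ condVar w x := integral_nonneg fun _ => sq_nonneg _

lemma ae_condVar_le (hy : ∀ᵐ z ∂(μ ⊗ₘ w), |z.2| ≤ C) : ∀ᵐ x ∂μ, condVar w x ≤ C ^ 2 := by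
  filter_upwards [ae_ae_abs_le hy] with x hx
  have h1 := integral_sq_sub hx 0
  have h2 : ∫ y, (y - 0) ^ 2 ∂(w x) ≤ C ^ 2 := by
    have : ‖∫ y, (y - 0) ^ 2 ∂(w x)‖ ≤ C ^ 2 * (w x).real Set.univ := by
      refine norm_integral_le_of_norm_le_const ?_
      filter_upwards [hx] with y hy
      rw [sub_zero, Real.norm_of_nonneg (sq_nonneg _), ← sq_abs]
      gcongr
    simpa using (le_abs_self _).trans this
  nlinarith [sq_nonneg (regressionFn w x - 0)]

/-- Bias-variance decomposition of the population risk. -/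
lemma popRisk_eq {k : ℕ} (hy : ∀ᵐ z ∂(μ ⊗ₘ w), |z.2| ≤ C)
    {g : EuclideanSpace ℝ (Fin k) → 𝒳 → ℝ} {β : EuclideanSpace ℝ (Fin k)}
    (hg : Measurable (g β)) {B : ℝ} (hgB : ∀ x, |g β x| ≤ B) :
    popRisk μ w g β = ∫ x, condVar w x ∂μ + ∫ x, (regressionFn w x - g β x) ^ 2 ∂μ := by
  have h := integral_mul_sq_residual hy hg (v := fun _ => 1) measurable_const (B := max B 1)
    (fun _ => by simp) (fun x => (hgB x).trans (le_max_left _ _))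
  simp only [one_mul] at h
  rw [popRisk, h]
  refine integral_add ?_ ?_
  · refine Integrable.of_bound measurable_condVar.aestronglyMeasurable (C ^ 2) ?_
    filter_upwards [ae_condVar_le hy] with x hx
    rwa [Real.norm_of_nonneg (condVar_nonneg x)]
  · refine Integrable.of_bound
      ((measurable_regressionFn.sub hg).pow_const 2).aestronglyMeasurable ((C + B) ^ 2) ?_
    filter_upwards [ae_ae_abs_le hy] with x hx
    rw [norm_pow, Real.norm_eq_abs]
    gcongr
    exact (abs_sub _ _).trans (add_le_add (abs_regressionFn_le hx) (hgB x))

/-- A correctly specified model is identified by any minimizer of the population risk. -/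
lemma isArgmin_popRisk_iff {k : ℕ} (hy : ∀ᵐ z ∂(μ ⊗ₘ w), |z.2| ≤ C)
    {g : EuclideanSpace ℝ (Fin k) → 𝒳 → ℝ} {Θ : Set (EuclideanSpace ℝ (Fin k))}
    (hg : ∀ β ∈ Θ, Measurable (g β)) {B : ℝ} (hgB : ∀ β ∈ Θ, ∀ x, |g β x| ≤ B)
    (hspec : ∃ β ∈ Θ, regressionFn w =ᵐ[μ] g β) (β : EuclideanSpace ℝ (Fin k)) :
    IsArgmin (popRisk μ w g) Θ β ↔ β ∈ Θ ∧ regressionFn w =ᵐ[μ] g β := by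
  obtain ⟨β', hβ', hspec⟩ := hspec
  have hzero : ∀ b, regressionFn w =ᵐ[μ] g b →
      ∫ x, (regressionFn w x - g b x) ^ 2 ∂μ = 0 := by
    intro b hb
    refine integral_eq_zero_of_ae ?_
    filter_upwards [hb] with x hx
    simp [hx]
  constructor
  · rintro ⟨hβ, hmin⟩
    refine ⟨hβ, ?_⟩
    -- At the correctly specified `β'` the bias term is zero, so minimality of `β` forces its own
    -- bias integral to be at most zero.
    have h1 := hmin β' hβ'
    rw [popRisk_eq hy (hg β hβ) (hgB β hβ), popRisk_eq hy (hg β' hβ') (hgB β' hβ'),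
      hzero β' hspec] at h1
    have h2 : ∫ x, (regressionFn w x - g β x) ^ 2 ∂μ = 0 :=
      le_antisymm (by linarith) (integral_nonneg fun _ => sq_nonneg _)
    have hint : Integrable (fun x => (regressionFn w x - g β x) ^ 2) μ := by
      refine Integrable.of_bound
        ((measurable_regressionFn.sub (hg β hβ)).pow_const 2).aestronglyMeasurable
        ((C + B) ^ 2) ?_
      filter_upwards [ae_ae_abs_le hy] with x hx
      rw [norm_pow, Real.norm_eq_abs]
      gcongr
      exact (abs_sub _ _).trans (add_le_add (abs_regressionFn_le hx) (hgB β hβ x))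
    have h3 := (integral_eq_zero_iff_of_nonneg (fun _ => sq_nonneg _) hint).1 h2
    filter_upwards [h3] with x hx
    have : regressionFn w x - g β x = 0 := by simpa using hx
    linarith
  · rintro ⟨hβ, hae⟩
    refine ⟨hβ, fun b hb => ?_⟩
    rw [popRisk_eq hy (hg β hβ) (hgB β hβ), popRisk_eq hy (hg b hb) (hgB b hb), hzero β hae,
      add_zero]
    exact le_add_of_nonneg_right (integral_nonneg fun _ => sq_nonneg _)

end Population

/-! ### Change of measure from `q` to `p` -/

section DensityRatio

variable {𝒳 : Type*} [MeasurableSpace 𝒳] {p q : Measure 𝒳} {r₀ : 𝒳 → ℝ}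

lemma integral_eq_integral_mul_density (hr₀ : Measurable r₀) (hr0 : ∀ x, 0 ≤ r₀ x)
    (hq : q = p.withDensity fun x => ENNReal.ofReal (r₀ x)) (u : 𝒳 → ℝ) :
    ∫ x, u x ∂q = ∫ x, u x * r₀ x ∂p := by
  rw [hq, integral_withDensity_eq_integral_toReal_smul hr₀.ennreal_ofReal (by simp)]
  refine integral_congr_ae (ae_of_all _ fun x => ?_)
  simp [ENNReal.toReal_ofReal (hr0 x), mul_comm]

lemma lintegral_le_const_mul (hr₀ : Measurable r₀) {K : ℝ} (hrK : ∀ x, r₀ x ≤ K)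
    (hq : q = p.withDensity fun x => ENNReal.ofReal (r₀ x)) {u : 𝒳 → ℝ≥0∞} (hu : Measurable u) :
    ∫⁻ x, u x ∂q ≤ ENNReal.ofReal K * ∫⁻ x, u x ∂p := by
  rw [hq, lintegral_withDensity_eq_lintegral_mul _ hr₀.ennreal_ofReal hu,
    ← lintegral_const_mul _ hu]
  refine lintegral_mono fun x => ?_
  simp only [Pi.mul_apply]
  gcongr
  exact hrK x

end DensityRatio

/-! ### `L¹` and `L²` bounds in extended nonnegative form -/

section Norms

variable {𝒳 : Type*} [MeasurableSpace 𝒳] {μ : Measure 𝒳}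

lemma lintegral_enorm_sq_eq (f : 𝒳 → ℝ) : ∫⁻ x, ‖f x‖ₑ ^ 2 ∂μ = eLpNorm f 2 μ ^ 2 := by
  rw [eLpNorm_eq_lintegral_rpow_enorm_toReal (by simp) (by simp)]
  simp only [ENNReal.toReal_ofNat, ENNReal.rpow_ofNat]
  rw [← ENNReal.rpow_natCast, ← ENNReal.rpow_mul]
  simp

lemma lintegral_enorm_mul_le {f h : 𝒳 → ℝ} (hf : Measurable f) (hh : Measurable h) :
    ∫⁻ x, ‖f x * h x‖ₑ ∂μ ≤ eLpNorm f 2 μ * eLpNorm h 2 μ := by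
  have := eLpNorm_smul_le_mul_eLpNorm (p := 2) (q := 2) (r := 1) (μ := μ)
    hh.aestronglyMeasurable hf.aestronglyMeasurable
  rwa [eLpNorm_one_eq_lintegral_enorm] at this

lemma lintegral_enorm_le [IsProbabilityMeasure μ] {f : 𝒳 → ℝ} (hf : Measurable f) :
    ∫⁻ x, ‖f x‖ₑ ∂μ ≤ eLpNorm f 2 μ := by
  rw [← eLpNorm_one_eq_lintegral_enorm]
  exact eLpNorm_le_eLpNorm_of_exponent_le (by norm_num) hf.aestronglyMeasurable

end Norms

set_option linter.unusedSectionVars false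

/-! ### First-order insensitivity of the cross-fitted score -/

section Fold

variable {Ω : Type*} [MeasurableSpace Ω] {𝒳 : Type*} [MeasurableSpace 𝒳]

/-- One fold of the cross-fitted sample: a labelled sample `X N` from `p ⊗ₘ w` and an unlabelled
sample `T N` from `q`, with nuisance estimators `fh N`, `rh N` that are functions of an independent
variable `Z N`. The function `m` is a bounded version of the regression function, and `K` bounds
the outcome, the density ratio and `m`. -/
structure IsCrossFitFold (P : Measure Ω) (p q : Measure 𝒳) (w : Kernel 𝒳 ℝ) (r₀ m : 𝒳 → ℝ)
    (K ρ : ℝ) (a b : ℕ → ℕ) (X : ∀ N, Fin (a N) → Ω → 𝒳 × ℝ) (T : ∀ N, Fin (b N) → Ω → 𝒳)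
    {E : ℕ → Type*} [∀ N, MeasurableSpace (E N)] (Z : ∀ N, Ω → E N)
    (fh rh : ∀ N, E N → 𝒳 → ℝ) : Prop where
  train : IsIndepSample P (p ⊗ₘ w) a X Z
  test : IsIndepSample P q b T Z
  pos : 0 < ρ
  size : ∀ N, ((2 * b N : ℕ) : ℝ) = ρ * ((2 * a N : ℕ) : ℝ)
  abs_outcome_le : ∀ᵐ z ∂(p ⊗ₘ w), |z.2| ≤ K
  measurable_ratio : Measurable r₀
  ratio_nonneg : ∀ x, 0 ≤ r₀ x
  ratio_le : ∀ x, r₀ x ≤ K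
  density : q = p.withDensity fun x => ENNReal.ofReal (r₀ x)
  measurable_m : Measurable m
  abs_m_le : ∀ x, |m x| ≤ K
  regressionFn_eq : regressionFn w =ᵐ[p] m
  measurable_f : ∀ N, Measurable (Function.uncurry (fh N))
  measurable_r : ∀ N, Measurable (Function.uncurry (rh N))
  ratio_conv : IsLittleOpOne P fun N ω => eLpNorm (fun x => rh N (Z N ω) x - r₀ x) 2 p
  regression_conv : IsLittleOpOne P fun N ω => eLpNorm (fun x => fh N (Z N ω) x - m x) 2 p
  product_conv : IsLittleOpOne P fun N ω =>
      ENNReal.ofReal (Real.sqrt (min (2 * a N : ℕ) (2 * b N : ℕ) : ℕ)) *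
        (eLpNorm (fun x => rh N (Z N ω) x - r₀ x) 2 p *
          eLpNorm (fun x => fh N (Z N ω) x - m x) 2 p)

lemma enorm_sqrt_sq (n : ℕ) : ‖Real.sqrt n‖ₑ ^ 2 = (n : ℝ≥0∞) := by
  rw [Real.enorm_eq_ofReal (Real.sqrt_nonneg _), ← ENNReal.ofReal_pow (Real.sqrt_nonneg _),
    Real.sq_sqrt (by positivity)]
  simp

lemma sqrt_sq_mul_inv_le (n : ℕ) :
    ‖Real.sqrt ((2 * n : ℕ) : ℝ)‖ₑ ^ 2 * (n : ℝ≥0∞)⁻¹ ≤ 2 := by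
  rw [enorm_sqrt_sq]
  push_cast
  rw [mul_assoc]
  calc (2 : ℝ≥0∞) * (n * (n : ℝ≥0∞)⁻¹) ≤ 2 * 1 := by gcongr; exact ENNReal.mul_inv_le_one _
    _ = 2 := mul_one 2

lemma sqrt_sq_mul_inv_le_of_ratio {n n' : ℕ} {ρ : ℝ} (hρ : 0 < ρ)
    (h : ((2 * n' : ℕ) : ℝ) = ρ * ((2 * n : ℕ) : ℝ)) :
    ‖Real.sqrt ((2 * n : ℕ) : ℝ)‖ₑ ^ 2 * (n' : ℝ≥0∞)⁻¹ ≤ ENNReal.ofReal (2 / ρ) := by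
  rw [enorm_sqrt_sq]
  have h1 : ((2 * n : ℕ) : ℝ) = 2 / ρ * n' := by
    push_cast at h ⊢
    field_simp
    linarith
  have h2 : ((2 * n : ℕ) : ℝ≥0∞) = ENNReal.ofReal (2 / ρ) * n' := by
    rw [← ENNReal.ofReal_natCast, h1, ENNReal.ofReal_mul (by positivity), ENNReal.ofReal_natCast]
  rw [h2, mul_assoc]
  calc _ ≤ ENNReal.ofReal (2 / ρ) * 1 := by gcongr; exact ENNReal.mul_inv_le_one _
    _ = _ := mul_one _

/-- The product rate is stated with `min n m`, whereas the scores are scaled by `√n`. Proportional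
sample sizes make the two comparable up to a constant. -/
lemma enorm_sqrt_le_of_ratio {n n' : ℕ} {ρ : ℝ} (hρ : 0 < ρ)
    (h : ((2 * n' : ℕ) : ℝ) = ρ * ((2 * n : ℕ) : ℝ)) :
    ‖Real.sqrt ((2 * n : ℕ) : ℝ)‖ₑ ≤ ENNReal.ofReal (Real.sqrt (max 1 (1 / ρ))) *
      ENNReal.ofReal (Real.sqrt (min (2 * n : ℕ) (2 * n' : ℕ) : ℕ)) := by
  rw [Real.enorm_eq_ofReal (Real.sqrt_nonneg _), ← ENNReal.ofReal_mul (Real.sqrt_nonneg _),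
    ← Real.sqrt_mul (by positivity)]
  refine ENNReal.ofReal_le_ofReal (Real.sqrt_le_sqrt ?_)
  rcases min_choice (2 * n) (2 * n') with h' | h' <;> rw [h']
  · exact le_mul_of_one_le_left (by positivity) (le_max_left _ _)
  · calc ((2 * n : ℕ) : ℝ) = 1 / ρ * ((2 * n' : ℕ) : ℝ) := by rw [h]; field_simp
      _ ≤ _ := by gcongr; exact le_max_right _ _

lemma lintegral_enorm_mul_sq_le {𝒲 : Type*} [MeasurableSpace 𝒲] {μ : Measure 𝒲} {c d : 𝒲 → ℝ}
    {M : ℝ} (hc : ∀ᵐ v ∂μ, |c v| ≤ M) :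
    ∫⁻ v, ‖c v * d v‖ₑ ^ 2 ∂μ ≤ ENNReal.ofReal M ^ 2 * ∫⁻ v, ‖d v‖ₑ ^ 2 ∂μ := by
  rw [← lintegral_const_mul' _ _ (by simp)]
  refine lintegral_mono_ae ?_
  filter_upwards [hc] with v hv
  rw [enorm_mul, mul_pow]
  gcongr
  rw [Real.enorm_eq_ofReal_abs]
  gcongr

lemma lintegral_enorm_mul_le_const {𝒲 : Type*} [MeasurableSpace 𝒲] {μ : Measure 𝒲} {c d : 𝒲 → ℝ}
    {M : ℝ} (hc : ∀ᵐ v ∂μ, |c v| ≤ M) :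
    ∫⁻ v, ‖c v * d v‖ₑ ∂μ ≤ ENNReal.ofReal M * ∫⁻ v, ‖d v‖ₑ ∂μ := by
  rw [← lintegral_const_mul' _ _ (by simp)]
  refine lintegral_mono_ae ?_
  filter_upwards [hc] with v hv
  rw [enorm_mul]
  gcongr
  rw [Real.enorm_eq_ofReal_abs]
  gcongr

variable {P : Measure Ω} [IsProbabilityMeasure P] {p q : Measure 𝒳} [IsProbabilityMeasure p]
  [IsProbabilityMeasure q] {w : Kernel 𝒳 ℝ} [IsMarkovKernel w] {r₀ m : 𝒳 → ℝ}
  {K ρ : ℝ} {a b : ℕ → ℕ} {X : ∀ N, Fin (a N) → Ω → 𝒳 × ℝ} {T : ∀ N, Fin (b N) → Ω → 𝒳}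
  {E : ℕ → Type*} [∀ N, MeasurableSpace (E N)] {Z : ∀ N, Ω → E N}
  {fh rh : ∀ N, E N → 𝒳 → ℝ}

/-- The influence function of the score in the direction `u`. -/
def oracle (m r₀ u : 𝒳 → ℝ) (v : 𝒳 × ℝ) : ℝ := u v.1 * ((v.2 - m v.1) * r₀ v.1)

namespace IsCrossFitFold

variable (h : IsCrossFitFold P p q w r₀ m K ρ a b X T Z fh rh)
include h

lemma measurable_f_train (N : ℕ) :
    Measurable fun v : E N × (𝒳 × ℝ) => fh N v.1 v.2.1 :=
  (h.measurable_f N).comp (measurable_fst.prodMk (measurable_fst.comp measurable_snd))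

lemma measurable_r_train (N : ℕ) :
    Measurable fun v : E N × (𝒳 × ℝ) => rh N v.1 v.2.1 :=
  (h.measurable_r N).comp (measurable_fst.prodMk (measurable_fst.comp measurable_snd))

lemma abs_residual_le : ∀ᵐ z ∂(p ⊗ₘ w), |z.2 - m z.1| ≤ 2 * K := by
  filter_upwards [h.abs_outcome_le] with z hz
  exact (abs_sub _ _).trans (by linarith [h.abs_m_le z.1])

lemma bound_nonneg [Nonempty 𝒳] : 0 ≤ K := (abs_nonneg _).trans (h.abs_m_le (Classical.arbitrary 𝒳))

lemma abs_ratio_le (x : 𝒳) : |r₀ x| ≤ K := by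
  rw [abs_of_nonneg (h.ratio_nonneg x)]
  exact h.ratio_le x

lemma measurable_fdiff (N : ℕ) (z : E N) : Measurable fun x => fh N z x - m x :=
  ((h.measurable_f N).comp measurable_prodMk_left).sub h.measurable_m

lemma measurable_rdiff (N : ℕ) (z : E N) : Measurable fun x => rh N z x - r₀ x :=
  ((h.measurable_r N).comp measurable_prodMk_left).sub h.measurable_ratio

lemma lintegral_fdiff_sq (N : ℕ) (z : E N) :
    ∫⁻ v, ‖fh N z v.1 - m v.1‖ₑ ^ 2 ∂(p ⊗ₘ w) = eLpNorm (fun x => fh N z x - m x) 2 p ^ 2 := by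
  rw [lintegral_compProd_fst (F := fun x => ‖fh N z x - m x‖ₑ ^ 2)
    ((h.measurable_fdiff N z).enorm.pow_const 2), lintegral_enorm_sq_eq]

lemma lintegral_rdiff_sq (N : ℕ) (z : E N) :
    ∫⁻ v, ‖rh N z v.1 - r₀ v.1‖ₑ ^ 2 ∂(p ⊗ₘ w) = eLpNorm (fun x => rh N z x - r₀ x) 2 p ^ 2 := by
  rw [lintegral_compProd_fst (F := fun x => ‖rh N z x - r₀ x‖ₑ ^ 2)
    ((h.measurable_rdiff N z).enorm.pow_const 2), lintegral_enorm_sq_eq]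

lemma lintegral_prod_le (N : ℕ) (z : E N) :
    ∫⁻ v, ‖(fh N z v.1 - m v.1) * (rh N z v.1 - r₀ v.1)‖ₑ ∂(p ⊗ₘ w) ≤
      eLpNorm (fun x => rh N z x - r₀ x) 2 p * eLpNorm (fun x => fh N z x - m x) 2 p := by
  rw [lintegral_compProd_fst (F := fun x => ‖(fh N z x - m x) * (rh N z x - r₀ x)‖ₑ)
    ((h.measurable_fdiff N z).mul (h.measurable_rdiff N z)).enorm, mul_comm]
  exact lintegral_enorm_mul_le (h.measurable_fdiff N z) (h.measurable_rdiff N z)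

/-- The cross-fitted score is first-order equivalent to the score with the true nuisances. -/
theorem isLittleOpOne_sqrt_mul_score_sub {u : 𝒳 → ℝ} (hu : Measurable u) {B : ℝ}
    (huB : ∀ x, |u x| ≤ B) :
    IsLittleOpOne P fun N ω => ‖Real.sqrt ((2 * a N : ℕ) : ℝ) *
      (score m (fh N (Z N ω)) (rh N (Z N ω)) (fun i => X N i ω) (fun j => T N j ω) u -
        sampleMean (fun i => X N i ω) (oracle m r₀ u))‖ₑ := by
  have hu1 : ∀ N, Measurable fun v : E N × (𝒳 × ℝ) => u v.2.1 := fun N =>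
    hu.comp (measurable_fst.comp measurable_snd)
  have hm1 : ∀ N, Measurable fun v : E N × (𝒳 × ℝ) => m v.2.1 := fun N =>
    h.measurable_m.comp (measurable_fst.comp measurable_snd)
  have hr1 : ∀ N, Measurable fun v : E N × (𝒳 × ℝ) => r₀ v.2.1 := fun N =>
    h.measurable_ratio.comp (measurable_fst.comp measurable_snd)
  have hf1 := h.measurable_f_train
  have hrh1 := h.measurable_r_train
  -- Error in `r̂` alone, multiplied by the true residual: conditional variance of order `‖r̂ - r₀‖²
  -- / n`.
  have H1 := h.train.isLittleOpOne_sampleMean_sub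
    (h := fun N z v => (u v.1 * (v.2 - m v.1)) * (rh N z v.1 - r₀ v.1))
    (fun N => ((hu1 N).mul ((measurable_snd.comp measurable_snd).sub (hm1 N))).mul
      ((hrh1 N).sub (hr1 N))) (c := fun N => Real.sqrt ((2 * a N : ℕ) : ℝ)) (by
      refine (h.ratio_conv.sq.const_mul (c := 2 * ENNReal.ofReal (B * (2 * K)) ^ 2)
        (ENNReal.mul_ne_top (by simp) (by simp))).mono fun N ω => ?_
      rw [mul_assoc 2]
      refine mul_le_mul' (sqrt_sq_mul_inv_le _) ?_
      rw [← h.lintegral_rdiff_sq]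
      refine lintegral_enorm_mul_sq_le ?_
      filter_upwards [h.abs_residual_le] with v hv
      rw [abs_mul]
      exact mul_le_mul (huB _) hv (abs_nonneg _) ((abs_nonneg _).trans (huB v.1)))
  -- The product error is not centred. Cauchy–Schwarz bounds its `L¹` norm, and this is where the
  -- product rate is spent.
  have H2 := h.train.isLittleOpOne_sampleMean
    (h := fun N z v => u v.1 * ((fh N z v.1 - m v.1) * (rh N z v.1 - r₀ v.1)))
    (fun N => (hu1 N).mul (((hf1 N).sub (hm1 N)).mul ((hrh1 N).sub (hr1 N))))
    (c := fun N => Real.sqrt ((2 * a N : ℕ) : ℝ)) (by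
      refine (h.product_conv.const_mul
        (c := ENNReal.ofReal (Real.sqrt (max 1 (1 / ρ))) * ENNReal.ofReal B)
        (ENNReal.mul_ne_top (by simp) (by simp))).mono fun N ω => ?_
      rw [mul_mul_mul_comm]
      refine mul_le_mul' (enorm_sqrt_le_of_ratio h.pos (h.size N)) ?_
      refine (lintegral_enorm_mul_le_const (c := fun v : 𝒳 × ℝ => u v.1)
        (ae_of_all _ fun v => huB v.1)).trans ?_
      gcongr
      exact h.lintegral_prod_le N _)
  -- Error in `f̂` alone, on the labelled data, about its conditional mean.
  have H3 := h.train.isLittleOpOne_sampleMean_sub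
    (h := fun N z v => (u v.1 * r₀ v.1) * (fh N z v.1 - m v.1))
    (fun N => ((hu1 N).mul (hr1 N)).mul ((hf1 N).sub (hm1 N)))
    (c := fun N => Real.sqrt ((2 * a N : ℕ) : ℝ)) (by
      refine (h.regression_conv.sq.const_mul (c := 2 * ENNReal.ofReal (B * K) ^ 2)
        (ENNReal.mul_ne_top (by simp) (by simp))).mono fun N ω => ?_
      rw [mul_assoc 2]
      refine mul_le_mul' (sqrt_sq_mul_inv_le _) ?_
      rw [← h.lintegral_fdiff_sq]
      refine lintegral_enorm_mul_sq_le (ae_of_all _ fun v => ?_)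
      rw [abs_mul]
      exact mul_le_mul (huB _) (h.abs_ratio_le _) (abs_nonneg _) ((abs_nonneg _).trans (huB v.1)))
  -- The matching error on the unlabelled data. Its second moment under `q` is transferred to `p` by
  -- the bound on the density ratio.
  have H4 := h.test.isLittleOpOne_sampleMean_sub
    (h := fun N z x => u x * (fh N z x - m x))
    (fun N => (hu.comp measurable_snd).mul
      ((h.measurable_f N).sub (h.measurable_m.comp measurable_snd)))
    (c := fun N => Real.sqrt ((2 * a N : ℕ) : ℝ)) (by
      refine (h.regression_conv.sq.const_mul
        (c := ENNReal.ofReal (2 / ρ) * (ENNReal.ofReal B ^ 2 * ENNReal.ofReal K))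
        (ENNReal.mul_ne_top (by simp) (ENNReal.mul_ne_top (by simp) (by simp)))).mono
        fun N ω => ?_
      rw [mul_assoc (ENNReal.ofReal (2 / ρ))]
      refine mul_le_mul' (sqrt_sq_mul_inv_le_of_ratio h.pos (h.size N)) ?_
      refine (lintegral_enorm_mul_sq_le (ae_of_all _ huB)).trans ?_
      rw [mul_assoc, ← lintegral_enorm_sq_eq]
      gcongr
      exact lintegral_le_const_mul h.measurable_ratio h.ratio_le h.density
        ((h.measurable_fdiff N _).enorm.pow_const 2))
  refine (((H1.add H2).add H3).add H4).mono fun N ω => ?_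
  set z := Z N ω
  have i1 : ∫ v, (u v.1 * (v.2 - m v.1)) * (rh N z v.1 - r₀ v.1) ∂(p ⊗ₘ w) = 0 := by
    rw [← integral_mul_residual h.abs_outcome_le h.regressionFn_eq
      fun x => u x * (rh N z x - r₀ x)]
    exact integral_congr_ae (ae_of_all _ fun v => by ring)
  -- The conditional means in `H3` and `H4` coincide, because weighting by `r₀` turns `p` into `q`.
  -- They enter the score with opposite signs and cancel, so the error in `f̂` has no first-order
  -- effect.
  have i2 : ∫ v, (u v.1 * r₀ v.1) * (fh N z v.1 - m v.1) ∂(p ⊗ₘ w) =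
      ∫ x, u x * (fh N z x - m x) ∂q := by
    rw [integral_compProd_fst (F := fun x => (u x * r₀ x) * (fh N z x - m x))
      ((hu.mul h.measurable_ratio).mul (h.measurable_fdiff N z)),
      integral_eq_integral_mul_density h.measurable_ratio h.ratio_nonneg h.density]
    exact integral_congr_ae (ae_of_all _ fun v => by ring)
  simp only [i1, i2]
  have key : score m (fh N z) (rh N z) (fun i => X N i ω) (fun j => T N j ω) u -
        sampleMean (fun i => X N i ω) (oracle m r₀ u) =
      ((sampleMean (fun i => X N i ω) fun v => (u v.1 * (v.2 - m v.1)) * (rh N z v.1 - r₀ v.1)) -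
        sampleMean (fun i => X N i ω)
          fun v => u v.1 * ((fh N z v.1 - m v.1) * (rh N z v.1 - r₀ v.1))) -
        (sampleMean (fun i => X N i ω) fun v => (u v.1 * r₀ v.1) * (fh N z v.1 - m v.1)) +
        sampleMean (fun j => T N j ω) fun x => u x * (fh N z x - m x) := by
    rw [score, ← sampleMean_sub, ← sampleMean_sub, add_sub_right_comm, ← sampleMean_sub]
    congr 2
    ext v
    simp only [oracle]
    ring
  rw [key]
  set c := Real.sqrt ((2 * a N : ℕ) : ℝ)
  set I := ∫ x, u x * (fh N z x - m x) ∂q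
  set A1 := sampleMean (fun i => X N i ω)
    fun v => (u v.1 * (v.2 - m v.1)) * (rh N z v.1 - r₀ v.1)
  set A2 := sampleMean (fun i => X N i ω)
    fun v => u v.1 * ((fh N z v.1 - m v.1) * (rh N z v.1 - r₀ v.1))
  set A3 := sampleMean (fun i => X N i ω) fun v => (u v.1 * r₀ v.1) * (fh N z v.1 - m v.1)
  set A4 := sampleMean (fun j => T N j ω) fun x => u x * (fh N z x - m x)
  have e : c * (A1 - A2 - A3 + A4) =
      ((c * (A1 - 0) - c * A2) - c * (A3 - I)) + c * (A4 - I) := by ring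
  rw [e]
  refine (enorm_add_le _ _).trans (add_le_add ((enorm_sub_le).trans
    (add_le_add (enorm_sub_le) le_rfl)) le_rfl)

lemma measurable_oracle {u : 𝒳 → ℝ} (hu : Measurable u) : Measurable (oracle m r₀ u) :=
  (hu.comp measurable_fst).mul ((measurable_snd.sub (h.measurable_m.comp measurable_fst)).mul
    (h.measurable_ratio.comp measurable_fst))

lemma abs_oracle_le {u : 𝒳 → ℝ} {B : ℝ} (huB : ∀ x, |u x| ≤ B) :
    ∀ᵐ v ∂(p ⊗ₘ w), |oracle m r₀ u v| ≤ B * (2 * K * K) := by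
  filter_upwards [h.abs_residual_le] with v hv
  have hB0 : 0 ≤ B := (abs_nonneg _).trans (huB v.1)
  have hK0 : 0 ≤ 2 * K := (abs_nonneg _).trans hv
  rw [oracle, abs_mul, abs_mul]
  exact mul_le_mul (huB _) (mul_le_mul hv (h.abs_ratio_le _) (abs_nonneg _) hK0)
    (by positivity) hB0

lemma integral_oracle (u : 𝒳 → ℝ) : ∫ v, oracle m r₀ u v ∂(p ⊗ₘ w) = 0 := by
  rw [← integral_mul_residual h.abs_outcome_le h.regressionFn_eq fun x => u x * r₀ x]
  exact integral_congr_ae (ae_of_all _ fun v => by simp only [oracle]; ring)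

/-- The oracle average obeys the law of large numbers with mean zero, and the remainder is small
even after multiplication by `√n ≥ 1`. -/
lemma isLittleOpOne_score {u : 𝒳 → ℝ} (hu : Measurable u) {B : ℝ} (huB : ∀ x, |u x| ≤ B) :
    IsLittleOpOne P fun N ω =>
      ‖score m (fh N (Z N ω)) (rh N (Z N ω)) (fun i => X N i ω) (fun j => T N j ω) u‖ₑ := by
  have h1 := h.train.isLittleOpOne_sampleMean_sub_of_bounded (h.measurable_oracle hu)
    (h.abs_oracle_le huB)
  simp only [h.integral_oracle, sub_zero] at h1
  refine ((h.isLittleOpOne_sqrt_mul_score_sub hu huB).add h1).mono_ae ?_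
  filter_upwards [h.train.tendsto_size.eventually_ge_atTop 1] with N hN
  refine ae_of_all _ fun ω => ?_
  have h2 : 1 ≤ Real.sqrt ((2 * a N : ℕ) : ℝ) := by
    rw [Real.one_le_sqrt]
    exact_mod_cast (by omega : 1 ≤ 2 * a N)
  set S := score m (fh N (Z N ω)) (rh N (Z N ω)) (fun i => X N i ω) (fun j => T N j ω) u
  set A := sampleMean (fun i => X N i ω) (oracle m r₀ u)
  calc ‖S‖ₑ = ‖(S - A) + A‖ₑ := by rw [sub_add_cancel]
    _ ≤ ‖S - A‖ₑ + ‖A‖ₑ := enorm_add_le _ _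
    _ ≤ _ := by
      gcongr
      rw [enorm_mul]
      refine le_mul_of_one_le_left zero_le ?_
      rw [Real.enorm_eq_ofReal (by positivity)]
      exact ENNReal.one_le_ofReal.2 h2

/-- The rescaled score is bounded in probability. -/
lemma isLittleOpOne_mul_sqrt_mul_score {u : 𝒳 → ℝ} (hu : Measurable u) {B : ℝ}
    (huB : ∀ x, |u x| ≤ B) {Y : ℕ → Ω → ℝ≥0∞} (hY : IsLittleOpOne P Y) :
    IsLittleOpOne P fun N ω => Y N ω * ‖Real.sqrt ((2 * a N : ℕ) : ℝ) *
      score m (fh N (Z N ω)) (rh N (Z N ω)) (fun i => X N i ω) (fun j => T N j ω) u‖ₑ := by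
  have h1 : IsLittleOpOne P fun N ω => Y N ω *
      ‖Real.sqrt ((2 * a N : ℕ) : ℝ) * sampleMean (fun i => X N i ω) (oracle m r₀ u)‖ₑ := by
    have hsm : Measurable (oracle m r₀ u) := h.measurable_oracle hu
    have hvm : ∀ N, Measurable fun v : Fin (a N) → 𝒳 × ℝ =>
        sampleMean v (oracle m r₀ u) := fun N =>
      (Finset.measurable_sum _ fun i _ => hsm.comp (measurable_pi_apply i)).const_mul _
    have hXm : ∀ N, Measurable fun ω i => X N i ω := fun N =>
      measurable_pi_lambda _ (h.train.measurable N)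
    -- The oracle average has second moment of order `1 / n`, so its rescaled version is bounded in
    -- `L²`, and an `o_p(1)` factor keeps the product `o_p(1)`.
    refine hY.mul_of_lintegral_sq_le (c := 2 * ENNReal.ofReal (B * (2 * K * K)) ^ 2)
      (fun N => (((hvm N).comp (hXm N)).const_mul _).enorm.aemeasurable)
      (ENNReal.mul_ne_top (by simp) (by simp)) ?_
    filter_upwards [h.train.tendsto_size.eventually_gt_atTop 0] with N hN
    have h2 := lintegral_enorm_sampleMean_sub_sq_le (μ := p ⊗ₘ w) hN hsm
    simp only [h.integral_oracle, sub_zero] at h2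
    rw [← h.train.map_pi, lintegral_map ((hvm N).enorm.pow_const 2) (hXm N)] at h2
    simp_rw [enorm_mul, mul_pow]
    rw [lintegral_const_mul' _ _ (ENNReal.pow_ne_top enorm_ne_top)]
    calc _ ≤ ‖Real.sqrt ((2 * a N : ℕ) : ℝ)‖ₑ ^ 2 *
          ((a N : ℝ≥0∞)⁻¹ * ∫⁻ v, ‖oracle m r₀ u v‖ₑ ^ 2 ∂(p ⊗ₘ w)) := by gcongr
      _ ≤ 2 * ENNReal.ofReal (B * (2 * K * K)) ^ 2 := by
        rw [← mul_assoc]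
        refine mul_le_mul' (sqrt_sq_mul_inv_le _) ?_
        calc ∫⁻ v, ‖oracle m r₀ u v‖ₑ ^ 2 ∂(p ⊗ₘ w)
            ≤ ∫⁻ _, ENNReal.ofReal (B * (2 * K * K)) ^ 2 ∂(p ⊗ₘ w) := by
              refine lintegral_mono_ae ?_
              filter_upwards [h.abs_oracle_le huB] with v hv
              rw [Real.enorm_eq_ofReal_abs]
              gcongr
          _ = _ := by simp
  refine ((hY.mul (h.isLittleOpOne_sqrt_mul_score_sub hu huB)).add h1).mono fun N ω => ?_
  rw [← mul_add]
  gcongr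
  rw [mul_sub]
  refine le_trans (le_of_eq ?_) (enorm_add_le _ _)
  rw [sub_add_cancel]

end IsCrossFitFold
end Fold

/-! ### Local oscillation of the model -/

section Modulus

variable {𝒳 : Type*} [MeasurableSpace 𝒳]

/-- The oscillation of a bounded continuous model near a parameter has small mean. -/
lemma exists_modulus {E : Type*} [PseudoMetricSpace E] [SecondCountableTopology E]
    {q : Measure 𝒳} [IsProbabilityMeasure q] {Θ : Set E} {g : E → 𝒳 → ℝ}
    (hg_meas : ∀ β ∈ Θ, Measurable (g β)) (hg_cont : ∀ x, ContinuousOn (fun β => g β x) Θ)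
    {K : ℝ} (hK : 0 ≤ K) (hgK : ∀ β ∈ Θ, ∀ x, |g β x| ≤ K) {β' : E} (hβ' : β' ∈ Θ)
    {η : ℝ} (hη : 0 < η) :
    ∃ U ∈ 𝓝 β', ∃ M : 𝒳 → ℝ, Measurable M ∧ (∀ x, 0 ≤ M x ∧ M x ≤ 2 * K) ∧
      (∀ β ∈ U ∩ Θ, ∀ x, |g β x - g β' x| ≤ M x) ∧ ∫ x, M x ∂q ≤ η := by
  let S : ℕ → Set E := fun n => Metric.ball β' (1 / ((n : ℝ) + 1)) ∩ Θ
  have hSne : ∀ n, β' ∈ S n := fun n => ⟨Metric.mem_ball_self (by positivity), hβ'⟩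
  have hne : ∀ n, Nonempty (S n) := fun n => ⟨⟨β', hSne n⟩⟩
  let d : ∀ n, ℕ → S n := fun n => TopologicalSpace.denseSeq (S n)
  -- The supremum runs over a countable dense subset of the ball intersected with `Θ`, which keeps
  -- it measurable. Continuity on `Θ` makes it dominate the oscillation at every parameter there.
  let M : ℕ → 𝒳 → ℝ≥0∞ := fun n x => ⨆ i, ‖g (d n i) x - g β' x‖ₑ
  have hMm : ∀ n, Measurable (M n) := fun n =>
    Measurable.iSup fun i => ((hg_meas _ (d n i).2.2).sub (hg_meas _ hβ')).enorm
  have hMle : ∀ n x, M n x ≤ ENNReal.ofReal (2 * K) := fun n x => iSup_le fun i => by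
    rw [Real.enorm_eq_ofReal_abs]
    refine ENNReal.ofReal_le_ofReal ((abs_sub _ _).trans ?_)
    linarith [hgK _ (d n i).2.2 x, hgK _ hβ' x]
  have hMfin : ∀ n x, M n x ≠ ∞ := fun n x => ne_top_of_le_ne_top ENNReal.ofReal_ne_top (hMle n x)
  have hMdom : ∀ n, ∀ β ∈ S n, ∀ x, |g β x - g β' x| ≤ (M n x).toReal := by
    intro n β hβ x
    rw [← ENNReal.ofReal_le_iff_le_toReal (hMfin n x), ← Real.enorm_eq_ofReal_abs]
    have hc : Continuous fun b : S n => g b x :=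
      continuousOn_iff_continuous_domRestrict.1 ((hg_cont x).mono Set.inter_subset_right)
    have hcl : IsClosed {b : S n | ‖g b x - g β' x‖ₑ ≤ M n x} :=
      isClosed_le (hc.sub continuous_const).enorm continuous_const
    exact (TopologicalSpace.denseRange_denseSeq (S n)).induction_on
      (p := fun b : S n => ‖g b x - g β' x‖ₑ ≤ M n x) ⟨β, hβ⟩ hcl
      fun i => le_iSup (fun i => ‖g (d n i) x - g β' x‖ₑ) i
  have hlim : ∀ x, Tendsto (fun n => (M n x).toReal) atTop (𝓝 0) := by
    intro x
    rw [Metric.tendsto_atTop]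
    intro ε hε
    obtain ⟨δ, hδ, hδ'⟩ := Metric.continuousWithinAt_iff.1 (hg_cont x β' hβ') (ε / 2) (half_pos hε)
    obtain ⟨n₀, hn₀⟩ := exists_nat_one_div_lt hδ
    refine ⟨n₀, fun n hn => ?_⟩
    rw [Real.dist_eq, sub_zero, abs_of_nonneg ENNReal.toReal_nonneg]
    refine lt_of_le_of_lt (ENNReal.toReal_le_of_le_ofReal (half_pos hε).le
      (iSup_le fun i => ?_)) (half_lt_self hε)
    rw [Real.enorm_eq_ofReal_abs]
    refine ENNReal.ofReal_le_ofReal (le_of_lt ?_)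
    rw [← Real.dist_eq]
    refine hδ' (d n i).2.2 ((Metric.mem_ball.1 (d n i).2.1).trans (lt_of_le_of_lt ?_ hn₀))
    gcongr
  have hle : ∀ n x, (M n x).toReal ≤ 2 * K := fun n x =>
    ENNReal.toReal_le_of_le_ofReal (by positivity) (hMle n x)
  -- The oscillation tends to zero pointwise by continuity at `β'` and is bounded by `2 * K`, so its
  -- mean becomes arbitrarily small.
  have hint := tendsto_integral_of_dominated_convergence (μ := q)
    (F := fun n x => (M n x).toReal) (f := fun _ => 0) (fun _ => 2 * K)
    (fun n => (hMm n).ennreal_toReal.aestronglyMeasurable) (integrable_const _)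
    (fun n => ae_of_all _ fun x => by
      rw [Real.norm_of_nonneg ENNReal.toReal_nonneg]
      exact hle n x)
    (ae_of_all _ hlim)
  rw [integral_zero] at hint
  obtain ⟨n, hn⟩ := (hint.eventually (ge_mem_nhds hη)).exists
  exact ⟨Metric.ball β' (1 / ((n : ℝ) + 1)), Metric.ball_mem_nhds _ (by positivity),
    fun x => (M n x).toReal, (hMm n).ennreal_toReal,
    fun x => ⟨ENNReal.toReal_nonneg, hle n x⟩, hMdom n, hn⟩

end Modulus

/-! ### Consistency by local lower bounds and compactness -/

section Consistency

variable {Ω : Type*} [MeasurableSpace Ω] {𝒳 : Type*} [MeasurableSpace 𝒳]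
  {P : Measure Ω} [IsProbabilityMeasure P] {p q : Measure 𝒳} [IsProbabilityMeasure p]
  [IsProbabilityMeasure q] {w : Kernel 𝒳 ℝ} [IsMarkovKernel w] {r₀ m : 𝒳 → ℝ}
  {K ρ : ℝ} {a b : ℕ → ℕ} {X : ∀ N, Fin (a N) → Ω → 𝒳 × ℝ} {T : ∀ N, Fin (b N) → Ω → 𝒳}
  {E : ℕ → Type*} [∀ N, MeasurableSpace (E N)] {Z : ∀ N, Ω → E N}
  {fh rh : ∀ N, E N → 𝒳 → ℝ}

namespace IsCrossFitFold

variable (h : IsCrossFitFold P p q w r₀ m K ρ a b X T Z fh rh)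
include h

/-- The direction `u` is absent, so after multiplication by a bound on `u` this controls all
directions simultaneously. The integrand splits as `(Y - m)(r̂ - r₀) - (f̂ - m)(r̂ - r₀) - r₀ (f̂ -
m)`, and plain `L²(p)` consistency suffices since there is no factor `√n`. -/
lemma isLittleOpOne_sampleMean_train_error :
    IsLittleOpOne P fun N ω => ‖sampleMean (fun i => X N i ω) fun v =>
      |(v.2 - fh N (Z N ω) v.1) * rh N (Z N ω) v.1 - (v.2 - m v.1) * r₀ v.1|‖ₑ := by
  have hm1 : ∀ N, Measurable fun v : E N × (𝒳 × ℝ) => m v.2.1 := fun N =>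
    h.measurable_m.comp (measurable_fst.comp measurable_snd)
  have hr1 : ∀ N, Measurable fun v : E N × (𝒳 × ℝ) => r₀ v.2.1 := fun N =>
    h.measurable_ratio.comp (measurable_fst.comp measurable_snd)
  have hy : ∀ N, Measurable fun v : E N × (𝒳 × ℝ) => v.2.2 := fun N =>
    measurable_snd.comp measurable_snd
  have H := h.train.isLittleOpOne_sampleMean
    (h := fun N z v => |(v.2 - fh N z v.1) * rh N z v.1 - (v.2 - m v.1) * r₀ v.1|)
    (fun N => ((((hy N).sub (h.measurable_f_train N)).mul (h.measurable_r_train N)).sub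
      (((hy N).sub (hm1 N)).mul (hr1 N))).abs) (c := fun _ => 1) (by
      have hb := (((h.ratio_conv.const_mul (c := ENNReal.ofReal (2 * K)) ENNReal.ofReal_ne_top).add
        (h.ratio_conv.mul h.regression_conv)).add
          (h.regression_conv.const_mul (c := ENNReal.ofReal K) (by simp)))
      refine hb.mono fun N ω => ?_
      rw [enorm_one, one_mul]
      set z := Z N ω
      have m1 : Measurable fun v : 𝒳 × ℝ => ‖(v.2 - m v.1) * (rh N z v.1 - r₀ v.1)‖ₑ :=
        ((measurable_snd.sub (h.measurable_m.comp measurable_fst)).mul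
          ((h.measurable_rdiff N z).comp measurable_fst)).enorm
      have m2 : Measurable fun v : 𝒳 × ℝ => ‖(fh N z v.1 - m v.1) * (rh N z v.1 - r₀ v.1)‖ₑ :=
        (((h.measurable_fdiff N z).comp measurable_fst).mul
          ((h.measurable_rdiff N z).comp measurable_fst)).enorm
      calc ∫⁻ v, ‖|(v.2 - fh N z v.1) * rh N z v.1 - (v.2 - m v.1) * r₀ v.1|‖ₑ ∂(p ⊗ₘ w)
          ≤ ∫⁻ v, (‖(v.2 - m v.1) * (rh N z v.1 - r₀ v.1)‖ₑ +
              ‖(fh N z v.1 - m v.1) * (rh N z v.1 - r₀ v.1)‖ₑ +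
              ‖r₀ v.1 * (fh N z v.1 - m v.1)‖ₑ) ∂(p ⊗ₘ w) := by
            refine lintegral_mono fun v => ?_
            rw [Real.enorm_abs]
            have e : (v.2 - fh N z v.1) * rh N z v.1 - (v.2 - m v.1) * r₀ v.1 =
              ((v.2 - m v.1) * (rh N z v.1 - r₀ v.1) -
                (fh N z v.1 - m v.1) * (rh N z v.1 - r₀ v.1)) -
                r₀ v.1 * (fh N z v.1 - m v.1) := by ring
            rw [e]
            exact enorm_sub_le.trans (add_le_add enorm_sub_le le_rfl)
        _ ≤ _ := by
            have m12 : Measurable fun v : 𝒳 × ℝ => ‖(v.2 - m v.1) * (rh N z v.1 - r₀ v.1)‖ₑ +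
              ‖(fh N z v.1 - m v.1) * (rh N z v.1 - r₀ v.1)‖ₑ := m1.add m2
            rw [lintegral_add_left m12, lintegral_add_left m1]
            refine add_le_add (add_le_add ?_ (h.lintegral_prod_le N z)) ?_
            · refine (lintegral_enorm_mul_le_const h.abs_residual_le).trans ?_
              rw [lintegral_compProd_fst (F := fun x => ‖rh N z x - r₀ x‖ₑ)
                (h.measurable_rdiff N z).enorm]
              gcongr
              exact lintegral_enorm_le (h.measurable_rdiff N z)
            · refine (lintegral_enorm_mul_le_const (c := fun v : 𝒳 × ℝ => r₀ v.1)
                (ae_of_all _ fun v => h.abs_ratio_le v.1)).trans ?_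
              rw [lintegral_compProd_fst (F := fun x => ‖fh N z x - m x‖ₑ)
                (h.measurable_fdiff N z).enorm]
              gcongr
              exact lintegral_enorm_le (h.measurable_fdiff N z))
  simpa using H

lemma isLittleOpOne_sampleMean_test_error :
    IsLittleOpOne P fun N ω => ‖sampleMean (fun j => T N j ω) fun x =>
      |fh N (Z N ω) x - m x|‖ₑ := by
  have H := h.test.isLittleOpOne_sampleMean
    (h := fun N z x => |fh N z x - m x|)
    (fun N => ((h.measurable_f N).sub (h.measurable_m.comp measurable_snd)).abs)
    (c := fun _ => 1) (by
      refine (h.regression_conv.const_mul (c := ENNReal.ofReal K) (by simp)).mono fun N ω => ?_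
      rw [enorm_one, one_mul]
      simp only [Real.enorm_abs]
      refine (lintegral_le_const_mul h.measurable_ratio h.ratio_le h.density
        (h.measurable_fdiff N _).enorm).trans ?_
      gcongr
      exact lintegral_enorm_le (h.measurable_fdiff N _))
  simpa using H

/-- A lower bound for the excess risk of one fold, uniform over all directions `u` that are within
`M` of a given direction `v`. -/
lemma exists_excessRisk_lower_bound {v M : 𝒳 → ℝ} (hv : Measurable v)
    (hvK : ∀ x, |v x| ≤ 2 * K) (hM : Measurable M) (hMK : ∀ x, 0 ≤ M x ∧ M x ≤ 2 * K) :
    ∃ err : ℕ → Ω → ℝ, (IsLittleOpOne P fun N ω => ‖err N ω‖ₑ) ∧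
      ∀ N ω (u : 𝒳 → ℝ), (∀ x, |u x - v x| ≤ M x) → (∀ x, |u x| ≤ 2 * K) →
        ∫ x, v x ^ 2 ∂q - 8 * K * ∫ x, M x ∂q - err N ω ≤
          -2 * score m (fh N (Z N ω)) (rh N (Z N ω)) (fun i => X N i ω) (fun j => T N j ω) u +
            sampleMean (fun j => T N j ω) fun x => u x ^ 2 := by
  have hMabs : ∀ x, |M x| ≤ 2 * K := fun x => by rw [abs_of_nonneg (hMK x).1]; exact (hMK x).2
  have hI1m : Measurable fun y : 𝒳 × ℝ => M y.1 * (|y.2 - m y.1| * r₀ y.1) :=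
    (hM.comp measurable_fst).mul ((measurable_snd.sub (h.measurable_m.comp measurable_fst)).abs.mul
      (h.measurable_ratio.comp measurable_fst))
  have hI1b : ∀ᵐ y ∂(p ⊗ₘ w), |M y.1 * (|y.2 - m y.1| * r₀ y.1)| ≤ 2 * K * (2 * K * K) := by
    filter_upwards [h.abs_residual_le] with y hy
    have hK : 0 ≤ 2 * K := (abs_nonneg _).trans hy
    rw [abs_mul, abs_mul, abs_abs]
    exact mul_le_mul (hMabs _) (mul_le_mul hy (h.abs_ratio_le _) (abs_nonneg _) hK)
      (by positivity) hK
  set I1 := ∫ y, M y.1 * (|y.2 - m y.1| * r₀ y.1) ∂(p ⊗ₘ w) with hI1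
  -- The residual is at most `2 * K`, and the remaining weight `r₀` converts the integral over `p`
  -- into one over `q`.
  have hI1le : I1 ≤ 2 * K * ∫ x, M x ∂q := by
    have e : 2 * K * ∫ x, M x ∂q = ∫ y, 2 * K * (M y.1 * r₀ y.1) ∂(p ⊗ₘ w) := by
      rw [integral_eq_integral_mul_density h.measurable_ratio h.ratio_nonneg h.density,
        integral_const_mul,
        integral_compProd_fst (F := fun x => M x * r₀ x) (hM.mul h.measurable_ratio)]
    rw [e, hI1]
    refine integral_mono_ae (Integrable.of_bound hI1m.aestronglyMeasurable _ hI1b)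
      (Integrable.of_bound (C := |2 * K| * (2 * K * K)) (Measurable.aestronglyMeasurable
        (((hM.comp measurable_fst).mul
          (h.measurable_ratio.comp measurable_fst)).const_mul _)) (ae_of_all _ fun y => ?_)) ?_
    · rw [Real.norm_eq_abs, abs_mul, abs_mul (M y.1)]
      exact mul_le_mul_of_nonneg_left (mul_le_mul (hMabs _) (h.abs_ratio_le _) (abs_nonneg _)
        ((abs_nonneg _).trans (hMabs y.1))) (abs_nonneg _)
    · filter_upwards [h.abs_residual_le] with y hy
      have := mul_le_mul_of_nonneg_left hy (mul_nonneg (hMK y.1).1 (h.ratio_nonneg y.1))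
      linarith
  have o1 := h.isLittleOpOne_score hv hvK
  have o2 := h.train.isLittleOpOne_sampleMean_sub_of_bounded hI1m hI1b
  have o3 := h.isLittleOpOne_sampleMean_train_error
  have o4 := h.isLittleOpOne_sampleMean_test_error
  have o5 := h.test.isLittleOpOne_sampleMean_sub_of_bounded (hv.pow_const 2)
    (B := (2 * K) ^ 2) (ae_of_all _ fun x => by
      rw [abs_pow]
      exact pow_le_pow_left₀ (abs_nonneg _) (hvK x) 2)
  have o6 := h.test.isLittleOpOne_sampleMean_sub_of_bounded hM (ae_of_all _ hMabs)
  set s1 : ℕ → Ω → ℝ := fun N ω =>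
    score m (fh N (Z N ω)) (rh N (Z N ω)) (fun i => X N i ω) (fun j => T N j ω) v
  set s2 : ℕ → Ω → ℝ := fun N ω =>
    sampleMean (fun i => X N i ω) (fun y => M y.1 * (|y.2 - m y.1| * r₀ y.1)) - I1
  set s3 : ℕ → Ω → ℝ := fun N ω => sampleMean (fun i => X N i ω) fun v =>
      |(v.2 - fh N (Z N ω) v.1) * rh N (Z N ω) v.1 - (v.2 - m v.1) * r₀ v.1|
  set s4 : ℕ → Ω → ℝ := fun N ω => sampleMean (fun j => T N j ω) fun x => |fh N (Z N ω) x - m x|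
  set s5 : ℕ → Ω → ℝ := fun N ω =>
    sampleMean (fun j => T N j ω) (fun x => v x ^ 2) - ∫ x, v x ^ 2 ∂q
  set s6 : ℕ → Ω → ℝ := fun N ω => sampleMean (fun j => T N j ω) M - ∫ x, M x ∂q
  -- The constant `8 * K` splits evenly. Twice the score deviation costs `2 * I1 ≤ 4 * K * ∫ M`, and
  -- replacing `u ^ 2` by `v ^ 2` costs another `4 * K * ∫ M`. The error collects the fluctuations
  -- and nuisance errors, none depending on `u`.
  refine ⟨fun N ω => 2 * |s1 N ω| + 2 * |s2 N ω| + 4 * K * s3 N ω + 4 * K * s4 N ω + |s5 N ω| +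
    4 * K * |s6 N ω|, ?_, fun N ω u huv huK => ?_⟩
  · have c2 : ∀ c : ℝ, ‖c‖ₑ ≠ ∞ := fun c => by simp
    refine ((((((o1.const_mul (c2 2)).add (o2.const_mul (c2 2))).add
      (o3.const_mul (c2 (4 * K)))).add (o4.const_mul (c2 (4 * K)))).add o5).add
        (o6.const_mul (c2 (4 * K)))).mono fun N ω => ?_
    refine (enorm_add_le _ _).trans (add_le_add ((enorm_add_le _ _).trans (add_le_add
      ((enorm_add_le _ _).trans (add_le_add ((enorm_add_le _ _).trans (add_le_add
        ((enorm_add_le _ _).trans (add_le_add ?_ ?_)) ?_)) ?_)) ?_)) ?_) <;>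
      simp only [enorm_mul, Real.enorm_abs] <;> exact le_rfl
  · have hsplit : score m (fh N (Z N ω)) (rh N (Z N ω)) (fun i => X N i ω) (fun j => T N j ω) u =
        s1 N ω + score m (fh N (Z N ω)) (rh N (Z N ω)) (fun i => X N i ω) (fun j => T N j ω)
          (fun x => u x - v x) := by
      rw [← score_add]
      congr 1
      ext x
      ring
    have hdev : |score m (fh N (Z N ω)) (rh N (Z N ω)) (fun i => X N i ω) (fun j => T N j ω)
          (fun x => u x - v x)| ≤ (s2 N ω + I1) + 2 * K * s3 N ω + 2 * K * s4 N ω := by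
      rw [score]
      refine (abs_add_le _ _).trans (add_le_add ?_ ?_)
      · refine (abs_sampleMean_le _ _).trans ?_
        simp only [s2, s3, sub_add_cancel]
        rw [← sampleMean_const_mul, ← sampleMean_add]
        refine sampleMean_mono _ fun y => ?_
        rw [abs_mul]
        have e1 : |(y.2 - fh N (Z N ω) y.1) * rh N (Z N ω) y.1| ≤ |y.2 - m y.1| * r₀ y.1 +
            |(y.2 - fh N (Z N ω) y.1) * rh N (Z N ω) y.1 - (y.2 - m y.1) * r₀ y.1| := by
          rw [← abs_of_nonneg (h.ratio_nonneg y.1), ← abs_mul, abs_of_nonneg (h.ratio_nonneg y.1)]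
          refine le_trans (le_of_eq ?_) (abs_add_le _ _)
          congr 1
          ring
        calc _ ≤ M y.1 * (|y.2 - m y.1| * r₀ y.1 +
            |(y.2 - fh N (Z N ω) y.1) * rh N (Z N ω) y.1 - (y.2 - m y.1) * r₀ y.1|) :=
              mul_le_mul (huv _) e1 (abs_nonneg _) (hMK _).1
          _ ≤ _ := by
              rw [mul_add]
              gcongr
              exact (hMK _).2
      · refine (abs_sampleMean_le _ _).trans ?_
        simp only [s4]
        rw [← sampleMean_const_mul]
        refine sampleMean_mono _ fun x => ?_
        rw [abs_mul]
        gcongr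
        exact (huv x).trans (hMK x).2
    have hsq : (s5 N ω + ∫ x, v x ^ 2 ∂q) - 4 * K * (s6 N ω + ∫ x, M x ∂q) ≤
        sampleMean (fun j => T N j ω) fun x => u x ^ 2 := by
      simp only [s5, s6, sub_add_cancel]
      rw [← sampleMean_const_mul, ← sampleMean_sub]
      -- Here `u² - v² = (u - v)(u + v)`, with `|u - v| ≤ M` and `|u + v| ≤ 4 * K`.
      refine sampleMean_mono _ fun x => ?_
      have e1 : |(u x - v x) * (u x + v x)| ≤ M x * (4 * K) := by
        rw [abs_mul]
        refine mul_le_mul (huv x) ((abs_add_le _ _).trans ?_) (abs_nonneg _) (hMK x).1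
        linarith [huK x, hvK x]
      have e2 := (abs_le.1 e1).1
      nlinarith
    have hK : 0 ≤ K ∨ IsEmpty 𝒳 := by
      rcases isEmpty_or_nonempty 𝒳 with h' | h'
      · exact Or.inr h'
      · exact Or.inl h.bound_nonneg
    have hK : 0 ≤ K := hK.resolve_right fun _ =>
      IsProbabilityMeasure.ne_zero p (Measure.eq_zero_of_isEmpty p)
    rw [hsplit]
    have a1 := le_abs_self (s1 N ω)
    have a2 := le_abs_self (s2 N ω)
    have a5 := neg_abs_le (s5 N ω)
    have a6 := mul_le_mul_of_nonneg_left (le_abs_self (s6 N ω)) (by positivity : 0 ≤ 4 * K)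
    have a7 := le_abs_self (score m (fh N (Z N ω)) (rh N (Z N ω)) (fun i => X N i ω)
      (fun j => T N j ω) (fun x => u x - v x))
    linarith

end IsCrossFitFold

/-- Consistency of minimizers of the cross-fitted risk. -/
theorem isLittleOpOne_argmin_sub {k : ℕ} {L : Type*} [Fintype L] [Nonempty L]
    {X : L → ∀ N, Fin (a N) → Ω → 𝒳 × ℝ} {T : L → ∀ N, Fin (b N) → Ω → 𝒳}
    {Z : L → ∀ N, Ω → E N} {fh rh : L → ∀ N, E N → 𝒳 → ℝ}
    (h : ∀ ℓ, IsCrossFitFold P p q w r₀ m K ρ a b (X ℓ) (T ℓ) (Z ℓ) (fh ℓ) (rh ℓ))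
    {Θ : Set (EuclideanSpace ℝ (Fin k))} (hΘ : IsCompact Θ)
    {g : EuclideanSpace ℝ (Fin k) → 𝒳 → ℝ} (hg_meas : ∀ β ∈ Θ, Measurable (g β))
    (hg_cont : ∀ x, ContinuousOn (fun β => g β x) Θ) (hgK : ∀ β ∈ Θ, ∀ x, |g β x| ≤ K)
    {βt : EuclideanSpace ℝ (Fin k)} (hβt : βt ∈ Θ)
    (hsep : ∀ β ∈ Θ, β ≠ βt → 0 < ∫ x, (g β x - m x) ^ 2 ∂q)
    {risk : ℕ → Ω → EuclideanSpace ℝ (Fin k) → ℝ}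
    (hrisk : ∀ N ω β, risk N ω β - risk N ω βt = ∑ ℓ,
      (-2 * score m (fh ℓ N (Z ℓ N ω)) (rh ℓ N (Z ℓ N ω)) (fun i => X ℓ N i ω)
        (fun j => T ℓ N j ω) (fun x => g β x - m x) +
        sampleMean (fun j => T ℓ N j ω) fun x => (g β x - m x) ^ 2))
    {βhat : ℕ → Ω → EuclideanSpace ℝ (Fin k)}
    (hβhat : ∀ N, ∀ᵐ ω ∂P, IsArgmin (risk N ω) Θ (βhat N ω)) :
    IsLittleOpOne P fun N ω => ‖βhat N ω - βt‖ₑ := by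
  classical
  obtain ⟨ℓ₀⟩ := ‹Nonempty L›
  have hne : Nonempty 𝒳 := by
    by_contra hcon
    rw [not_nonempty_iff] at hcon
    exact IsProbabilityMeasure.ne_zero p (Measure.eq_zero_of_isEmpty p)
  have hK : 0 ≤ K := (h ℓ₀).bound_nonneg
  -- Each wrong parameter has a neighbourhood in which, with probability tending to one, no
  -- parameter matches the risk of `βt`.
  have hloc : ∀ β' ∈ Θ, β' ≠ βt → ∃ U ∈ 𝓝 β', Tendsto
      (fun N => P {ω | ∃ β ∈ U ∩ Θ, risk N ω β ≤ risk N ω βt}) atTop (𝓝 0) := by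
    intro β' hβ' hneq
    set Q := ∫ x, (g β' x - m x) ^ 2 ∂q with hQ
    have hQ0 : 0 < Q := hsep β' hβ' hneq
    -- With this radius of oscillation the loss `8 * K * ∫ M` is at most `Q / 2`; the `+ 1` covers
    -- `K = 0`.
    have hη : 0 < Q / (16 * K + 1) := by positivity
    obtain ⟨U, hU, M, hM, hMK, hMdom, hMint⟩ :=
      exists_modulus (q := q) hg_meas hg_cont hK hgK hβ' hη
    have hbd : ∀ β ∈ Θ, ∀ x, |g β x - m x| ≤ 2 * K := fun β hβ x =>
      (abs_sub _ _).trans (by linarith [hgK β hβ x, (h ℓ₀).abs_m_le x])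
    choose err herr hlow using fun ℓ => (h ℓ).exists_excessRisk_lower_bound
      ((hg_meas β' hβ').sub (h ℓ₀).measurable_m) (hbd β' hβ') hM hMK
    refine ⟨U, hU, ?_⟩
    have hsum := IsLittleOpOne.sum Finset.univ fun ℓ _ => herr ℓ
    have hQ2 : 0 < ENNReal.ofReal (Q / 2) := by simpa using hQ0
    refine tendsto_of_tendsto_of_tendsto_of_le_of_le tendsto_const_nhds (hsum _ hQ2)
      (fun _ => zero_le) fun N => measure_mono fun ω hω => ?_
    obtain ⟨β, hβ, hle⟩ := hω
    have h1 : ∑ ℓ, (Q / 2 - err ℓ N ω) ≤ risk N ω β - risk N ω βt := by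
      rw [hrisk]
      refine Finset.sum_le_sum fun ℓ _ => le_trans ?_ (hlow ℓ N ω (fun x => g β x - m x)
        (fun x => by
          simpa only [Pi.sub_apply, sub_sub_sub_cancel_right] using hMdom β hβ x) (hbd β hβ.2))
      have h2 : 8 * K * ∫ x, M x ∂q ≤ Q / 2 := by
        calc 8 * K * ∫ x, M x ∂q ≤ 8 * K * (Q / (16 * K + 1)) := by gcongr
          _ = Q / 2 * ((16 * K) / (16 * K + 1)) := by ring
          _ ≤ Q / 2 * 1 := by
            gcongr
            rw [div_le_one (by positivity)]
            linarith
          _ = Q / 2 := mul_one _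
      simp only [Pi.sub_apply] at h2 ⊢
      linarith
    rw [Finset.sum_sub_distrib, Finset.sum_const, nsmul_eq_mul] at h1
    have hc : (1 : ℝ) ≤ (Finset.univ : Finset L).card := by
      exact_mod_cast Finset.card_pos.2 ⟨ℓ₀, Finset.mem_univ _⟩
    have h3 : Q / 2 ≤ ∑ ℓ, err ℓ N ω := by nlinarith
    rw [Set.mem_ofPred_eq]
    calc ENNReal.ofReal (Q / 2) ≤ ENNReal.ofReal |∑ ℓ, err ℓ N ω| :=
          ENNReal.ofReal_le_ofReal (h3.trans (le_abs_self _))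
      _ = ‖∑ ℓ, err ℓ N ω‖ₑ := (Real.enorm_eq_ofReal_abs _).symm
      _ ≤ _ := enorm_sum_le _ _
  refine IsLittleOpOne.of_ne_top fun ε hε hε' => ?_
  have hε2 : 0 < ε.toReal := ENNReal.toReal_pos hε.ne' hε'
  -- Finitely many of these neighbourhoods cover the part of `Θ` outside the ball, and a union bound
  -- finishes.
  have hcomp : IsCompact (Θ \ Metric.ball βt ε.toReal) := hΘ.diff Metric.isOpen_ball
  have hmem : ∀ β ∈ Θ \ Metric.ball βt ε.toReal, β ≠ βt := by
    rintro β hβ rfl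
    exact hβ.2 (Metric.mem_ball_self hε2)
  choose! U hU hUt using fun β (hβ : β ∈ Θ \ Metric.ball βt ε.toReal) =>
    hloc β hβ.1 (hmem β hβ)
  obtain ⟨s, hs, hcover⟩ := hcomp.elim_nhds_subcover U hU
  have hlim : Tendsto (fun N => ∑ β' ∈ s, P {ω | ∃ β ∈ U β' ∩ Θ, risk N ω β ≤ risk N ω βt})
      atTop (𝓝 0) := by
    have := tendsto_finsetSum s fun β' hβ' => hUt β' (hs β' hβ')
    simpa using this
  refine tendsto_of_tendsto_of_tendsto_of_le_of_le tendsto_const_nhds hlim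
    (fun _ => zero_le) fun N => ?_
  refine le_trans ?_ (measure_biUnion_finset_le s _)
  refine measure_mono_ae ?_
  filter_upwards [hβhat N] with ω hω hωε
  have hωε : ε ≤ ‖βhat N ω - βt‖ₑ := hωε
  have hnb : βhat N ω ∈ Θ \ Metric.ball βt ε.toReal := by
    refine ⟨hω.1, fun hb => ?_⟩
    rw [mem_ball_iff_norm] at hb
    refine absurd hωε (not_le.2 ?_)
    rw [← ofReal_norm, ENNReal.ofReal_lt_iff_lt_toReal (norm_nonneg _) hε']
    exact hb
  obtain ⟨β', hβ's, hβ'U⟩ := Set.mem_iUnion₂.1 (hcover hnb)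
  exact Set.mem_iUnion₂.2 ⟨β', hβ's, βhat N ω, ⟨hβ'U, hω.1⟩, hω.2 βt hβt⟩

end Consistency

/-! ### Independence of a fold from the data of the other fold -/

section Independence

variable {Ω : Type*} [MeasurableSpace Ω] {P : Measure Ω} [IsProbabilityMeasure P]

/-- The two hypotheses say that the joint law of `((A, B), C)` is the full product, and a product
law is preserved by reassociating and swapping factors. -/
lemma indepFun_prodMk_of_indepFun {α β γ : Type*} [MeasurableSpace α] [MeasurableSpace β]
    [MeasurableSpace γ] {A : Ω → α} {B : Ω → β} {C : Ω → γ} (hA : Measurable A)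
    (hB : Measurable B) (hC : Measurable C) (h1 : IndepFun A B P)
    (h2 : IndepFun (fun ω => (A ω, B ω)) C P) : IndepFun (fun ω => (A ω, C ω)) B P := by
  have pA : IsProbabilityMeasure (P.map A) := Measure.isProbabilityMeasure_map hA.aemeasurable
  have pB : IsProbabilityMeasure (P.map B) := Measure.isProbabilityMeasure_map hB.aemeasurable
  have pC : IsProbabilityMeasure (P.map C) := Measure.isProbabilityMeasure_map hC.aemeasurable
  have h3 : IndepFun A C P := h2.comp measurable_fst measurable_id
  have e1 := (indepFun_iff_map_prod_eq_prod_map_map hA.aemeasurable hB.aemeasurable).1 h1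
  have e2 := (indepFun_iff_map_prod_eq_prod_map_map (hA.prodMk hB).aemeasurable
    hC.aemeasurable).1 h2
  have e3 := (indepFun_iff_map_prod_eq_prod_map_map hA.aemeasurable hC.aemeasurable).1 h3
  refine (indepFun_iff_map_prod_eq_prod_map_map (hA.prodMk hC).aemeasurable
    hB.aemeasurable).2 ?_
  rw [e1] at e2
  rw [e3]
  have mp : MeasurePreserving (fun v : (α × β) × γ => ((v.1.1, v.2), v.1.2))
      (((P.map A).prod (P.map B)).prod (P.map C)) (((P.map A).prod (P.map C)).prod (P.map B)) := by
    have m1 := measurePreserving_prodAssoc (P.map A) (P.map B) (P.map C)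
    have m2 := (MeasurePreserving.id (P.map A)).prod
      (Measure.measurePreserving_swap (μ := P.map B) (ν := P.map C))
    have m3 := (measurePreserving_prodAssoc (P.map A) (P.map C) (P.map B)).symm
    exact (m3.comp (m2.comp m1))
  rw [← mp.map_eq, ← e2, Measure.map_map mp.measurable ((hA.prodMk hB).prodMk hC)]
  rfl

variable {𝒲 𝒱 : Type*} [MeasurableSpace 𝒲] [MeasurableSpace 𝒱]

lemma indepFun_fold {a : ℕ} {X : Fin 2 → Fin a → Ω → 𝒲} (hX : ∀ ℓ i, Measurable (X ℓ i))
    (hind : iIndepFun (fun s : Fin 2 × Fin a => X s.1 s.2) P) (ℓ : Fin 2) :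
    IndepFun (fun ω i => X (1 - ℓ) i ω) (fun ω i => X ℓ i ω) P := by
  classical
  have hne : (1 : Fin 2) - ℓ ≠ ℓ := by fin_cases ℓ <;> decide
  let S : Fin 2 → Finset (Fin 2 × Fin a) := fun ℓ => Finset.univ.filter fun s => s.1 = ℓ
  have hmem : ∀ ℓ (i : Fin a), (ℓ, i) ∈ S ℓ := fun ℓ i => by simp [S]
  have hdisj : Disjoint (S (1 - ℓ)) (S ℓ) := by
    rw [Finset.disjoint_left]
    intro s hs hs'
    simp only [S, Finset.mem_filter, Finset.mem_univ, true_and] at hs hs'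
    exact hne (hs.symm.trans hs')
  have h1 := hind.indepFun_finset (S (1 - ℓ)) (S ℓ) hdisj fun s => hX s.1 s.2
  exact h1.comp (φ := fun v i => v ⟨(1 - ℓ, i), hmem _ i⟩) (ψ := fun v i => v ⟨(ℓ, i), hmem _ i⟩)
    (measurable_pi_lambda _ fun i => measurable_pi_apply _)
    (measurable_pi_lambda _ fun i => measurable_pi_apply _)

/-- The nuisance input combines both samples of the other fold: independence of its labelled part
comes from the i.i.d. sample, and that of its unlabelled part from independence of the two samples.
Exchanging `X` and `T` gives the statement for the unlabelled fold. -/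
lemma indepFun_aux_fold {a b : ℕ} {X : Fin 2 → Fin a → Ω → 𝒲} {T : Fin 2 → Fin b → Ω → 𝒱}
    (hX : ∀ ℓ i, Measurable (X ℓ i)) (hT : ∀ ℓ j, Measurable (T ℓ j))
    (hindX : iIndepFun (fun s : Fin 2 × Fin a => X s.1 s.2) P)
    (hind : IndepFun (fun ω (s : Fin 2 × Fin a) => X s.1 s.2 ω)
      (fun ω (s : Fin 2 × Fin b) => T s.1 s.2 ω) P) (ℓ : Fin 2) :
    IndepFun (fun ω => ((fun i => X (1 - ℓ) i ω : Fin a → 𝒲), (fun j => T (1 - ℓ) j ω : Fin b → 𝒱)))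
      (fun ω i => X ℓ i ω) P := by
  refine indepFun_prodMk_of_indepFun (measurable_pi_lambda _ fun i => hX _ i)
    (measurable_pi_lambda _ fun i => hX _ i) (measurable_pi_lambda _ fun i => hT _ i)
    (indepFun_fold hX hindX ℓ) ?_
  have h1 : Measurable fun v : Fin 2 × Fin a → 𝒲 =>
      ((fun i => v (1 - ℓ, i) : Fin a → 𝒲), (fun i => v (ℓ, i) : Fin a → 𝒲)) :=
    (measurable_pi_lambda _ fun i => measurable_pi_apply _).prodMk
      (measurable_pi_lambda _ fun i => measurable_pi_apply _)
  have h2 : Measurable fun (v : Fin 2 × Fin b → 𝒱) (j : Fin b) => v (1 - ℓ, j) :=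
    measurable_pi_lambda _ fun i => measurable_pi_apply _
  exact hind.comp h1 h2

end Independence

/-! ### Covariance of the influence function -/

section InfluenceFunction

variable {𝒳 : Type*} [MeasurableSpace 𝒳] {p q : Measure 𝒳} [IsProbabilityMeasure p]
  {w : Kernel 𝒳 ℝ} [IsMarkovKernel w] {r₀ m : 𝒳 → ℝ} {K : ℝ} {k : ℕ}

/-- The product is `u u' r₀² (Y - m)²`. Conditioning on the covariate turns the squared residual
into `σ²`, as `m` is the regression function, and one of the two factors `r₀` is used up in passing
from `p` to `q`. -/
lemma integral_oracle_mul_oracle (hy : ∀ᵐ z ∂(p ⊗ₘ w), |z.2| ≤ K) (hr₀ : Measurable r₀)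
    (hr0 : ∀ x, 0 ≤ r₀ x) (hrK : ∀ x, r₀ x ≤ K)
    (hq : q = p.withDensity fun x => ENNReal.ofReal (r₀ x)) (hm : Measurable m)
    (hmK : ∀ x, |m x| ≤ K) (hmf : regressionFn w =ᵐ[p] m) {u u' : 𝒳 → ℝ} (hu : Measurable u)
    (hu' : Measurable u') {B : ℝ} (huB : ∀ x, |u x| ≤ B) (huB' : ∀ x, |u' x| ≤ B) :
    ∫ v, oracle m r₀ u v * oracle m r₀ u' v ∂(p ⊗ₘ w) =
      ∫ x, (condVar w x * r₀ x) * (u x * u' x) ∂q := by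
  have h1 := integral_mul_sq_residual hy hm (v := fun x => (u x * u' x) * (r₀ x * r₀ x))
    ((hu.mul hu').mul (hr₀.mul hr₀)) (B := max (B * B * (K * K)) K) (fun x => by
      refine le_trans ?_ (le_max_left _ _)
      have hB : 0 ≤ B := (abs_nonneg _).trans (huB x)
      have hK : 0 ≤ K := (abs_nonneg _).trans (hmK x)
      have hr : |r₀ x| ≤ K := by rw [abs_of_nonneg (hr0 x)]; exact hrK x
      rw [abs_mul, abs_mul, abs_mul]
      exact mul_le_mul (mul_le_mul (huB x) (huB' x) (abs_nonneg _) hB)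
        (mul_le_mul hr hr (abs_nonneg _) hK) (by positivity) (by positivity))
    (fun x => (hmK x).trans (le_max_right _ _))
  rw [integral_eq_integral_mul_density hr₀ hr0 hq]
  calc _ = ∫ z, (u z.1 * u' z.1) * (r₀ z.1 * r₀ z.1) * (z.2 - m z.1) ^ 2 ∂(p ⊗ₘ w) :=
        integral_congr_ae (ae_of_all _ fun v => by simp only [oracle]; ring)
    _ = _ := by
      rw [h1]
      refine integral_congr_ae ?_
      filter_upwards [hmf] with x hx
      rw [hx]
      ring

/-- The influence function of the estimator: minus a matrix applied to the vector of oracle scores. -/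
def influence (m r₀ : 𝒳 → ℝ) (A : Matrix (Fin k) (Fin k) ℝ) (u : Fin k → 𝒳 → ℝ) (v : 𝒳 × ℝ) :
    EuclideanSpace ℝ (Fin k) :=
  WithLp.toLp 2 fun i => -∑ j, A i j * oracle m r₀ (u j) v

lemma momentMatrix_influence {A : Matrix (Fin k) (Fin k) ℝ} {u : Fin k → 𝒳 → ℝ}
    (hint : ∀ i j, Integrable (fun v => oracle m r₀ (u i) v * oracle m r₀ (u j) v) (p ⊗ₘ w))
    {W : Matrix (Fin k) (Fin k) ℝ}
    (hW : ∀ i j, ∫ v, oracle m r₀ (u i) v * oracle m r₀ (u j) v ∂(p ⊗ₘ w) = W i j) :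
    momentMatrix (p ⊗ₘ w) (influence m r₀ A u) = A * W * A.transpose := by
  ext i j
  have h1 : ∀ v, (influence m r₀ A u v) i * (influence m r₀ A u v) j =
      ∑ l, ∑ n, (A i n * A j l) * (oracle m r₀ (u n) v * oracle m r₀ (u l) v) := by
    intro v
    simp only [influence, neg_mul_neg, Finset.sum_mul_sum]
    rw [Finset.sum_comm]
    refine Finset.sum_congr rfl fun l _ => Finset.sum_congr rfl fun n _ => by ring
  simp only [momentMatrix, Matrix.of_apply, h1]
  rw [integral_finsetSum _ fun l _ => integrable_finsetSum _ fun n _ => (hint n l).const_mul _]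
  simp_rw [integral_finsetSum _ fun n _ => (hint n _).const_mul _, integral_const_mul, hW]
  simp only [Matrix.mul_apply, Matrix.transpose_apply, Finset.sum_mul]
  exact Finset.sum_congr rfl fun l _ => Finset.sum_congr rfl fun n _ => by ring

end InfluenceFunction

lemma enorm_le_sum_enorm {k : ℕ} (v : EuclideanSpace ℝ (Fin k)) : ‖v‖ₑ ≤ ∑ i, ‖v i‖ₑ := by
  have h : v = ∑ i, v i • EuclideanSpace.single i (1 : ℝ) := by
    simpa using ((EuclideanSpace.basisFun (Fin k) ℝ).sum_repr v).symm
  conv_lhs => rw [h]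
  refine (enorm_sum_le _ _).trans (Finset.sum_le_sum fun i _ => ?_)
  rw [enorm_smul]
  have : ‖EuclideanSpace.single i (1 : ℝ)‖ₑ = 1 := by
    rw [← ofReal_norm]; simp
  rw [this, mul_one]

/-- The difference of the two limits is a deterministic `o_p(1)`, hence zero; `H` need not be
measurable. -/
lemma eq_of_isLittleOpOne {Ω : Type*} [MeasurableSpace Ω] {P : Measure Ω} [IsProbabilityMeasure P]
    {H : ℕ → Ω → ℝ} {c c' : ℝ} (h : IsLittleOpOne P fun N ω => ‖H N ω - c‖ₑ)
    (h' : IsLittleOpOne P fun N ω => ‖H N ω - c'‖ₑ) : c = c' := by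
  by_contra hne
  have h1 : IsLittleOpOne P fun (_ : ℕ) (_ : Ω) => ‖c' - c‖ₑ := by
    refine (h.add h').mono fun N ω => ?_
    rw [← sub_sub_sub_cancel_left c c' (H N ω)]
    exact enorm_sub_le
  have h2 := h1 ‖c' - c‖ₑ (by simpa [sub_eq_zero] using Ne.symm hne)
  simp only [le_refl] at h2
  have h3 : P {_ω : Ω | True} = 1 := by
    simp
  rw [h3] at h2
  exact one_ne_zero (tendsto_nhds_unique tendsto_const_nhds h2)

/-! ### Calculus and measurability of the two-fold risk -/

section CrossFit

variable {𝒳 : Type*} {k a b : ℕ}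

lemma crossFitRisk_eq (g : EuclideanSpace ℝ (Fin k) → 𝒳 → ℝ)
    (f r : Fin 2 → (Fin a → 𝒳 × ℝ) → (Fin b → 𝒳) → 𝒳 → ℝ)
    (z : Fin 2 → Fin a → 𝒳 × ℝ) (t : Fin 2 → Fin b → 𝒳) :
    crossFitRisk g f r z t = fun β =>
      foldRisk g (f 0 (z (1 - 0)) (t (1 - 0))) (r 0 (z (1 - 0)) (t (1 - 0))) (z 0) (t 0) β +
        foldRisk g (f 1 (z (1 - 1)) (t (1 - 1))) (r 1 (z (1 - 1)) (t (1 - 1))) (z 1) (t 1) β := by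
  ext β
  rw [crossFitRisk, Fin.sum_univ_two]

lemma crossFitRisk_calculus {g : EuclideanSpace ℝ (Fin k) → 𝒳 → ℝ}
    (f r : Fin 2 → (Fin a → 𝒳 × ℝ) → (Fin b → 𝒳) → 𝒳 → ℝ)
    (z : Fin 2 → Fin a → 𝒳 × ℝ) (t : Fin 2 → Fin b → 𝒳)
    {s : Set (EuclideanSpace ℝ (Fin k))} (hs : IsOpen s)
    (hd : ∀ x, ∀ β ∈ s, TwiceDifferentiableAt (fun b => g b x) β)
    {β : EuclideanSpace ℝ (Fin k)} (hβ : β ∈ s) :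
    TwiceDifferentiableAt (crossFitRisk g f r z t) β ∧
    (∀ i, pderiv i (crossFitRisk g f r z t) β = ∑ ℓ, -2 * score (g β)
      (f ℓ (z (1 - ℓ)) (t (1 - ℓ))) (r ℓ (z (1 - ℓ)) (t (1 - ℓ))) (z ℓ) (t ℓ)
      fun x => pderiv i (fun b => g b x) β) ∧
    ∀ i j, hess (crossFitRisk g f r z t) β i j = ∑ ℓ, (-2 * score (g β)
      (f ℓ (z (1 - ℓ)) (t (1 - ℓ))) (r ℓ (z (1 - ℓ)) (t (1 - ℓ))) (z ℓ) (t ℓ)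
      (fun x => hess (fun b => g b x) β i j) +
        2 * sampleMean (t ℓ) fun x => pderiv i (fun b => g b x) β * pderiv j (fun b => g b x) β) := by
  have h := fun ℓ β (hβ : β ∈ s) => twiceDifferentiableAt_foldRisk (f ℓ (z (1 - ℓ)) (t (1 - ℓ)))
    (r ℓ (z (1 - ℓ)) (t (1 - ℓ))) (z ℓ) (t ℓ) hs hd hβ
  rw [crossFitRisk_eq]
  obtain ⟨h1, h2, h3⟩ := TwiceDifferentiableAt.add hs (h 0) (h 1) hβ
  refine ⟨h1, fun i => ?_, fun i j => ?_⟩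
  · rw [h2, Fin.sum_univ_two, pderiv_foldRisk _ _ _ _ fun x => (hd x β hβ).1,
      pderiv_foldRisk _ _ _ _ fun x => (hd x β hβ).1]
  · rw [h3, Fin.sum_univ_two, hess_foldRisk _ _ _ _ hs hd hβ, hess_foldRisk _ _ _ _ hs hd hβ]

lemma crossFitRisk_sub (g : EuclideanSpace ℝ (Fin k) → 𝒳 → ℝ)
    (f r : Fin 2 → (Fin a → 𝒳 × ℝ) → (Fin b → 𝒳) → 𝒳 → ℝ)
    (z : Fin 2 → Fin a → 𝒳 × ℝ) (t : Fin 2 → Fin b → 𝒳) (β β' : EuclideanSpace ℝ (Fin k)) :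
    crossFitRisk g f r z t β - crossFitRisk g f r z t β' = ∑ ℓ,
      (-2 * score (g β') (f ℓ (z (1 - ℓ)) (t (1 - ℓ))) (r ℓ (z (1 - ℓ)) (t (1 - ℓ))) (z ℓ) (t ℓ)
        (fun x => g β x - g β' x) + sampleMean (t ℓ) fun x => (g β x - g β' x) ^ 2) := by
  rw [crossFitRisk, crossFitRisk, ← Finset.sum_sub_distrib]
  exact Finset.sum_congr rfl fun ℓ _ => foldRisk_sub _ _ _ _ _ _ _

lemma measurable_foldRisk {Ω : Type*} [MeasurableSpace Ω] [MeasurableSpace 𝒳]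
    {g : EuclideanSpace ℝ (Fin k) → 𝒳 → ℝ} {β : EuclideanSpace ℝ (Fin k)} (hg : Measurable (g β))
    {f r : Ω → 𝒳 → ℝ} (hf : Measurable (Function.uncurry f)) (hr : Measurable (Function.uncurry r))
    {z : Fin a → Ω → 𝒳 × ℝ} (hz : ∀ i, Measurable (z i)) {t : Fin b → Ω → 𝒳}
    (ht : ∀ j, Measurable (t j)) :
    Measurable fun ω => foldRisk g (f ω) (r ω) (fun i => z i ω) (fun j => t j ω) β := by
  unfold foldRisk
  have h1 : ∀ {x : Ω → 𝒳}, Measurable x → Measurable fun ω => f ω (x ω) := fun hx =>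
    hf.comp (measurable_id.prodMk hx)
  have h2 : ∀ {x : Ω → 𝒳}, Measurable x → Measurable fun ω => r ω (x ω) := fun hx =>
    hr.comp (measurable_id.prodMk hx)
  refine ((Finset.measurable_sum _ fun i _ => ?_).const_mul _).add
    ((Finset.measurable_sum _ fun j _ => ?_).const_mul _)
  · have hx := measurable_fst.comp (hz i)
    exact ((((measurable_snd.comp (hz i)).sub (hg.comp hx)).pow_const 2).sub
      (((h1 hx).sub (hg.comp hx)).pow_const 2)).mul (h2 hx)
  · exact ((h1 (ht j)).sub (hg.comp (ht j))).pow_const 2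

lemma measurable_crossFitRisk {Ω : Type*} [MeasurableSpace Ω] [MeasurableSpace 𝒳]
    {g : EuclideanSpace ℝ (Fin k) → 𝒳 → ℝ} {β : EuclideanSpace ℝ (Fin k)} (hg : Measurable (g β))
    {f r : Fin 2 → (Fin a → 𝒳 × ℝ) → (Fin b → 𝒳) → 𝒳 → ℝ}
    (hf : ∀ ℓ, Measurable fun v : ((Fin a → 𝒳 × ℝ) × (Fin b → 𝒳)) × 𝒳 => f ℓ v.1.1 v.1.2 v.2)
    (hr : ∀ ℓ, Measurable fun v : ((Fin a → 𝒳 × ℝ) × (Fin b → 𝒳)) × 𝒳 => r ℓ v.1.1 v.1.2 v.2)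
    {z : Fin 2 → Fin a → Ω → 𝒳 × ℝ} (hz : ∀ ℓ i, Measurable (z ℓ i)) {t : Fin 2 → Fin b → Ω → 𝒳}
    (ht : ∀ ℓ j, Measurable (t ℓ j)) :
    Measurable fun ω => crossFitRisk g f r (fun ℓ i => z ℓ i ω) (fun ℓ j => t ℓ j ω) β := by
  refine Finset.measurable_sum _ fun ℓ _ => ?_
  have haux : Measurable fun v : Ω × 𝒳 =>
      (((fun i => z (1 - ℓ) i v.1 : Fin a → 𝒳 × ℝ), (fun j => t (1 - ℓ) j v.1 : Fin b → 𝒳)), v.2) :=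
    ((measurable_pi_lambda _ fun i => (hz _ i).comp measurable_fst).prodMk
      (measurable_pi_lambda _ fun j => (ht _ j).comp measurable_fst)).prodMk measurable_snd
  exact measurable_foldRisk hg
    (f := fun ω => f ℓ (fun i => z (1 - ℓ) i ω) (fun j => t (1 - ℓ) j ω))
    (r := fun ω => r ℓ (fun i => z (1 - ℓ) i ω) (fun j => t (1 - ℓ) j ω))
    ((hf ℓ).comp haux) ((hr ℓ).comp haux) (hz ℓ) (ht ℓ)

end CrossFit

/-! ### Hessian limit and asymptotic normality -/

section Assembly

variable {Ω : Type*} [MeasurableSpace Ω] {𝒳 : Type*} [MeasurableSpace 𝒳]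
  {P : Measure Ω} [IsProbabilityMeasure P] {p q : Measure 𝒳} [IsProbabilityMeasure p]
  [IsProbabilityMeasure q] {w : Kernel 𝒳 ℝ} [IsMarkovKernel w] {r₀ m : 𝒳 → ℝ}
  {K ρ : ℝ} {a b : ℕ → ℕ} {E : ℕ → Type*} [∀ N, MeasurableSpace (E N)] {k : ℕ}
  {X : Fin 2 → ∀ N, Fin (a N) → Ω → 𝒳 × ℝ} {T : Fin 2 → ∀ N, Fin (b N) → Ω → 𝒳}
  {Z : Fin 2 → ∀ N, Ω → E N} {fh rh : Fin 2 → ∀ N, E N → 𝒳 → ℝ}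

/-- Each fold mean divides by `a = n / 2`, so adding two of them yields twice the full-sample mean.
-/
lemma sqrt_mul_sum_sampleMean {a : ℕ} {𝒲 : Type*} (x : Fin 2 → Fin a → 𝒲) (h : 𝒲 → ℝ) :
    Real.sqrt ((2 * a : ℕ) : ℝ) * ∑ ℓ, sampleMean (x ℓ) h =
      2 * ((Real.sqrt ((2 * a : ℕ) : ℝ))⁻¹ * ∑ s : Fin 2 × Fin a, h (x s.1 s.2)) := by
  rcases Nat.eq_zero_or_pos a with rfl | ha
  · simp [sampleMean]
  · simp only [sampleMean, ← Finset.mul_sum]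
    rw [Fintype.sum_prod_type]
    have h1 : (0 : ℝ) < ((2 * a : ℕ) : ℝ) := by exact_mod_cast (by omega : 0 < 2 * a)
    have h2 := Real.sqrt_pos.2 h1
    have h3 := Real.sq_sqrt h1.le
    have h4 : (0 : ℝ) < a := by exact_mod_cast ha
    have h5 : Real.sqrt ((2 * a : ℕ) : ℝ) * (1 / (a : ℝ)) = 2 * (Real.sqrt ((2 * a : ℕ) : ℝ))⁻¹ := by
      field_simp
      rw [h3]
      push_cast
      ring
    rw [← mul_assoc, h5, mul_assoc]

/-- The limit of the Hessian of the cross-fitted risk. -/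
lemma eq_four_mul_of_hess_tendsto
    (h : ∀ ℓ, IsCrossFitFold P p q w r₀ m K ρ a b (X ℓ) (T ℓ) (Z ℓ) (fh ℓ) (rh ℓ))
    {u u' v : 𝒳 → ℝ} (hu : Measurable u) (hu' : Measurable u') (hv : Measurable v) {B : ℝ}
    (huB : ∀ x, |u x| ≤ B) (huB' : ∀ x, |u' x| ≤ B) (hvB : ∀ x, |v x| ≤ B) {c : ℝ}
    (hc : IsLittleOpOne P fun N ω => ‖(∑ ℓ, (-2 * score m (fh ℓ N (Z ℓ N ω)) (rh ℓ N (Z ℓ N ω))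
      (fun i => X ℓ N i ω) (fun j => T ℓ N j ω) v +
        2 * sampleMean (fun j => T ℓ N j ω) fun x => u x * u' x)) - c‖ₑ) :
    c = 4 * ∫ x, u x * u' x ∂q := by
  refine eq_of_isLittleOpOne hc ?_
  have h1 := fun ℓ => (h ℓ).isLittleOpOne_score hv hvB
  have h2 := fun ℓ => (h ℓ).test.isLittleOpOne_sampleMean_sub_of_bounded (hu.mul hu') (B := B * B)
    (ae_of_all _ fun x => by
      rw [Pi.mul_apply, abs_mul]
      exact mul_le_mul (huB x) (huB' x) (abs_nonneg _) ((abs_nonneg _).trans (huB x)))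
  refine (IsLittleOpOne.sum Finset.univ fun ℓ _ => ((h1 ℓ).const_mul (c := ‖(-2 : ℝ)‖ₑ)
    enorm_ne_top).add ((h2 ℓ).const_mul (c := ‖(2 : ℝ)‖ₑ) enorm_ne_top)).mono fun N ω => ?_
  -- The factor `4` is two folds times the `2` from differentiating the square twice; the
  -- second-derivative part of the Hessian is a score and vanishes.
  have e : 4 * ∫ x, u x * u' x ∂q = ∑ _ℓ : Fin 2, 2 * ∫ x, u x * u' x ∂q := by
    rw [Fin.sum_univ_two]
    ring
  rw [e, ← Finset.sum_sub_distrib]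
  refine (enorm_sum_le _ _).trans (Finset.sum_le_sum fun ℓ _ => ?_)
  rw [← enorm_mul, ← enorm_mul, add_sub_assoc, ← mul_sub]
  exact enorm_add_le _ _

end Assembly

section Assembly

variable {Ω : Type*} [MeasurableSpace Ω] {𝒳 : Type*} [MeasurableSpace 𝒳]
  {P : Measure Ω} [IsProbabilityMeasure P] {p q : Measure 𝒳} [IsProbabilityMeasure p]
  [IsProbabilityMeasure q] {w : Kernel 𝒳 ℝ} [IsMarkovKernel w] {r₀ m : 𝒳 → ℝ}
  {K ρ : ℝ} {a b : ℕ → ℕ} {E : ℕ → Type*} [∀ N, MeasurableSpace (E N)] {k : ℕ}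
  {X : Fin 2 → ∀ N, Fin (a N) → Ω → 𝒳 × ℝ} {T : Fin 2 → ∀ N, Fin (b N) → Ω → 𝒳}
  {Z : Fin 2 → ∀ N, Ω → E N} {fh rh : Fin 2 → ∀ N, E N → 𝒳 → ℝ}

/-- Asymptotic normality of an estimator that is asymptotically linear in the cross-fitted
scores. -/
theorem tendstoInDistribution_of_linear_in_scores
    (h : ∀ ℓ, IsCrossFitFold P p q w r₀ m K ρ a b (X ℓ) (T ℓ) (Z ℓ) (fh ℓ) (rh ℓ))
    (hind : ∀ N, iIndepFun (fun s : Fin 2 × Fin (a N) => X s.1 N s.2) P)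
    {u : Fin k → 𝒳 → ℝ} (hu : ∀ i, Measurable (u i)) {B : ℝ} (huB : ∀ i x, |u i x| ≤ B)
    {A : Matrix (Fin k) (Fin k) ℝ} {δ : ℕ → Ω → EuclideanSpace ℝ (Fin k)}
    (hδ : ∀ N, Measurable (δ N))
    (hlin : ∀ i, IsLittleOpOne P fun N ω => ‖Real.sqrt ((2 * a N : ℕ) : ℝ) *
      (δ N ω i - ∑ j, (1 / 4 * A i j) * ∑ ℓ, -2 * score m (fh ℓ N (Z ℓ N ω)) (rh ℓ N (Z ℓ N ω))
        (fun i => X ℓ N i ω) (fun j => T ℓ N j ω) (u j))‖ₑ) :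
    TendstoInDistribution (fun N ω => Real.sqrt ((2 * a N : ℕ) : ℝ) • δ N ω) atTop
      (id : EuclideanSpace ℝ (Fin k) → EuclideanSpace ℝ (Fin k)) (fun _ => P)
      (multivariateGaussian 0 (A * (Matrix.of fun i j =>
        ∫ x, (condVar w x * r₀ x) * (u i x * u j x) ∂q) * A.transpose)) := by
  have h0 := h 0
  have hom : ∀ j, Measurable (oracle m r₀ (u j)) := fun j => h0.measurable_oracle (hu j)
  have hoL : ∀ j, MemLp (oracle m r₀ (u j)) 2 (p ⊗ₘ w) := fun j =>
    MemLp.of_bound (hom j).aestronglyMeasurable _ (h0.abs_oracle_le (huB j))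
  have hmom : momentMatrix (p ⊗ₘ w) (influence m r₀ A u) = A * (Matrix.of fun i j =>
        ∫ x, (condVar w x * r₀ x) * (u i x * u j x) ∂q) * A.transpose :=
    momentMatrix_influence (fun i j => (hoL i).integrable_mul (hoL j)) fun i j =>
      integral_oracle_mul_oracle h0.abs_outcome_le h0.measurable_ratio h0.ratio_nonneg h0.ratio_le
        h0.density h0.measurable_m h0.abs_m_le h0.regressionFn_eq (hu i) (hu j) (huB i) (huB j)
  have hcoordL : ∀ i, MemLp (fun v => influence m r₀ A u v i) 2 (p ⊗ₘ w) := fun i =>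
    (memLp_finsetSum _ fun j _ => (hoL j).const_mul (A i j)).neg
  have hinfl : Measurable (influence m r₀ A u) :=
    (WithLp.measurable_toLp 2 _).comp (measurable_pi_lambda _ fun i =>
      (Finset.measurable_sum _ fun j _ => (hom j).const_mul _).neg)
  have hclt := tendstoInDistribution_inv_sqrt_smul_sum (P := P) (μ := p ⊗ₘ w)
    (ι := fun N => Fin 2 × Fin (a N)) (X := fun N s => X s.1 N s.2)
    (ξ := influence m r₀ A u) (fun N s => (h s.1).train.measurable N s.2)
    (fun N s => (h s.1).train.map_eq N s.2) hind
    (by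
      simp only [Fintype.card_prod, Fintype.card_fin]
      exact tendsto_atTop_mono (fun N => by omega) h0.train.tendsto_size)
    hinfl hcoordL (fun i => by
      simp only [influence]
      rw [integral_neg, integral_finsetSum _ fun j _ =>
        ((hoL j).integrable (by norm_num)).const_mul _]
      simp [integral_const_mul, h0.integral_oracle])
  rw [hmom] at hclt
  simp only [Fintype.card_prod, Fintype.card_fin] at hclt
  -- Slutsky's lemma: only the difference from the normalized sum of influence functions has to
  -- vanish in probability.
  refine tendstoInDistribution_of_tendstoInMeasure_sub _ _ hclt ?_ fun N => ?_
  swap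
  · have := hδ N
    fun_prop
  refine tendstoInMeasure_iff_isLittleOpOne.2 ?_
  have hsc : ∀ i, IsLittleOpOne P fun N ω => ∑ j, ‖(-(1 / 2)) * A i j‖ₑ * ∑ ℓ,
      ‖Real.sqrt ((2 * a N : ℕ) : ℝ) *
      (score m (fh ℓ N (Z ℓ N ω)) (rh ℓ N (Z ℓ N ω)) (fun i => X ℓ N i ω) (fun j => T ℓ N j ω)
        (u j) - sampleMean (fun i => X ℓ N i ω) (oracle m r₀ (u j)))‖ₑ := fun i =>
    IsLittleOpOne.sum _ fun j _ => (IsLittleOpOne.sum _ fun ℓ _ =>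
      (h ℓ).isLittleOpOne_sqrt_mul_score_sub (hu j) (huB j)).const_mul enorm_ne_top
  refine (IsLittleOpOne.sum Finset.univ fun i _ => (hlin i).add (hsc i)).mono fun N ω => ?_
  refine (enorm_le_sum_enorm _).trans (Finset.sum_le_sum fun i _ => ?_)
  set c := Real.sqrt ((2 * a N : ℕ) : ℝ) with hc
  set S : Fin 2 → Fin k → ℝ := fun ℓ j => score m (fh ℓ N (Z ℓ N ω)) (rh ℓ N (Z ℓ N ω))
    (fun i => X ℓ N i ω) (fun j => T ℓ N j ω) (u j) with hS
  set O : Fin 2 → Fin k → ℝ := fun ℓ j =>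
    sampleMean (fun i => X ℓ N i ω) (oracle m r₀ (u j)) with hO
  -- The constants balance: `1 / 4` (the inverse Hessian scale) times `-2` (the gradient) is `-1 /
  -- 2`, and the sum of two fold means restores the factor `2`, leaving `-A`.
  have hsum : ∀ j, c⁻¹ * ∑ s : Fin 2 × Fin (a N), oracle m r₀ (u j) (X s.1 N s.2 ω) =
      1 / 2 * (c * ∑ ℓ, O ℓ j) := by
    intro j
    have := sqrt_mul_sum_sampleMean (fun ℓ i => X ℓ N i ω) (oracle m r₀ (u j))
    rw [hc, hO, this]
    ring
  have hcoord : (c⁻¹ • ∑ s : Fin 2 × Fin (a N), influence m r₀ A u (X s.1 N s.2 ω)) i =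
      -∑ j, A i j * (1 / 2 * (c * ∑ ℓ, O ℓ j)) := by
    simp only [← hsum, PiLp.smul_apply, WithLp.ofLp_sum, Finset.sum_apply, influence, smul_eq_mul,
      Finset.sum_neg_distrib]
    rw [Finset.sum_comm, mul_neg, Finset.mul_sum]
    congr 1
    refine Finset.sum_congr rfl fun j _ => ?_
    rw [← Finset.mul_sum]
    ring
  have key : (c • δ N ω -
        c⁻¹ • ∑ s : Fin 2 × Fin (a N), influence m r₀ A u (X s.1 N s.2 ω)) i =
      c * (δ N ω i - ∑ j, (1 / 4 * A i j) * ∑ ℓ, -2 * S ℓ j) +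
        ∑ j, (-(1 / 2) * A i j) * ∑ ℓ, c * (S ℓ j - O ℓ j) := by
    rw [PiLp.sub_apply, hcoord, mul_sub, Finset.mul_sum, sub_neg_eq_add, sub_add,
      ← Finset.sum_sub_distrib, PiLp.smul_apply, smul_eq_mul, sub_eq_add_neg,
      ← Finset.sum_neg_distrib]
    congr 1
    refine Finset.sum_congr rfl fun j _ => ?_
    simp only [Fin.sum_univ_two]
    ring
  have hbound : ‖(c • δ N ω -
      c⁻¹ • ∑ s : Fin 2 × Fin (a N), influence m r₀ A u (X s.1 N s.2 ω)) i‖ₑ ≤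
      ‖c * (δ N ω i - ∑ j, (1 / 4 * A i j) * ∑ ℓ, -2 * S ℓ j)‖ₑ +
        ∑ j, ‖(-(1 / 2)) * A i j‖ₑ * ∑ ℓ, ‖c * (S ℓ j - O ℓ j)‖ₑ := by
    rw [key]
    refine (enorm_add_le _ _).trans (add_le_add le_rfl ((enorm_sum_le _ _).trans
      (Finset.sum_le_sum fun j _ => ?_)))
    rw [enorm_mul]
    gcongr
    exact enorm_sum_le _ _
  simp only [Pi.zero_apply, sub_zero]
  exact hbound

end Assembly
end CovariateShift
end

/-! ### The main theorem -/

theorem theorem1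
    {d k : ℕ} (𝒳 : Set (EuclideanSpace ℝ (Fin d)))
    -- the two covariate laws and the common conditional law of the outcome
    (p q : Measure 𝒳) [IsProbabilityMeasure p] [IsProbabilityMeasure q]
    (w : Kernel 𝒳 ℝ) [IsMarkovKernel w]
    -- bounded data
    (hbdd : ∃ C : ℝ, 0 < C ∧
      (∀ᵐ z ∂(p ⊗ₘ w), |z.2| < C ∧ ∀ i, |(z.1 : EuclideanSpace ℝ (Fin d)) i| < C) ∧
      (∀ᵐ z ∂(q ⊗ₘ w), |z.2| < C ∧ ∀ i, |(z.1 : EuclideanSpace ℝ (Fin d)) i| < C))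
    -- the density ratio `r₀ = dq/dp` exists and is bounded
    (r₀ : 𝒳 → ℝ) (hr₀ : Measurable r₀)
    (hq : q = p.withDensity fun x => ENNReal.ofReal (r₀ x))
    (hr₀_bdd : ∃ Cr : ℝ, ∀ x, 0 ≤ r₀ x ∧ r₀ x < Cr)
    -- the parametric model
    (Θ : Set (EuclideanSpace ℝ (Fin k))) (hΘ : IsCompact Θ)
    (g : EuclideanSpace ℝ (Fin k) → 𝒳 → ℝ)
    (hg_meas : ∀ β ∈ Θ, Measurable (g β))
    (hg_cont : ∀ x, ContinuousOn (fun β => g β x) Θ)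
    (hg_diff : ∀ x, ∀ β ∈ interior Θ, CovariateShift.TwiceDifferentiableAt (fun b => g b x) β)
    (hg_bdd : ∃ B : ℝ, ∀ β ∈ Θ, ∀ x, |g β x| ≤ B)
    -- `β₀` minimizes the train risk, `βt` is the unique minimizer of the test risk
    (β₀ βt : EuclideanSpace ℝ (Fin k))
    (hβ₀ : CovariateShift.IsArgmin (CovariateShift.popRisk p w g) Θ β₀)
    (hβt : ∀ β, CovariateShift.IsArgmin (CovariateShift.popRisk q w g) Θ β ↔ β = βt)
    (hβt_int : βt ∈ interior Θ)
    (hg_bdd' : ∃ B : ℝ, ∀ x i j, |CovariateShift.pderiv i (fun b => g b x) βt| ≤ B ∧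
      |CovariateShift.hess (fun b => g b x) βt i j| ≤ B)
    -- correct specification
    (hspec : ∃ β ∈ Θ, CovariateShift.regressionFn w =ᵐ[p] g β)
    -- fold sizes `a N`, `b N`; the sample sizes are `n = 2 a N` and `m = 2 b N`
    (a b : ℕ → ℕ) (ρ : ℝ) (hρ : 0 < ρ) (ha : Tendsto a atTop atTop)
    (hab : ∀ N, ((2 * b N : ℕ) : ℝ) = ρ * ((2 * a N : ℕ) : ℝ))
    -- the data: at each stage, two independent i.i.d. samples, each split into two folds
    {Ω : Type*} [MeasurableSpace Ω] (P : Measure Ω) [IsProbabilityMeasure P]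
    (train : ∀ N, Fin 2 → Fin (a N) → Ω → 𝒳 × ℝ)
    (test : ∀ N, Fin 2 → Fin (b N) → Ω → 𝒳)
    (htrain_meas : ∀ N ℓ i, Measurable (train N ℓ i))
    (htest_meas : ∀ N ℓ j, Measurable (test N ℓ j))
    (htrain_law : ∀ N ℓ i, P.map (train N ℓ i) = p ⊗ₘ w)
    (htest_law : ∀ N ℓ j, P.map (test N ℓ j) = q)
    (htrain_indep : ∀ N, iIndepFun (fun (s : Fin 2 × Fin (a N)) => train N s.1 s.2) P)
    (htest_indep : ∀ N, iIndepFun (fun (s : Fin 2 × Fin (b N)) => test N s.1 s.2) P)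
    (hindep : ∀ N, IndepFun (fun ω (s : Fin 2 × Fin (a N)) => train N s.1 s.2 ω)
      (fun ω (s : Fin 2 × Fin (b N)) => test N s.1 s.2 ω) P)
    -- the nuisance estimators, as functions of the data of one fold
    (fhat rhat : ∀ N, Fin 2 → (Fin (a N) → 𝒳 × ℝ) → (Fin (b N) → 𝒳) → 𝒳 → ℝ)
    (hfhat_meas : ∀ N ℓ, Measurable fun v : ((Fin (a N) → 𝒳 × ℝ) × (Fin (b N) → 𝒳)) × 𝒳 =>
      fhat N ℓ v.1.1 v.1.2 v.2)
    (hrhat_meas : ∀ N ℓ, Measurable fun v : ((Fin (a N) → 𝒳 × ℝ) × (Fin (b N) → 𝒳)) × 𝒳 =>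
      rhat N ℓ v.1.1 v.1.2 v.2)
    -- `F N ℓ ω`, `R N ℓ ω`: the estimates used on fold `ℓ`, computed from the other fold
    (F R : ℕ → Fin 2 → Ω → 𝒳 → ℝ)
    (hF : ∀ N ℓ ω, F N ℓ ω =
      fhat N ℓ (fun i => train N (1 - ℓ) i ω) (fun j => test N (1 - ℓ) j ω))
    (hR : ∀ N ℓ ω, R N ℓ ω =
      rhat N ℓ (fun i => train N (1 - ℓ) i ω) (fun j => test N (1 - ℓ) j ω))
    -- convergence of the nuisance estimators in `L²(p)`
    (hR_conv : ∀ ℓ, CovariateShift.IsLittleOpOne P fun N ω =>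
      eLpNorm (fun x => R N ℓ ω x - r₀ x) 2 p)
    (hF_conv : ∀ ℓ, CovariateShift.IsLittleOpOne P fun N ω =>
      eLpNorm (fun x => F N ℓ ω x - CovariateShift.regressionFn w x) 2 p)
    (hRF_conv : ∀ ℓ, CovariateShift.IsLittleOpOne P fun N ω =>
      ENNReal.ofReal (Real.sqrt (min (2 * a N : ℕ) (2 * b N : ℕ) : ℕ)) *
        (eLpNorm (fun x => R N ℓ ω x - r₀ x) 2 p *
          eLpNorm (fun x => F N ℓ ω x - CovariateShift.regressionFn w x) 2 p))
    -- the cross-fitted empirical risk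
    (risk : ℕ → Ω → EuclideanSpace ℝ (Fin k) → ℝ)
    (hrisk : ∀ N ω, risk N ω = CovariateShift.crossFitRisk g (fhat N) (rhat N)
      (fun ℓ i => train N ℓ i ω) (fun ℓ j => test N ℓ j ω))
    -- the Hessian of the empirical risk converges in probability to an invertible matrix along
    -- every sequence of random parameters that is consistent for `βt`
    (D : Matrix (Fin k) (Fin k) ℝ) (hD : IsUnit D.det)
    (hhess : ∀ βs : ℕ → Ω → EuclideanSpace ℝ (Fin k), (∀ N, Measurable (βs N)) →
      (∀ N ω, βs N ω ∈ interior Θ) → TendstoInMeasure P βs atTop (fun _ => βt) →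
      ∀ i j, TendstoInMeasure P (fun N ω => CovariateShift.hess (risk N ω) (βs N ω) i j) atTop
        (fun _ => D.transpose i j))
    -- the doubly robust estimator
    (βhat : ℕ → Ω → EuclideanSpace ℝ (Fin k)) (hβhat_meas : ∀ N, Measurable (βhat N))
    (hβhat : ∀ N, ∀ᵐ ω ∂P, CovariateShift.IsArgmin (risk N ω) Θ (βhat N ω)) :
    IsUnit (CovariateShift.gramMatrix q g β₀ fun _ => 1).det ∧
    TendstoInDistribution
      (fun N ω => Real.sqrt (2 * a N : ℕ) • (β₀ - βhat N ω)) atTop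
      (id : EuclideanSpace ℝ (Fin k) → EuclideanSpace ℝ (Fin k)) (fun _ => P)
      (multivariateGaussian 0 (CovariateShift.asymptoticCov q w r₀ g β₀)) := by
  open CovariateShift in
  classical
  obtain ⟨C, hC0, hbp, hbq⟩ := hbdd
  obtain ⟨Cr, hCr⟩ := hr₀_bdd
  obtain ⟨B, hB⟩ := hg_bdd
  obtain ⟨B', hB'⟩ := hg_bdd'
  -- One constant bounds the outcome, the model and the density ratio.
  set K := max C (max B Cr) with hKdef
  have hyp : ∀ᵐ z ∂(p ⊗ₘ w), |z.2| ≤ K := by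
    filter_upwards [hbp] with z hz
    exact hz.1.le.trans (le_max_left _ _)
  have hyq : ∀ᵐ z ∂(q ⊗ₘ w), |z.2| ≤ K := by
    filter_upwards [hbq] with z hz
    exact hz.1.le.trans (le_max_left _ _)
  have hgK : ∀ β ∈ Θ, ∀ x, |g β x| ≤ K := fun β hβ x =>
    (hB β hβ x).trans ((le_max_left _ _).trans (le_max_right _ _))
  have hrK : ∀ x, r₀ x ≤ K := fun x =>
    (hCr x).2.le.trans ((le_max_right _ _).trans (le_max_right _ _))
  have hqp : q ≪ p := hq ▸ withDensity_absolutelyContinuous _ _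
  have hspecq : ∃ β ∈ Θ, regressionFn w =ᵐ[q] g β := by
    obtain ⟨β, hβ, h⟩ := hspec
    exact ⟨β, hβ, hqp.ae_le h⟩
  have hβ₀' := (isArgmin_popRisk_iff hyp hg_meas hgK hspec β₀).1 hβ₀
  -- Equality with the regression function passes from `p`-a.e. to `q`-a.e., so `β₀` is a test
  -- minimizer and uniqueness applies.
  have heq : β₀ = βt := (hβt β₀).1
    ((isArgmin_popRisk_iff hyq hg_meas hgK hspecq β₀).2 ⟨hβ₀'.1, hqp.ae_le hβ₀'.2⟩)
  subst heq
  have hβΘ : β₀ ∈ Θ := hβ₀'.1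
  set m : 𝒳 → ℝ := g β₀ with hm
  have hmm : Measurable m := hg_meas _ hβΘ
  have hsep : ∀ β ∈ Θ, β ≠ β₀ → 0 < ∫ x, (g β x - m x) ^ 2 ∂q := by
    intro β hβ hne
    refine lt_of_le_of_ne (integral_nonneg fun _ => sq_nonneg _) fun hzero => hne ?_
    refine (hβt β).1 ((isArgmin_popRisk_iff hyq hg_meas hgK hspecq β).2 ⟨hβ, ?_⟩)
    have hint : Integrable (fun x => (g β x - m x) ^ 2) q := by
      refine Integrable.of_bound (((hg_meas β hβ).sub hmm).pow_const 2).aestronglyMeasurable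
        ((K + K) ^ 2) (ae_of_all _ fun x => ?_)
      rw [norm_pow, Real.norm_eq_abs]
      gcongr
      exact (abs_sub _ _).trans (add_le_add (hgK β hβ x) (hgK _ hβΘ x))
    have h1 := (integral_eq_zero_iff_of_nonneg (fun _ => sq_nonneg _) hint).1 hzero.symm
    filter_upwards [h1, hqp.ae_le hβ₀'.2] with x hx hx'
    have : g β x - m x = 0 := by simpa using hx
    rw [hx']
    linarith
  have hb : Tendsto b atTop atTop := by
    rw [← tendsto_natCast_atTop_iff (R := ℝ)]
    have h1 : (fun N => (b N : ℝ)) = fun N => ρ * (a N : ℝ) := by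
      ext N
      have := hab N
      push_cast at this
      linarith
    rw [h1]
    exact (tendsto_natCast_atTop_iff.2 ha).const_mul_atTop hρ
  let Z : Fin 2 → ∀ N, Ω → (Fin (a N) → 𝒳 × ℝ) × (Fin (b N) → 𝒳) := fun ℓ N ω =>
    (fun i => train N (1 - ℓ) i ω, fun j => test N (1 - ℓ) j ω)
  have hZm : ∀ ℓ N, Measurable (Z ℓ N) := fun ℓ N =>
    (measurable_pi_lambda _ fun i => htrain_meas N _ i).prodMk
      (measurable_pi_lambda _ fun j => htest_meas N _ j)
  let fh : Fin 2 → ∀ N, (Fin (a N) → 𝒳 × ℝ) × (Fin (b N) → 𝒳) → 𝒳 → ℝ :=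
    fun ℓ N e => fhat N ℓ e.1 e.2
  let rh : Fin 2 → ∀ N, (Fin (a N) → 𝒳 × ℝ) × (Fin (b N) → 𝒳) → 𝒳 → ℝ :=
    fun ℓ N e => rhat N ℓ e.1 e.2
  -- The regression function is traded for its version `m = g β₀`, which is bounded everywhere and
  -- not merely almost everywhere.
  have hFm : ∀ ℓ N ω, eLpNorm (fun x => F N ℓ ω x - regressionFn w x) 2 p =
      eLpNorm (fun x => fh ℓ N (Z ℓ N ω) x - m x) 2 p := by
    intro ℓ N ω
    refine eLpNorm_congr_ae ?_
    filter_upwards [hβ₀'.2] with x hx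
    rw [hx, hF]
  have hRm : ∀ ℓ N ω, eLpNorm (fun x => R N ℓ ω x - r₀ x) 2 p =
      eLpNorm (fun x => rh ℓ N (Z ℓ N ω) x - r₀ x) 2 p := by
    intro ℓ N ω
    rw [hR]
  simp only [hFm, hRm] at hR_conv hF_conv hRF_conv
  have hfold : ∀ ℓ, IsCrossFitFold P p q w r₀ m K ρ a b (fun N => train N ℓ)
      (fun N => test N ℓ) (Z ℓ) (fh ℓ) (rh ℓ) := by
    intro ℓ
    refine
      { train := ⟨fun N => htrain_meas N ℓ, fun N => htrain_law N ℓ, fun N => ?_, hZm ℓ,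
          fun N => ?_, ha⟩
        test := ⟨fun N => htest_meas N ℓ, fun N => htest_law N ℓ, fun N => ?_, hZm ℓ,
          fun N => ?_, hb⟩
        pos := hρ
        size := hab
        abs_outcome_le := hyp
        measurable_ratio := hr₀
        ratio_nonneg := fun x => (hCr x).1
        ratio_le := hrK
        density := hq
        measurable_m := hmm
        abs_m_le := hgK _ hβΘ
        regressionFn_eq := hβ₀'.2
        measurable_f := fun N => hfhat_meas N ℓ
        measurable_r := fun N => hrhat_meas N ℓ
        ratio_conv := hR_conv ℓ
        regression_conv := hF_conv ℓ
        product_conv := hRF_conv ℓ }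
    · exact (htrain_indep N).precomp (g := fun i => (ℓ, i)) (Prod.mk_right_injective ℓ)
    · exact indepFun_aux_fold (htrain_meas N) (htest_meas N) (htrain_indep N) (hindep N) ℓ
    · exact (htest_indep N).precomp (g := fun i => (ℓ, i)) (Prod.mk_right_injective ℓ)
    · exact (indepFun_aux_fold (htest_meas N) (htrain_meas N) (htest_indep N)
        (hindep N).symm ℓ).comp measurable_swap measurable_id
  have hcalc := fun N ω (β : EuclideanSpace ℝ (Fin k)) (hβ : β ∈ interior Θ) =>
    crossFitRisk_calculus (fhat N) (rhat N) (fun ℓ i => train N ℓ i ω) (fun ℓ j => test N ℓ j ω)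
      isOpen_interior hg_diff hβ
  have hdiff : ∀ N ω, ∀ β ∈ interior Θ, TwiceDifferentiableAt (risk N ω) β := fun N ω β hβ => by
    rw [hrisk]
    exact (hcalc N ω β hβ).1
  have hmeas : ∀ N, ∀ β ∈ Θ, Measurable fun ω => risk N ω β := fun N β hβ => by
    simp only [hrisk]
    exact measurable_crossFitRisk (hg_meas β hβ) (hfhat_meas N) (hrhat_meas N) (htrain_meas N)
      (htest_meas N)
  set u : Fin k → 𝒳 → ℝ := fun i x => pderiv i (fun b => g b x) β₀ with hu
  have hum : ∀ i, Measurable (u i) := fun i =>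
    measurable_pderiv hg_meas hβt_int (fun x => (hg_diff x _ hβt_int).1) i
  -- The measurability lemma is iterated; the second time the parameter set is `interior Θ`, where
  -- first derivatives exist and are measurable.
  have hhm : ∀ i j, Measurable fun x => hess (fun b => g b x) β₀ i j := fun i j =>
    measurable_pderiv (F := fun β x => pderiv i (fun b => g b x) β) (Θ := interior Θ)
      (fun β hβ => measurable_pderiv hg_meas hβ (fun x => (hg_diff x _ hβ).1) i)
      (by rwa [interior_interior])
      (fun x => (hg_diff x _ hβt_int).differentiableAt_pderiv i) j
  have huB : ∀ i x, |u i x| ≤ B' := fun i x => (hB' x i i).1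
  have hcons : IsLittleOpOne P fun N ω => ‖βhat N ω - β₀‖ₑ :=
    isLittleOpOne_argmin_sub hfold hΘ hg_meas hg_cont hgK hβΘ hsep
      (fun N ω β => by rw [hrisk, crossFitRisk_sub]) hβhat
  set G := gramMatrix q g β₀ fun _ => 1 with hG
  -- The constant sequence `β₀` is consistent, and there the Hessian limit can be computed directly.
  -- Uniqueness of limits in probability gives `Dᵀ = 4 G`.
  have hD4 : ∀ i j, D.transpose i j = 4 * G i j := by
    intro i j
    have h1 := hhess (fun _ _ => β₀) (fun _ => measurable_const) (fun _ _ => hβt_int)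
      (tendstoInMeasure_iff_isLittleOpOne.2 (by simpa using IsLittleOpOne.zero)) i j
    have h2 := tendstoInMeasure_iff_isLittleOpOne.1 h1
    have h3 := eq_four_mul_of_hess_tendsto hfold (hum i) (hum j) (hhm i j) (huB i) (huB j)
      (fun x => (hB' x i j).2) (c := D.transpose i j) (h2.mono fun N ω => by
        rw [hrisk, (hcalc N ω _ hβt_int).2.2 i j])
    rw [h3, hG]
    simp [gramMatrix, hu]
  have hDT : IsUnit D.transpose.det := by rwa [Matrix.det_transpose]
  have hDG : D.transpose = (4 : ℝ) • G := by
    ext i j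
    simpa using hD4 i j
  have hleft : ((4 : ℝ) • D.transpose⁻¹) * G = 1 := by
    rw [Matrix.smul_mul, ← Matrix.mul_smul, ← hDG, Matrix.nonsing_inv_mul _ hDT]
  have hGinv : G⁻¹ = (4 : ℝ) • D.transpose⁻¹ := Matrix.inv_eq_left_inv hleft
  have hGsymm : G⁻¹.transpose = G⁻¹ := by
    rw [Matrix.transpose_nonsing_inv]
    congr 1
    ext i j
    simp [hG, gramMatrix, mul_comm]
  refine ⟨Matrix.isUnit_det_of_left_inverse hleft, ?_⟩
  have hgradeq : ∀ N ω i, pderiv i (risk N ω) β₀ = ∑ ℓ, -2 * score m (fh ℓ N (Z ℓ N ω))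
      (rh ℓ N (Z ℓ N ω)) (fun i => train N ℓ i ω) (fun j => test N ℓ j ω) (u i) := by
    intro N ω i
    rw [hrisk, (hcalc N ω _ hβt_int).2.1 i]
  have hlin := isLittleOpOne_argmin_sub_inv_mulVec_grad hβt_int hmeas hdiff hDT hhess hβhat_meas
    hβhat hcons (c := fun N => Real.sqrt ((2 * a N : ℕ) : ℝ)) (fun i Y hY => by
      refine (IsLittleOpOne.sum Finset.univ fun ℓ _ =>
        ((hfold ℓ).isLittleOpOne_mul_sqrt_mul_score (hum i) (huB i) hY).const_mul
          (c := ‖(-2 : ℝ)‖ₑ) enorm_ne_top).mono fun N ω => ?_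
      rw [hgradeq, Finset.mul_sum]
      refine (mul_le_mul' le_rfl (enorm_sum_le _ _)).trans (le_of_eq ?_)
      rw [Finset.mul_sum]
      refine Finset.sum_congr rfl fun ℓ _ => ?_
      rw [mul_left_comm, enorm_mul, mul_left_comm])
  have hfinal := tendstoInDistribution_of_linear_in_scores hfold htrain_indep hum huB (A := G⁻¹)
    (δ := fun N ω => β₀ - βhat N ω) (fun N => measurable_const.sub (hβhat_meas N)) (fun i => by
      refine (hlin i).mono fun N ω => le_of_eq ?_
      congr 3
      refine Finset.sum_congr rfl fun j _ => ?_
      rw [hgradeq, hGinv]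
      simp)
  -- Symmetry of `G⁻¹` turns `A W Aᵀ` into the stated sandwich.
  rw [hGsymm] at hfinal
  exact hfinal
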